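/- For a homogeneous polynomial $p$ of degree $d$ in $m$ variables with real coefficients, let $\|p\|_{\ell_2}$ be the Euclidean norm of the entries of the unique symmetric tensor $A_p$ of order $d$ with $p(x)=\langle A_p,x^{\otimes d}\rangle$. For a subspace $V$ of the space $\mathbb R_{[d]}[x_1,\dots,x_m]$ of all such polynomials and $R,\delta>0$, let $$S(V,R,\delta)=\{x\in\mathbb R^m:\ \|x\|_2\le R\ \text{ and }\ |p(x)|\le\delta\,\|p\|_{\ell_2}\ \text{ for all } p\in V\}.$$ A set $\mathcal C\subseteq\mathbb R^m$ is an $\epsilon$-cover of $S$ if every point of $S$ is within Euclidean distance $\epsilon$ of a point of $\mathcal C$. **Theorem.** There are a universal constant $C>0$, a single deterministic algorithm and a univariate polynomial $q$ with the following property. Let $d,k,m\ge 1$ be integers, let $V\subseteq\mathbb R_{[d]}[x_1,\dots,x_m]$ be a subspace of codimension at most $k$, and let $R,\delta>0$ and $$\delta^{\frac{1}{(C+1)d}}\,(2Rdkm)^{\frac{C}{C+1}}\ \le\ \epsilon\ \le\ R .$$ Given $d,k,m,R,\epsilon,\delta$ and any basis of $V$ (each polynomial as the list of its terms: all exponent vectors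 of degree $d$ in lexicographic order, with their coefficients), the algorithm computes a finite list of at most $$M=\bigl(2(R/\epsilon)\,d\,k\,m\bigr)^{C^2d^2k^{1/d}}$$ points of $\mathbb R^m$ that form an $\epsilon$-cover of $S(V,R,\delta)$, and it halts after at most $q(M)$ steps. Here algorithms are uniform programs for a real-number machine (real RAM): they operate on finite pointer structures (binary trees) with real numbers at the leaves, using sequential composition, branching and while loops; each step costs one unit and is an arithmetic operation ($+,-,\times,/$), a square root, a comparison of two real numbers, the writing of a rational constant, or an elementary pointer operation. -/

import Mathlib

namespace NearZeroCover

/-! ### Homogeneous polynomials, their norm, and their near-zero sets -/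

section Polynomials

variable {m : ℕ}

/-- The exponent vector of the monomial `x_{α 0} x_{α 1} ⋯ x_{α (d-1)}`. -/
noncomputable def indexCount {d : ℕ} (α : Fin d → Fin m) : Fin m →₀ ℕ :=
  ∑ i, Finsupp.single (α i) 1

/-- The symmetric tensor `A_p` of order `d` and dimension `m` attached to a homogeneous polynomial
`p` of degree `d`, i.e. the one with `p(x) = ⟨A_p, x^{⊗ d}⟩` (see `eval_eq_symTensor`).  Its entry at `α` is the coefficient of `x_{α 0} ⋯ x_{α (d-1)}` in `p`
divided by the number of tuples that give this monomial. -/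
noncomputable def symTensor (d : ℕ) (p : MvPolynomial (Fin m) ℝ) (α : Fin d → Fin m) : ℝ :=
  p.coeff (indexCount α) / ((indexCount α).multinomial : ℝ)

/-- The `ℓ₂`-norm of a homogeneous polynomial of degree `d`: the Euclidean norm of the entries of
its symmetric tensor. -/
noncomputable def polyNorm (d : ℕ) (p : MvPolynomial (Fin m) ℝ) : ℝ :=
  Real.sqrt (∑ α : Fin d → Fin m, symTensor d p α ^ 2)

/-- `S(V, R, δ)`: the points of the ball of radius `R` at which every `p ∈ V` is at most
`δ ‖p‖` in absolute value. -/
def nearZeroSet (d : ℕ) (V : Submodule ℝ (MvPolynomial (Fin m) ℝ)) (R δ : ℝ) :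
    Set (EuclideanSpace ℝ (Fin m)) :=
  {x | ‖x‖ ≤ R ∧ ∀ p ∈ V, |MvPolynomial.eval (fun i => x i) p| ≤ δ * polyNorm d p}

/-- The number of tuples with a given exponent vector is the multinomial coefficient. -/
theorem card_indexCount {d : ℕ} (a : Fin m →₀ ℕ) (ha : a.degree = d) :
    ((Finset.univ.filter fun α : Fin d → Fin m => indexCount α = a).card : ℝ)
      = (a.multinomial : ℝ) := by
  have h1 : ((∑ i, MvPolynomial.X i : MvPolynomial (Fin m) ℝ) ^ d)
      = ∑ α : Fin d → Fin m, MvPolynomial.monomial (indexCount α) 1 := by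
    rw [Fintype.sum_pow]
    refine Finset.sum_congr rfl fun α _ => ?_
    simp only [indexCount, MvPolynomial.X, MvPolynomial.monomial_sum_one]
  have h2 := congrArg (MvPolynomial.coeff a) h1
  rw [MvPolynomial.coeff_sum_X_pow_of_fintype] at h2
  simp only [MvPolynomial.coeff_sum, MvPolynomial.coeff_monomial] at h2
  rw [Finset.sum_boole] at h2
  have ha' : (a.sum fun _ n => n) = d := ha
  rw [← h2]
  simp [ha']

/-- The defining property of the symmetric tensor of a homogeneous polynomial. -/
theorem eval_eq_symTensor {d : ℕ} {p : MvPolynomial (Fin m) ℝ} (hp : p.IsHomogeneous d)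
    (x : Fin m → ℝ) :
    MvPolynomial.eval x p = ∑ α : Fin d → Fin m, symTensor d p α * ∏ i, x (α i) := by
  classical
  have hx : ∀ α : Fin d → Fin m, ∏ i, x (α i) = ∏ j, x j ^ (indexCount α) j := by
    intro α
    have h : (∏ i, (MvPolynomial.X (α i) : MvPolynomial (Fin m) ℝ))
        = MvPolynomial.monomial (indexCount α) 1 := by
      simp only [indexCount, MvPolynomial.X, MvPolynomial.monomial_sum_one]
    have h' := congrArg (MvPolynomial.eval x) h
    rw [map_prod, MvPolynomial.eval_monomial, Finsupp.prod_fintype _ _ (by simp)] at h'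
    simpa using h'
  rw [MvPolynomial.eval_eq']
  have hsub : ∀ α ∈ (Finset.univ : Finset (Fin d → Fin m)), α ∉ Finset.univ.filter
      (fun α : Fin d → Fin m => indexCount α ∈ p.support) →
      symTensor d p α * ∏ i, x (α i) = 0 := by
    intro α _ hα
    simp only [Finset.mem_filter, Finset.mem_univ, true_and, MvPolynomial.notMem_support_iff] at hα
    simp [symTensor, hα]
  rw [← Finset.sum_subset (Finset.filter_subset _ _) hsub,
    ← Finset.sum_fiberwise_of_maps_to (s := Finset.univ.filter
      (fun α : Fin d → Fin m => indexCount α ∈ p.support)) (t := p.support) (g := indexCount)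
      (by intro α hα; simpa using hα)]
  refine Finset.sum_congr rfl fun a ha => ?_
  have hfil : (Finset.univ.filter (fun α : Fin d → Fin m => indexCount α ∈ p.support)).filter
      (fun α => indexCount α = a) = Finset.univ.filter fun α => indexCount α = a := by
    ext α
    simp only [Finset.mem_filter, Finset.mem_univ, true_and]
    exact ⟨fun h => h.2, fun h => ⟨h ▸ ha, h⟩⟩
  have hdeg : a.degree = d := by
    have := hp (MvPolynomial.mem_support_iff.1 ha)
    rw [Finsupp.degree_eq_weight_one (R := ℕ)]
    exact this
  have hpos : (a.multinomial : ℝ) ≠ 0 := by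
    rw [Finsupp.multinomial_eq]
    exact_mod_cast (Nat.multinomial_pos _ _).ne'
  rw [hfil, Finset.sum_congr rfl (g := fun _ => p.coeff a / (a.multinomial : ℝ) * ∏ j, x j ^ a j)]
  · rw [Finset.sum_const, nsmul_eq_mul, card_indexCount a hdeg]
    field_simp
  · intro α hα
    rw [Finset.mem_filter] at hα
    rw [hx, symTensor, hα.2]

end Polynomials

/-! ### The machine model

A uniform real-number machine with unit cost per operation: data are binary trees with real
numbers at the leaves, and a program is built from finitely many elementary operations with
sequential composition, pairing, branching and `while` loops.  With trees kept as pointers, each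
unit of cost is a bounded number of instructions of a real RAM: an arithmetic operation or a
comparison of two reals, following a pointer, or allocating one cell. -/

/-- The data of the machine. -/
inductive Val : Type
  | leaf : ℝ → Val
  | node : Val → Val → Val

namespace Val

/-- The number at a leaf (`0` at an inner node). -/
def num : Val → ℝ
  | leaf r => r
  | node _ _ => 0

/-- The left subtree (the default value `0` at a leaf). -/
def left : Val → Val
  | leaf _ => leaf 0
  | node a _ => a

/-- The right subtree (the default value `0` at a leaf). -/
def right : Val → Val
  | leaf _ => leaf 0
  | node _ b => b

/-- Truth values are the leaves `1` and `0`. -/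
noncomputable def ofProp (c : Prop) : Val :=
  letI := Classical.propDecidable c
  if c then leaf 1 else leaf 0

/-- A list `[v₁, …, vₙ]` as the tree `(v₁, (v₂, … (vₙ, 0)))`. -/
def ofList : List Val → Val
  | [] => leaf 0
  | v :: l => node v (ofList l)

/-- A natural number is stored as a real number. -/
def ofNat (n : ℕ) : Val := leaf (n : ℝ)

end Val

/-- The elementary operations, each of unit cost.  The constants that occur in programs are
rational.  There is no rounding operation. -/
inductive Op : Type
  | ident : Op
  | const : ℚ → Op
  | left : Op
  | right : Op
  | isLeaf : Op
  | add : Op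
  | sub : Op
  | mul : Op
  | div : Op
  | sqrt : Op
  | le : Op

/-- The effect of an elementary operation; the binary ones act on the two numbers of a pair.
Division by `0` and the square root of a negative number return `0`; as a program can test for
these cases, this gives it no additional power. -/
noncomputable def Op.apply : Op → Val → Val
  | .ident, v => v
  | .const c, _ => .leaf (c : ℝ)
  | .left, v => v.left
  | .right, v => v.right
  | .isLeaf, v => .ofProp (∃ r, v = .leaf r)
  | .add, v => .leaf (v.left.num + v.right.num)
  | .sub, v => .leaf (v.left.num - v.right.num)
  | .mul, v => .leaf (v.left.num * v.right.num)
  | .div, v => .leaf (v.left.num / v.right.num)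
  | .sqrt, v => .leaf (Real.sqrt v.num)
  | .le, v => .ofProp (v.left.num ≤ v.right.num)

/-- Programs, each transforming a datum. -/
inductive Prog : Type
  /-- one elementary operation -/
  | op : Op → Prog
  /-- `seq f g`: first `f`, then `g` on the result -/
  | seq : Prog → Prog → Prog
  /-- `pair f g`: run `f` and `g` on the same datum and pair the results -/
  | pair : Prog → Prog → Prog
  /-- `branch c f g`: run `f` if the test `c` yields `1`, else `g` -/
  | branch : Prog → Prog → Prog → Prog
  /-- `loop c f`: as long as the test `c` yields `1`, replace the datum by its image under `f` -/
  | loop : Prog → Prog → Prog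

/-- `Run P v w t`: on input `v`, the program `P` halts with output `w` after `t` steps. -/
inductive Run : Prog → Val → Val → ℕ → Prop
  | op (o : Op) (v : Val) : Run (.op o) v (o.apply v) 1
  | seq {f g : Prog} {v u w : Val} {s t : ℕ} :
      Run f v u s → Run g u w t → Run (.seq f g) v w (s + t + 1)
  | pair {f g : Prog} {v a b : Val} {s t : ℕ} :
      Run f v a s → Run g v b t → Run (.pair f g) v (.node a b) (s + t + 1)
  | branch_true {c f g : Prog} {v w : Val} {s t : ℕ} :
      Run c v (.leaf 1) s → Run f v w t → Run (.branch c f g) v w (s + t + 1)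
  | branch_false {c f g : Prog} {v b w : Val} {s t : ℕ} :
      Run c v b s → b ≠ .leaf 1 → Run g v w t → Run (.branch c f g) v w (s + t + 1)
  | loop_true {c f : Prog} {v u w : Val} {s t r : ℕ} :
      Run c v (.leaf 1) s → Run f v u t → Run (.loop c f) u w r →
        Run (.loop c f) v w (s + t + r + 1)
  | loop_false {c f : Prog} {v b : Val} {s : ℕ} :
      Run c v b s → b ≠ .leaf 1 → Run (.loop c f) v v (s + 1)

/-- The machine is deterministic, so output and running time are functions of the input. -/
theorem Run.unique {P : Prog} {v w w' : Val} {t t' : ℕ} (h : Run P v w t) (h' : Run P v w' t') :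
    w = w' ∧ t = t' := by
  induction h generalizing w' t' with
  | op o v => cases h'; exact ⟨rfl, rfl⟩
  | seq _ _ ih1 ih2 =>
    cases h' with
    | seq k1 k2 =>
      obtain ⟨rfl, rfl⟩ := ih1 k1
      obtain ⟨rfl, rfl⟩ := ih2 k2
      exact ⟨rfl, rfl⟩
  | pair _ _ ih1 ih2 =>
    cases h' with
    | pair k1 k2 =>
      obtain ⟨rfl, rfl⟩ := ih1 k1
      obtain ⟨rfl, rfl⟩ := ih2 k2
      exact ⟨rfl, rfl⟩
  | branch_true _ _ ih1 ih2 =>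
    cases h' with
    | branch_true k1 k2 =>
      obtain ⟨-, rfl⟩ := ih1 k1
      obtain ⟨rfl, rfl⟩ := ih2 k2
      exact ⟨rfl, rfl⟩
    | branch_false k1 k2 _ => exact absurd (ih1 k1).1.symm k2
  | branch_false _ hb _ ih1 ih2 =>
    cases h' with
    | branch_true k1 k2 => exact absurd (ih1 k1).1 hb
    | branch_false k1 _ k2 =>
      obtain ⟨-, rfl⟩ := ih1 k1
      obtain ⟨rfl, rfl⟩ := ih2 k2
      exact ⟨rfl, rfl⟩
  | loop_true _ _ _ ih1 ih2 ih3 =>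
    cases h' with
    | loop_true k1 k2 k3 =>
      obtain ⟨-, rfl⟩ := ih1 k1
      obtain ⟨rfl, rfl⟩ := ih2 k2
      obtain ⟨rfl, rfl⟩ := ih3 k3
      exact ⟨rfl, rfl⟩
    | loop_false k1 k2 => exact absurd (ih1 k1).1.symm k2
  | loop_false _ hb ih1 =>
    cases h' with
    | loop_true k1 _ _ => exact absurd (ih1 k1).1 hb
    | loop_false k1 _ =>
      obtain ⟨-, rfl⟩ := ih1 k1
      exact ⟨rfl, rfl⟩

/-! ### Input and output formats -/

section Formats

variable {m : ℕ}

/-- A point of `ℝᵐ` is given by the list of its coordinates. -/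
def encodePoint (x : EuclideanSpace ℝ (Fin m)) : Val :=
  .ofList (List.ofFn fun i => .leaf (x i))

/-- A finite list of points. -/
def encodePoints (l : List (EuclideanSpace ℝ (Fin m))) : Val :=
  .ofList (l.map encodePoint)

/-- A homogeneous polynomial of degree `d` is given by the list of its terms: all exponent vectors
of degree `d`, in lexicographic order, each with its coefficient. -/
noncomputable def encodePoly (d : ℕ) (p : MvPolynomial (Fin m) ℝ) : Val :=
  .ofList ((List.Nat.antidiagonalTuple m d).map fun a =>
    .node (.ofList (List.ofFn fun i => .ofNat (a i)))
      (.leaf (p.coeff (Finsupp.equivFunOnFinite.symm a))))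

/-- The input of the covering problem: the parameters `d, k, m, R, ε, δ` and a list of
polynomials. -/
noncomputable def encodeInput (d k : ℕ) (R ε δ : ℝ) {n : ℕ}
    (b : Fin n → MvPolynomial (Fin m) ℝ) : Val :=
  .ofList [.ofNat d, .ofNat k, .ofNat m, .leaf R, .leaf ε, .leaf δ,
    .ofList (List.ofFn fun j => encodePoly d (b j))]

end Formats

/-- The bound `M = (2 (R/ε) d k m)^{C² d² k^{1/d}}` on the size of the cover. -/
noncomputable def coverBound (C : ℝ) (d k m : ℕ) (R ε : ℝ) : ℝ :=
  (2 * (R / ε) * d * k * m) ^ (C ^ 2 * (d : ℝ) ^ 2 * (k : ℝ) ^ (1 / (d : ℝ)))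

end NearZeroCover

/-!
Points of the near-zero set are found by recursion on the order of tensors.

After rescaling to `R = 1`, a point `x` of the near-zero set makes `x^{⊗d}` nearly orthogonal to the
symmetric tensors of the polynomials in `V`, so `x^{⊗d}` is close to a space of dimension at most
`k`.  Instead of subspaces, the search keeps positive definite matrices `G` ("covariances").  The
effective dimension `eff G`, the trace of `G (1 + G)⁻¹`, replaces the dimension, and a bound on the
quadratic form of `G⁻¹` at `x^{⊗j}` replaces membership; `Captures` is the conjunction of the two.
The first covariance is large on the symmetric tensors orthogonal to those of `V` and `m ^ (-d)`
elsewhere (`captures_start`).  Unlike a subspace, a covariance admits approximate membership at every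
stage, and no rank has to be decided numerically.

*Contraction.*  Contracting tensors of order `j + 1` with a unit vector `u` gives tensors of order
`j`, and `x^{⊗(j+1)}` becomes a multiple of `x^{⊗j}`.  For `u` in the span of `s` orthonormal
vectors, `child` is the covariance of the contraction with `u`, given that the contractions with the
vectors of the span orthogonal to `u` are small.  If `u` is nearly parallel to the projection of `x`
to the span, and that projection is not negligible, the child bounds `x^{⊗j}` (`qf_child_le`).  The
effective dimensions of the children for `s` well conditioned directions add up to at most
`5 eff G` (`sum_eff_le`): up to constants, the penalized forms for different directions compete for
the same dimensions of `G`.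

*Hyperplanes.*  Let `G` have `eff G ≤ κ`, and call a direction in the span bad if its child has
effective dimension more than `5 κ / s`.  By the above there are no `s` well conditioned bad
directions.  By Cramer's rule, applied to bad directions of maximal determinant, all bad directions
are then close to a hyperplane (`exists_dual_or_perp`, `exists_perp_of_eff`).  So either the direction
of `x` is good, and its child captures `x^{⊗j}` with effective dimension `5 κ / s`, or `x` is close to
the hyperplane.  The ambient space is cut down to that hyperplane and the step repeated (`round_spec`,
`rounds_spec`) until its dimension is less than `s`.  At that point `x` is close to a point of a net
of that space, which is put out.

*Counting.*  Take `s` of order `k^{1/d}`.  If `x` has not been put out after `d` levels, then some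
covariance on tensors of order `0` captures the number `1` and has effective dimension less than
`1/2`, which is absurd (`not_captures_zero`, `Level.spec`).  A covariance has at most `m g ^ s`
children, where the grid of coefficients has `g ≤ base ^ (22 d)` points, so the output has at most
`d (m g ^ s) ^ d` points; this is below the bound `M` (`Input.branching_pow_le`).  The hypothesis on
`ε` is used in the form `δ / R ^ d ≤ base ^ (-100 d)` (`Input.δ_le`).

*Running time.*  `Comp sz e f` says that one program turns the datum `e i` into the datum `f i`, for
all `i`, in time polynomial in `sz i`.  The relation is closed under local definitions, branching,
iteration, and maps and folds over lists of polynomial length, so the search is programmed by writing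
it once more in terms of lists (`Input.comp_points`).  Only the lengths of the lists matter: the real
numbers cost one unit each.  All lengths (the grid, the tensors, the list of covariances, the output)
are bounded by a polynomial in `M`.
-/

namespace NearZeroCover

set_option linter.unusedSectionVars false

open Matrix

/-! ### Families computed in polynomial time -/

/-- `Bd sz n`: the numbers `n i` are bounded by a fixed polynomial in the sizes `sz i`. -/
def Bd {ι : Type*} (sz n : ι → ℕ) : Prop := ∃ c, ∀ i, n i ≤ (sz i + 2) ^ c

/-- `Comp sz e f`: one program turns, for every index `i`, the datum `e i` into the datum `f i`, in
time polynomial in `sz i`.  The data `e i` play the role of an environment in which `f i` is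
evaluated; a local variable is a datum paired to the left of the environment. -/
def Comp {ι : Type*} (sz : ι → ℕ) (e f : ι → Val) : Prop :=
  ∃ (P : Prog) (c : ℕ), ∀ i, ∃ t, Run P (e i) (f i) t ∧ t ≤ (sz i + 2) ^ c

section Bounds

variable {ι : Type*} {sz a b : ι → ℕ}

theorem Bd.mono (h : Bd sz b) (hab : ∀ i, a i ≤ b i) : Bd sz a := by
  obtain ⟨c, hc⟩ := h
  exact ⟨c, fun i => (hab i).trans (hc i)⟩

theorem Bd.const (n : ℕ) : Bd sz fun _ => n :=
  ⟨n, fun _ => Nat.lt_two_pow_self.le.trans (Nat.pow_le_pow_left (by omega) n)⟩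

theorem Bd.mul (ha : Bd sz a) (hb : Bd sz b) : Bd sz fun i => a i * b i := by
  obtain ⟨c, hc⟩ := ha
  obtain ⟨d, hd⟩ := hb
  exact ⟨c + d, fun i => Nat.mul_le_mul (hc i) (hd i) |>.trans_eq (pow_add _ _ _).symm⟩

theorem Bd.add (ha : Bd sz a) (hb : Bd sz b) : Bd sz fun i => a i + b i := by
  obtain ⟨c, hc⟩ := ha
  obtain ⟨d, hd⟩ := hb
  refine ⟨c + d + 1, fun i => ?_⟩
  have h1 : (sz i + 2) ^ c ≤ (sz i + 2) ^ (c + d) := Nat.pow_le_pow_right (by omega) (by omega)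
  have h2 : (sz i + 2) ^ d ≤ (sz i + 2) ^ (c + d) := Nat.pow_le_pow_right (by omega) (by omega)
  have h3 : (sz i + 2) ^ (c + d + 1) = (sz i + 2) ^ (c + d) * (sz i + 2) := pow_succ _ _
  have h4 : (sz i + 2) ^ (c + d) * 2 ≤ (sz i + 2) ^ (c + d) * (sz i + 2) :=
    Nat.mul_le_mul_left _ (by omega)
  have := hc i
  have := hd i
  show a i + b i ≤ _
  omega

theorem Bd.self : Bd sz sz := ⟨1, fun i => by simp⟩

theorem Bd.reindex {κ : Type*} (φ : κ → ι) (h : Bd sz a) :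
    Bd (fun k => sz (φ k)) fun k => a (φ k) := by
  obtain ⟨c, hc⟩ := h
  exact ⟨c, fun k => hc (φ k)⟩

theorem comp_of_bd {e f : ι → Val} (P : Prog) {T : ι → ℕ} (hT : Bd sz T)
    (h : ∀ i, ∃ t, Run P (e i) (f i) t ∧ t ≤ T i) : Comp sz e f := by
  obtain ⟨c, hc⟩ := hT
  refine ⟨P, c, fun i => ?_⟩
  obtain ⟨t, h1, h2⟩ := h i
  exact ⟨t, h1, h2.trans (hc i)⟩

theorem Comp.exists_run {e f : ι → Val} (h : Comp sz e f) :
    ∃ (P : Prog) (T : ι → ℕ), Bd sz T ∧ ∀ i, ∃ t, Run P (e i) (f i) t ∧ t ≤ T i := by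
  obtain ⟨P, c, h⟩ := h
  exact ⟨P, fun i => (sz i + 2) ^ c, ⟨c, fun _ => le_rfl⟩, h⟩

end Bounds

namespace Comp

variable {ι : Type*} {sz : ι → ℕ} {e f g a b : ι → Val}

theorem congr {f' : ι → Val} (h : Comp sz e f) (hf : ∀ i, f i = f' i) : Comp sz e f' := by
  have : f = f' := funext hf
  exact this ▸ h

theorem reindex {κ : Type*} (φ : κ → ι) (h : Comp sz e f) :
    Comp (fun k => sz (φ k)) (fun k => e (φ k)) fun k => f (φ k) := by
  obtain ⟨P, c, h⟩ := h
  exact ⟨P, c, fun k => h (φ k)⟩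

theorem trans (h : Comp sz e f) (h' : Comp sz f g) : Comp sz e g := by
  obtain ⟨P, T, hT, h⟩ := h.exists_run
  obtain ⟨P', T', hT', h'⟩ := h'.exists_run
  refine comp_of_bd (.seq P P') ((hT.add hT').add (Bd.const 1)) fun i => ?_
  obtain ⟨t, h1, h2⟩ := h i
  obtain ⟨t', h3, h4⟩ := h' i
  exact ⟨_, .seq h1 h3, by omega⟩

theorem op (o : Op) : Comp sz e fun i => o.apply (e i) :=
  comp_of_bd (.op o) (Bd.const 1) fun _ => ⟨1, .op o _, le_rfl⟩

theorem id : Comp sz e e := op .ident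

theorem node (ha : Comp sz e a) (hb : Comp sz e b) : Comp sz e fun i => .node (a i) (b i) := by
  obtain ⟨P, T, hT, h⟩ := ha.exists_run
  obtain ⟨P', T', hT', h'⟩ := hb.exists_run
  refine comp_of_bd (.pair P P') ((hT.add hT').add (Bd.const 1)) fun i => ?_
  obtain ⟨t, h1, h2⟩ := h i
  obtain ⟨t', h3, h4⟩ := h' i
  exact ⟨_, .pair h1 h3, by omega⟩

theorem fst (h : Comp sz e fun i => .node (a i) (b i)) : Comp sz e a := h.trans (op .left)

theorem snd (h : Comp sz e fun i => .node (a i) (b i)) : Comp sz e b := h.trans (op .right)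

/-- The innermost local variable. -/
theorem var : Comp sz (fun i => .node (a i) (e i)) a := fst id

/-- A new local variable does not affect what was computable before. -/
theorem weak (h : Comp sz e f) : Comp sz (fun i => .node (a i) (e i)) f :=
  (snd id).trans h

theorem const (q : ℚ) : Comp sz e fun _ => .leaf (q : ℝ) := op (.const q)

theorem zero : Comp sz e fun _ => .leaf 0 := (const 0).congr fun _ => by simp

theorem one : Comp sz e fun _ => .leaf 1 := (const 1).congr fun _ => by simp

section Arithmetic

variable {x y : ι → ℝ}

theorem add (hx : Comp sz e fun i => .leaf (x i)) (hy : Comp sz e fun i => .leaf (y i)) :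
    Comp sz e fun i => .leaf (x i + y i) := (node hx hy).trans (op .add)

theorem sub (hx : Comp sz e fun i => .leaf (x i)) (hy : Comp sz e fun i => .leaf (y i)) :
    Comp sz e fun i => .leaf (x i - y i) := (node hx hy).trans (op .sub)

theorem mul (hx : Comp sz e fun i => .leaf (x i)) (hy : Comp sz e fun i => .leaf (y i)) :
    Comp sz e fun i => .leaf (x i * y i) := (node hx hy).trans (op .mul)

theorem div (hx : Comp sz e fun i => .leaf (x i)) (hy : Comp sz e fun i => .leaf (y i)) :
    Comp sz e fun i => .leaf (x i / y i) := (node hx hy).trans (op .div)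

theorem sqrt (hx : Comp sz e fun i => .leaf (x i)) :
    Comp sz e fun i => .leaf (Real.sqrt (x i)) := hx.trans (op .sqrt)

theorem le (hx : Comp sz e fun i => .leaf (x i)) (hy : Comp sz e fun i => .leaf (y i)) :
    Comp sz e fun i => Val.ofProp (x i ≤ y i) := (node hx hy).trans (op .le)

end Arithmetic

end Comp

theorem ofProp_true {p : Prop} (h : p) : Val.ofProp p = .leaf 1 := by simp [Val.ofProp, h]

theorem ofProp_ne {p : Prop} (h : ¬ p) : Val.ofProp p ≠ .leaf 1 := by simp [Val.ofProp, h]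

namespace Comp

variable {ι : Type*} {sz : ι → ℕ} {e f g a b : ι → Val}

open Classical in
/-- Branching; each branch has to be computable only where it is taken. -/
theorem ite' {p : ι → Prop} (hp : Comp sz e fun i => Val.ofProp (p i))
    (hf : Comp (fun i : {i // p i} => sz i) (fun i => e i) fun i => f i)
    (hg : Comp (fun i : {i // ¬ p i} => sz i) (fun i => e i) fun i => g i) :
    Comp sz e fun i => if p i then f i else g i := by
  obtain ⟨P, c, hp⟩ := hp
  obtain ⟨Q, c1, hf⟩ := hf
  obtain ⟨Q', c2, hg⟩ := hg
  refine comp_of_bd (.branch P Q Q') (T := fun i => (sz i + 2) ^ c + ((sz i + 2) ^ c1 +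
    (sz i + 2) ^ c2) + 1) ((Bd.add ⟨c, fun _ => le_rfl⟩
    (Bd.add ⟨c1, fun _ => le_rfl⟩ ⟨c2, fun _ => le_rfl⟩)).add (Bd.const 1)) fun i => ?_
  obtain ⟨t, h1, h2⟩ := hp i
  dsimp only at h1
  by_cases h : p i
  · obtain ⟨t', h3, h4⟩ := hf ⟨i, h⟩
    rw [ofProp_true h] at h1
    rw [if_pos h]
    exact ⟨_, .branch_true h1 h3, by dsimp only at h4 ⊢; omega⟩
  · obtain ⟨t', h3, h4⟩ := hg ⟨i, h⟩
    rw [if_neg h]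
    exact ⟨_, .branch_false h1 (ofProp_ne h) h3, by dsimp only at h4 ⊢; omega⟩

open Classical in
theorem ite {p : ι → Prop} (hp : Comp sz e fun i => Val.ofProp (p i)) (hf : Comp sz e f)
    (hg : Comp sz e g) : Comp sz e fun i => if p i then f i else g i :=
  ite' hp (hf.reindex Subtype.val) (hg.reindex Subtype.val)

theorem ofProp_congr {p q : ι → Prop} (hp : Comp sz e fun i => Val.ofProp (p i))
    (h : ∀ i, p i ↔ q i) : Comp sz e fun i => Val.ofProp (q i) :=
  hp.congr fun i => by rw [propext (h i)]

theorem not {p : ι → Prop} (hp : Comp sz e fun i => Val.ofProp (p i)) :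
    Comp sz e fun i => Val.ofProp (¬ p i) := by
  classical
  refine (ite hp zero one).congr fun i => ?_
  by_cases h : p i <;> simp [h, Val.ofProp]

theorem and {p q : ι → Prop} (hp : Comp sz e fun i => Val.ofProp (p i))
    (hq : Comp sz e fun i => Val.ofProp (q i)) : Comp sz e fun i => Val.ofProp (p i ∧ q i) := by
  classical
  refine (ite hp hq zero).congr fun i => ?_
  by_cases h : p i <;> simp [h, Val.ofProp]

theorem or {p q : ι → Prop} (hp : Comp sz e fun i => Val.ofProp (p i))
    (hq : Comp sz e fun i => Val.ofProp (q i)) : Comp sz e fun i => Val.ofProp (p i ∨ q i) := by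
  classical
  refine (ite hp one hq).congr fun i => ?_
  by_cases h : p i <;> simp [h, Val.ofProp]

/-- A `while` loop with polynomially many rounds: `s i k` is the datum after `k` of the `K i`
rounds. -/
theorem iterate {K : ι → ℕ} (hK : Bd sz K) {s : ι → ℕ → Val}
    (ht : Comp (fun x : (i : ι) × Fin (K i + 1) => sz x.1) (fun x => s x.1 x.2)
      fun x => Val.ofProp ((x.2 : ℕ) < K x.1))
    (hb : Comp (fun x : (i : ι) × Fin (K i) => sz x.1) (fun x => s x.1 x.2)
      fun x => s x.1 (x.2 + 1)) :
    Comp sz (fun i => s i 0) fun i => s i (K i) := by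
  obtain ⟨P, c, ht⟩ := ht
  obtain ⟨Q, c', hb⟩ := hb
  refine comp_of_bd (.loop P Q) (T := fun i => (K i + 1) * ((sz i + 2) ^ c + (sz i + 2) ^ c' + 1))
    ((hK.add (Bd.const 1)).mul ((Bd.add ⟨c, fun _ => le_rfl⟩ ⟨c', fun _ => le_rfl⟩).add
      (Bd.const 1))) fun i => ?_
  have key : ∀ r k, k + r = K i → ∃ t, Run (.loop P Q) (s i k) (s i (K i)) t ∧
      t ≤ (r + 1) * ((sz i + 2) ^ c + (sz i + 2) ^ c' + 1) := by
    intro r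
    induction r with
    | zero =>
      intro k hk
      obtain rfl : k = K i := by omega
      obtain ⟨t, h1, h2⟩ := ht ⟨i, ⟨K i, by omega⟩⟩
      refine ⟨_, .loop_false h1 (ofProp_ne (by simp)), ?_⟩
      dsimp only at h2
      omega
    | succ r ih =>
      intro k hk
      obtain ⟨t, h1, h2⟩ := ht ⟨i, ⟨k, by omega⟩⟩
      obtain ⟨t', h3, h4⟩ := hb ⟨i, ⟨k, by omega⟩⟩
      obtain ⟨t'', h5, h6⟩ := ih (k + 1) (by omega)
      dsimp only at h1
      rw [ofProp_true (show k < K i by omega)] at h1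
      refine ⟨_, .loop_true h1 h3 h5, ?_⟩
      dsimp only at h2 h4
      rw [add_mul, one_mul]
      omega
  obtain ⟨t, h1, h2⟩ := key (K i) 0 (by omega)
  exact ⟨t, h1, h2⟩

end Comp

/-! ### Lists -/

theorem isLeaf_node (a b : Val) : ¬ ∃ r, Val.node a b = .leaf r := by simp

/-- The tree of a list whose entries are encoded by `enc`. -/
def encList {α : Type*} (enc : α → Val) (l : List α) : Val := .ofList (l.map enc)

@[simp] theorem encList_nil {α : Type*} (enc : α → Val) : encList enc [] = .leaf 0 := rfl

@[simp] theorem encList_cons {α : Type*} (enc : α → Val) (a : α) (l : List α) :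
    encList enc (a :: l) = .node (enc a) (encList enc l) := rfl

namespace Comp

variable {ι : Type*} {sz : ι → ℕ} {e : ι → Val} {α β : ι → Type*}
  {encα : ∀ i, α i → Val} {encβ : ∀ i, β i → Val}

theorem nil : Comp sz e fun i => encList (encα i) [] := zero

theorem cons {x : ∀ i, α i} {l : ∀ i, List (α i)} (hx : Comp sz e fun i => encα i (x i))
    (hl : Comp sz e fun i => encList (encα i) (l i)) :
    Comp sz e fun i => encList (encα i) (x i :: l i) := node hx hl

/-- A fold over a list; the step has to be computable only at the values that the accumulator takes,
which are the folds of the proper prefixes `x.2.1` of the list. -/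
theorem foldl' {l : ∀ i, List (α i)} {F : ∀ i, β i → α i → β i} {b₀ : ∀ i, β i}
    (hn : Bd sz fun i => (l i).length)
    (hl : Comp sz e fun i => encList (encα i) (l i)) (h₀ : Comp sz e fun i => encβ i (b₀ i))
    (hF : Comp (fun x : (i : ι) × {p : List (α i) × α i // p.1 ++ [p.2] <+: l i} => sz x.1)
      (fun x => .node (encα x.1 x.2.1.2)
        (.node (encβ x.1 (x.2.1.1.foldl (F x.1) (b₀ x.1))) (e x.1)))
      fun x => encβ x.1 (F x.1 (x.2.1.1.foldl (F x.1) (b₀ x.1)) x.2.1.2)) :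
    Comp sz e fun i => encβ i ((l i).foldl (F i) (b₀ i)) := by
  -- the loop works on the rest of the list, the accumulator and the environment
  let s : ι → ℕ → Val := fun i k => .node (encList (encα i) ((l i).drop k))
    (.node (encβ i (((l i).take k).foldl (F i) (b₀ i))) (e i))
  have h0 : Comp sz e fun i => s i 0 :=
    (node hl (node h₀ id)).congr fun i => by simp [s]
  have hend : Comp sz (fun i => s i (l i).length)
      fun i => encβ i ((l i).foldl (F i) (b₀ i)) :=
    (fst (snd id)).congr fun i => by simp
  refine h0.trans (Comp.trans ?_ hend)
  refine iterate hn ?_ ?_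
  · refine ofProp_congr (not ((fst id).trans (op .isLeaf))) fun x => ?_
    obtain ⟨i, k, hk⟩ := x
    dsimp only
    rcases Nat.lt_or_ge k (l i).length with h | h
    · rw [List.drop_eq_getElem_cons h, encList_cons]
      exact iff_of_true (isLeaf_node _ _) h
    · rw [List.drop_eq_nil_of_le h]
      simp [h]
  · let φ : ((i : ι) × Fin (l i).length) →
        (i : ι) × {p : List (α i) × α i // p.1 ++ [p.2] <+: l i} := fun x =>
      ⟨x.1, ((l x.1).take x.2, (l x.1)[x.2]), by
        have : (l x.1).take x.2 ++ [(l x.1)[x.2]] = (l x.1).take (x.2 + 1) := by simp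
        rw [this]
        exact List.take_prefix _ _⟩
    have hs : (fun x : (i : ι) × Fin (l i).length => s x.1 x.2) = fun x =>
        .node (.node (encα x.1 ((l x.1)[x.2])) (encList (encα x.1) ((l x.1).drop (x.2 + 1))))
          (.node (encβ x.1 (((l x.1).take x.2).foldl (F x.1) (b₀ x.1))) (e x.1)) := by
      funext x
      obtain ⟨i, k, hk⟩ := x
      simp only [s]
      rw [List.drop_eq_getElem_cons hk]
      rfl
    rw [hs]
    have h1 := hF.reindex φ
    refine (node (snd (fst id)) (node ((node (fst (fst id)) (snd id)).trans h1)
      (snd (snd id)))).congr fun x => ?_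
    simp only [s, φ]
    rw [List.take_succ_eq_append_getElem x.2.2, List.foldl_append]
    rfl

/-- A fold over a list. -/
theorem foldl {l : ∀ i, List (α i)} {F : ∀ i, β i → α i → β i} {b₀ : ∀ i, β i}
    (hn : Bd sz fun i => (l i).length)
    (hl : Comp sz e fun i => encList (encα i) (l i)) (h₀ : Comp sz e fun i => encβ i (b₀ i))
    (hF : Comp (fun x : (i : ι) × α i × β i => sz x.1)
      (fun x => .node (encα x.1 x.2.1) (.node (encβ x.1 x.2.2) (e x.1)))
      fun x => encβ x.1 (F x.1 x.2.2 x.2.1)) :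
    Comp sz e fun i => encβ i ((l i).foldl (F i) (b₀ i)) :=
  foldl' hn hl h₀ (hF.reindex
    fun x : (i : ι) × {p : List (α i) × α i // p.1 ++ [p.2] <+: l i} =>
      (⟨x.1, x.2.1.2, x.2.1.1.foldl (F x.1) (b₀ x.1)⟩ : (i : ι) × α i × β i))

theorem reverse {l : ∀ i, List (α i)} (hn : Bd sz fun i => (l i).length)
    (hl : Comp sz e fun i => encList (encα i) (l i)) :
    Comp sz e fun i => encList (encα i) (l i).reverse := by
  have h := foldl (β := fun i => List (α i)) (encβ := fun i => encList (encα i))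
    (F := fun _ acc x => x :: acc) (b₀ := fun _ => []) hn hl nil (cons var (weak var))
  refine h.congr fun i => ?_
  rw [List.foldl_flip_cons_eq_append']
  simp

theorem append {l l' : ∀ i, List (α i)} (hn : Bd sz fun i => (l i).length)
    (hl : Comp sz e fun i => encList (encα i) (l i))
    (hl' : Comp sz e fun i => encList (encα i) (l' i)) :
    Comp sz e fun i => encList (encα i) (l i ++ l' i) := by
  have h := foldl (β := fun i => List (α i)) (encβ := fun i => encList (encα i))
    (F := fun _ acc x => x :: acc) (l := fun i => (l i).reverse) (by simpa using hn)
    (reverse hn hl) hl' (cons var (weak var))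
  refine h.congr fun i => ?_
  rw [List.foldl_flip_cons_eq_append']
  simp

theorem map {l : ∀ i, List (α i)} {F : ∀ i, α i → β i} (hn : Bd sz fun i => (l i).length)
    (hl : Comp sz e fun i => encList (encα i) (l i))
    (hF : Comp (fun x : (i : ι) × α i => sz x.1) (fun x => .node (encα x.1 x.2) (e x.1))
      fun x => encβ x.1 (F x.1 x.2)) :
    Comp sz e fun i => encList (encβ i) ((l i).map (F i)) := by
  have h := foldl (β := fun i => List (β i)) (encβ := fun i => encList (encβ i))
    (F := fun i acc x => F i x :: acc) (b₀ := fun _ => []) hn hl nil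
    (cons ((node var (weak (weak id))).trans
      (hF.reindex fun x : (i : ι) × α i × List (β i) => ⟨x.1, x.2.1⟩)) (weak var))
  refine (reverse (hn.mono fun i => ?_) h).congr fun i => ?_
  · rw [List.foldl_flip_cons_eq_append]
    simp
  · rw [List.foldl_flip_cons_eq_append]
    simp

end Comp

/-! ### Positive definite matrices -/

section PosDef

variable {n κ τ : Type*} [Fintype n] [DecidableEq n] [Fintype κ] [Fintype τ]

/-- The quadratic form of a matrix. -/
def qf (A : Matrix n n ℝ) (x : n → ℝ) : ℝ := x ⬝ᵥ A *ᵥ x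

/-- The matrix of the quadratic form `x ↦ ∑ t, (y t ⬝ᵥ x) ^ 2`. -/
def gram (y : τ → n → ℝ) : Matrix n n ℝ := ∑ t, vecMulVec (y t) (y t)

theorem dot_sq_nonneg (x : n → ℝ) : 0 ≤ x ⬝ᵥ x :=
  Finset.sum_nonneg fun i _ => mul_self_nonneg (x i)

theorem dot_sq_pos {x : n → ℝ} (hx : x ≠ 0) : 0 < x ⬝ᵥ x :=
  lt_of_le_of_ne (dot_sq_nonneg x) fun h => hx (dotProduct_self_eq_zero.1 h.symm)

theorem qf_add (A B : Matrix n n ℝ) (x : n → ℝ) : qf (A + B) x = qf A x + qf B x := by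
  simp [qf, add_mulVec, dotProduct_add]

theorem qf_smul (c : ℝ) (A : Matrix n n ℝ) (x : n → ℝ) : qf (c • A) x = c * qf A x := by
  simp [qf, smul_mulVec, dotProduct_smul]

theorem qf_one (x : n → ℝ) : qf (1 : Matrix n n ℝ) x = x ⬝ᵥ x := by simp [qf]

theorem qf_smul_vec (A : Matrix n n ℝ) (c : ℝ) (x : n → ℝ) : qf A (c • x) = c ^ 2 * qf A x := by
  simp [qf, mulVec_smul, dotProduct_smul, smul_dotProduct]
  ring

theorem qf_vecMulVec (y x : n → ℝ) : qf (vecMulVec y y) x = (y ⬝ᵥ x) ^ 2 := by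
  simp [qf, vecMulVec_mulVec, dotProduct_smul, dotProduct_comm x y]
  ring

theorem qf_gram (y : τ → n → ℝ) (x : n → ℝ) : qf (gram y) x = ∑ t, (y t ⬝ᵥ x) ^ 2 := by
  simp only [← qf_vecMulVec]
  simp [qf, gram, sum_mulVec, dotProduct_sum]

theorem posDef_iff_qf {A : Matrix n n ℝ} :
    A.PosDef ↔ A.IsHermitian ∧ ∀ x, x ≠ 0 → 0 < qf A x := by
  simp [posDef_iff_dotProduct_mulVec, qf]

theorem posSemidef_iff_qf {A : Matrix n n ℝ} :
    A.PosSemidef ↔ A.IsHermitian ∧ ∀ x, 0 ≤ qf A x := by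
  simp [posSemidef_iff_dotProduct_mulVec, qf]

theorem qf_nonneg {A : Matrix n n ℝ} (hA : A.PosSemidef) (x : n → ℝ) : 0 ≤ qf A x :=
  (posSemidef_iff_qf.1 hA).2 x

theorem dot_mulVec_comm {A : Matrix n n ℝ} (hA : A.IsHermitian) (x y : n → ℝ) :
    x ⬝ᵥ A *ᵥ y = y ⬝ᵥ A *ᵥ x := by
  have h : Aᵀ = A := by simpa [IsHermitian] using hA
  rw [dotProduct_mulVec, ← mulVec_transpose, h, dotProduct_comm]

theorem gram_posSemidef (y : τ → n → ℝ) : (gram y).PosSemidef := by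
  refine posSemidef_iff_qf.2 ⟨?_, fun x => ?_⟩
  · ext i j
    simp [gram, Matrix.sum_apply, vecMulVec_apply, mul_comm]
  · rw [qf_gram]
    exact Finset.sum_nonneg fun t _ => sq_nonneg _

theorem PosSemidef.exists_gram {A : Matrix n n ℝ} (hA : A.PosSemidef) :
    ∃ B : n → n → ℝ, A = gram B := by
  obtain ⟨B, hB⟩ : ∃ B : Matrix n n ℝ, A = star B * B := by
    open scoped MatrixOrder in
    exact CStarAlgebra.nonneg_iff_eq_star_mul_self.mp hA.nonneg
  refine ⟨B, ?_⟩
  rw [hB]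
  ext i j
  simp [gram, mul_apply, Matrix.sum_apply, vecMulVec_apply, star_eq_conjTranspose]

theorem posDef_inv_mul {A : Matrix n n ℝ} (hA : A.PosDef) : A⁻¹ * A = 1 :=
  nonsing_inv_mul _ ((isUnit_iff_isUnit_det _).1 hA.isUnit)

theorem posDef_mul_inv {A : Matrix n n ℝ} (hA : A.PosDef) : A * A⁻¹ = 1 :=
  mul_nonsing_inv _ ((isUnit_iff_isUnit_det _).1 hA.isUnit)

/-- The Fenchel inequality for a positive definite form and its inverse. -/
theorem two_dot_le {Q : Matrix n n ℝ} (hQ : Q.PosDef) (z v : n → ℝ) :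
    2 * (z ⬝ᵥ v) ≤ qf Q z + qf Q⁻¹ v := by
  have h := qf_nonneg hQ.posSemidef (z - Q⁻¹ *ᵥ v)
  have h1 : Q *ᵥ (Q⁻¹ *ᵥ v) = v := by rw [mulVec_mulVec, posDef_mul_inv hQ, one_mulVec]
  have h2 : (Q⁻¹ *ᵥ v) ⬝ᵥ Q *ᵥ z = z ⬝ᵥ v := by rw [dot_mulVec_comm hQ.1, h1]
  have h3 : (Q⁻¹ *ᵥ v) ⬝ᵥ v = qf Q⁻¹ v := by rw [dotProduct_comm]; rfl
  simp only [qf, mulVec_sub, dotProduct_sub, sub_dotProduct, h1, h2, h3] at h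
  simp only [qf] at h ⊢
  linarith

/-- Inversion of positive definite matrices reverses the order. -/
theorem qf_inv_anti {X Z : Matrix n n ℝ} (hX : X.PosDef) (hZ : Z.PosDef)
    (h : ∀ x, qf X x ≤ qf Z x) (v : n → ℝ) : qf Z⁻¹ v ≤ qf X⁻¹ v := by
  have h1 := two_dot_le hX (Z⁻¹ *ᵥ v) v
  have h2 := h (Z⁻¹ *ᵥ v)
  have h3 : qf Z (Z⁻¹ *ᵥ v) = qf Z⁻¹ v := by
    rw [qf, mulVec_mulVec, posDef_mul_inv hZ, one_mulVec, dotProduct_comm]; rfl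
  have h4 : (Z⁻¹ *ᵥ v) ⬝ᵥ v = qf Z⁻¹ v := by rw [dotProduct_comm]; rfl
  rw [h4] at h1
  linarith

theorem sum_qf_eq_trace (A : Matrix n n ℝ) (y : τ → n → ℝ) :
    ∑ t, qf A (y t) = trace (gram y * A) := by
  rw [gram, Finset.sum_mul, trace_sum]
  refine Finset.sum_congr rfl fun t _ => ?_
  rw [vecMulVec_mul, trace_vecMulVec, qf, dotProduct_mulVec, dotProduct_comm]

/-- The effective dimension of a covariance matrix: the eigenvalue `g` counts as `g / (1 + g)`. -/
noncomputable def eff (G : Matrix n n ℝ) : ℝ := trace (G * (1 + G)⁻¹)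

theorem posDef_one_add {G : Matrix n n ℝ} (hG : G.PosDef) : (1 + G).PosDef :=
  PosDef.one.add hG

theorem eff_eq {G : Matrix n n ℝ} (hG : G.PosDef) :
    eff G = Fintype.card n - trace (1 + G)⁻¹ := by
  have h := posDef_mul_inv (posDef_one_add hG)
  have h1 : G * (1 + G)⁻¹ = 1 - (1 + G)⁻¹ := by
    rw [eq_sub_iff_add_eq]
    rw [add_mul, one_mul] at h
    rw [add_comm]
    exact h
  rw [eff, h1, trace_sub, trace_one]

/-- A covariance matrix `G` has room only for `eff G` dimensions of vectors whose joint form is at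
most `γ`, compared with the form `γ G⁻¹`. -/
theorem sum_qf_le_eff {G : Matrix n n ℝ} (hG : G.PosDef) {γ : ℝ} (hγ : 0 < γ) (y : τ → n → ℝ)
    (hy : ∀ x, ∑ t, (y t ⬝ᵥ x) ^ 2 ≤ γ * (x ⬝ᵥ x)) :
    ∑ t, qf (γ • G⁻¹ + gram y)⁻¹ (y t) ≤ eff G := by
  have hGi : (γ • G⁻¹).PosDef := hG.inv.smul hγ
  set H := γ • G⁻¹ + gram y with hH
  have hHp : H.PosDef := hGi.add_posSemidef (gram_posSemidef y)
  have hZp : (γ • G⁻¹ + γ • (1 : Matrix n n ℝ)).PosDef := hGi.add (PosDef.one.smul hγ)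
  obtain ⟨B, hB⟩ := PosSemidef.exists_gram hG.inv.posSemidef
  have h1 : trace (G⁻¹ * (γ • G⁻¹ + γ • (1 : Matrix n n ℝ))⁻¹) ≤ trace (G⁻¹ * H⁻¹) := by
    rw [hB, ← sum_qf_eq_trace, ← sum_qf_eq_trace, ← hB]
    refine Finset.sum_le_sum fun t _ => qf_inv_anti hHp hZp (fun x => ?_) _
    rw [hH, qf_add, qf_add, qf_gram, qf_smul γ 1, qf_one]
    linarith [hy x]
  have h2 : γ • (G⁻¹ * (γ • G⁻¹ + γ • (1 : Matrix n n ℝ))⁻¹) = (1 + G)⁻¹ := by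
    symm
    apply inv_eq_left_inv
    have h3 : (1 + G) = γ⁻¹ • ((γ • G⁻¹ + γ • (1 : Matrix n n ℝ)) * G) := by
      rw [add_mul, smul_mul_assoc, posDef_inv_mul hG, smul_mul_assoc, one_mul, ← smul_add,
        smul_smul, inv_mul_cancel₀ hγ.ne', one_smul]
    rw [h3, smul_mul_smul_comm, mul_inv_cancel₀ hγ.ne', one_smul, mul_assoc,
      ← mul_assoc _ _ G, posDef_inv_mul hZp, one_mul, posDef_inv_mul hG]
  have h4 : trace (gram y * H⁻¹) = Fintype.card n - γ * trace (G⁻¹ * H⁻¹) := by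
    have h5 : gram y = H - γ • G⁻¹ := by rw [hH]; abel
    rw [h5, sub_mul, posDef_mul_inv hHp, trace_sub, trace_one, smul_mul_assoc, trace_smul,
      smul_eq_mul]
  rw [sum_qf_eq_trace, h4, eff_eq hG, ← h2, trace_smul, smul_eq_mul]
  have := mul_le_mul_of_nonneg_left h1 hγ.le
  linarith

variable [DecidableEq κ]

/-- The covariance matrix of the image under the map with rows `y`. -/
def image (y : κ → n → ℝ) (A : Matrix n n ℝ) : Matrix κ κ ℝ :=
  of fun a a' => y a ⬝ᵥ A *ᵥ y a'

theorem image_eq (y : κ → n → ℝ) (A : Matrix n n ℝ) : image y A = of y * A * (of y)ᵀ := by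
  ext a a'
  rw [image, of_apply, dotProduct_mulVec]
  rfl

theorem gram_eq (y : κ → n → ℝ) : gram y = (of y)ᵀ * of y := by
  ext i j
  simp [gram, mul_apply, Matrix.sum_apply, vecMulVec_apply]

/-- The effective dimension of an image, by the push-through identity. -/
theorem eff_image {Q : Matrix n n ℝ} (hQ : Q.PosDef) (y : κ → n → ℝ) :
    eff (image y Q⁻¹) = ∑ a, qf (Q + gram y)⁻¹ (y a) := by
  have hHp : (Q + gram y).PosDef := hQ.add_posSemidef (gram_posSemidef y)
  rw [sum_qf_eq_trace, eff, image_eq, gram_eq]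
  set C : Matrix κ n ℝ := of y
  rw [gram_eq] at hHp
  change (Q + Cᵀ * C).PosDef at hHp
  have hQi := posDef_mul_inv hQ
  have h0 : (1 + C * Q⁻¹ * Cᵀ).PosDef := by
    refine PosDef.one.add_posSemidef ?_
    simpa using hQ.inv.posSemidef.mul_mul_conjTranspose_same C
  have h1 : Cᵀ * (1 + C * Q⁻¹ * Cᵀ) = (Q + Cᵀ * C) * (Q⁻¹ * Cᵀ) := by
    rw [Matrix.mul_add, Matrix.add_mul, ← Matrix.mul_assoc Q, hQi, Matrix.mul_one, Matrix.one_mul]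
    simp only [Matrix.mul_assoc]
  have h2 : (Q + Cᵀ * C)⁻¹ * Cᵀ * (1 + C * Q⁻¹ * Cᵀ) = Q⁻¹ * Cᵀ := by
    rw [Matrix.mul_assoc, h1, ← Matrix.mul_assoc, posDef_inv_mul hHp, Matrix.one_mul]
  have h3 : C * (Q + Cᵀ * C)⁻¹ * Cᵀ * (1 + C * Q⁻¹ * Cᵀ) = C * Q⁻¹ * Cᵀ := by
    rw [Matrix.mul_assoc C, Matrix.mul_assoc C, h2, ← Matrix.mul_assoc]
  have h4 : C * Q⁻¹ * Cᵀ * (1 + C * Q⁻¹ * Cᵀ)⁻¹ = C * (Q + Cᵀ * C)⁻¹ * Cᵀ := by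
    calc C * Q⁻¹ * Cᵀ * (1 + C * Q⁻¹ * Cᵀ)⁻¹
        = C * (Q + Cᵀ * C)⁻¹ * Cᵀ * (1 + C * Q⁻¹ * Cᵀ) * (1 + C * Q⁻¹ * Cᵀ)⁻¹ := by rw [h3]
      _ = _ := by rw [Matrix.mul_assoc _ (1 + _), posDef_mul_inv h0, Matrix.mul_one]
  rw [h4, trace_mul_comm, ← Matrix.mul_assoc]

theorem image_posDef {A : Matrix n n ℝ} (hA : A.PosDef) {y : κ → n → ℝ}
    (hy : Function.Injective (of y).vecMul) : (image y A).PosDef := by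
  rw [image_eq]
  simpa using hA.mul_mul_conjTranspose_same (B := of y) hy

/-- The form of an image is the infimum of the form over the fibre. -/
theorem qf_image_inv_le {Q : Matrix n n ℝ} (hQ : Q.PosDef) {y : κ → n → ℝ}
    (hG : (image y Q⁻¹).PosDef) (z : n → ℝ) :
    qf (image y Q⁻¹)⁻¹ (fun a => y a ⬝ᵥ z) ≤ qf Q z := by
  set w := (image y Q⁻¹)⁻¹ *ᵥ (fun a => y a ⬝ᵥ z) with hw
  have h := two_dot_le hQ z ((of y)ᵀ *ᵥ w)
  have hz : (fun a => y a ⬝ᵥ z) = of y *ᵥ z := rfl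
  have h1 : z ⬝ᵥ (of y)ᵀ *ᵥ w = qf (image y Q⁻¹)⁻¹ (fun a => y a ⬝ᵥ z) := by
    rw [dotProduct_mulVec, vecMul_transpose, ← hz, qf]
  have h2 : qf Q⁻¹ ((of y)ᵀ *ᵥ w) = qf (image y Q⁻¹)⁻¹ (fun a => y a ⬝ᵥ z) := by
    have h3 : qf Q⁻¹ ((of y)ᵀ *ᵥ w) = qf (image y Q⁻¹) w := by
      rw [qf, qf, image_eq, ← mulVec_mulVec, ← mulVec_mulVec, mulVec_transpose,
        ← dotProduct_mulVec]
    rw [h3, qf, hw, mulVec_mulVec, posDef_mul_inv hG, one_mulVec, dotProduct_comm, qf]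
  rw [h1, h2] at h
  linarith

end PosDef

/-! ### Rank one updates -/

section Update

variable {n : Type*} [Fintype n] [DecidableEq n]

/-- The rank one update of the inverse of a symmetric matrix (for `c > 0`, `upd c X⁻¹ y` is the
inverse of `X + c⁻¹ y yᵀ`); for `c = 0` the vector `y` is projected out. -/
noncomputable def upd (c : ℝ) (A : Matrix n n ℝ) (y : n → ℝ) : Matrix n n ℝ :=
  of fun i j => A i j - (A *ᵥ y) i / (c + y ⬝ᵥ A *ᵥ y) * (A *ᵥ y) j

theorem upd_eq (c : ℝ) (A : Matrix n n ℝ) (y : n → ℝ) :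
    upd c A y = A - (c + qf A y)⁻¹ • vecMulVec (A *ᵥ y) (A *ᵥ y) := by
  ext i j
  simp [upd, vecMulVec_apply, qf]
  ring

/-- The Sherman–Morrison formula. -/
theorem upd_inv {X : Matrix n n ℝ} (hX : X.PosDef) {c : ℝ} (hc : 0 < c) (y : n → ℝ) :
    upd c X⁻¹ y = (X + c⁻¹ • vecMulVec y y)⁻¹ := by
  symm
  apply inv_eq_left_inv
  have hq : 0 ≤ qf X⁻¹ y := qf_nonneg hX.inv.posSemidef y
  have hd : c + qf X⁻¹ y ≠ 0 := by positivity
  have h1 : X⁻¹ * vecMulVec y y = vecMulVec (X⁻¹ *ᵥ y) y := mul_vecMulVec _ _ _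
  have h2 : vecMulVec (X⁻¹ *ᵥ y) (X⁻¹ *ᵥ y) * X = vecMulVec (X⁻¹ *ᵥ y) y := by
    have h3 : (X⁻¹ *ᵥ y) ᵥ* X = y := by
      have : Xᵀ = X := by simpa [IsHermitian] using hX.1
      rw [← mulVec_transpose, this, mulVec_mulVec, posDef_mul_inv hX, one_mulVec]
    rw [vecMulVec_mul, h3]
  have h3 : vecMulVec (X⁻¹ *ᵥ y) (X⁻¹ *ᵥ y) * vecMulVec y y
      = qf X⁻¹ y • vecMulVec (X⁻¹ *ᵥ y) y := by
    rw [vecMulVec_mul_vecMulVec, dotProduct_comm, vecMulVec_smul]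
    rfl
  rw [upd_eq, sub_mul, mul_add, mul_add, posDef_inv_mul hX, mul_smul_comm, h1, smul_mul_assoc, h2,
    smul_mul_assoc, mul_smul_comm, h3, smul_smul, smul_smul, mul_assoc, add_sub_assoc, ← add_smul, ← sub_smul]
  have : c⁻¹ - ((c + qf X⁻¹ y)⁻¹ + (c + qf X⁻¹ y)⁻¹ * (c⁻¹ * qf X⁻¹ y)) = 0 := by
    field_simp
    ring
  rw [this, zero_smul, add_zero]

theorem foldl_upd_inv {X : Matrix n n ℝ} (hX : X.PosDef) {c : ℝ} (hc : 0 < c)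
    (ys : List (n → ℝ)) :
    ys.foldl (upd c) X⁻¹ = (X + c⁻¹ • (ys.map fun y => vecMulVec y y).sum)⁻¹ := by
  induction ys generalizing X with
  | nil => simp
  | cons y ys ih =>
    have h : (X + c⁻¹ • vecMulVec y y).PosDef := by
      refine hX.add_posSemidef (PosSemidef.smul ?_ (by positivity))
      simpa using posSemidef_vecMulVec_self_star y
    rw [List.foldl_cons, upd_inv hX hc, ih h, List.map_cons, List.sum_cons, smul_add, add_assoc]

end Update

/-! ### Directions in which the effective dimension drops slowly -/

section Directions

variable {s : ℕ}

/-- The projection of the `l`-th basis vector to the orthogonal complement of the unit vector `a`. -/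
def perp (a : Fin s → ℝ) (l : Fin s) : Fin s → ℝ := Pi.single l 1 - a l • a

theorem sum_smul_perp (a p : Fin s → ℝ) (hp : a ⬝ᵥ p = 0) : ∑ l, p l • perp a l = p := by
  have h1 : ∑ l, p l • (Pi.single l 1 : Fin s → ℝ) = p := by
    ext j
    simp [Finset.sum_apply, Pi.single_apply]
  have h2 : ∑ l, p l • a l • a = (a ⬝ᵥ p) • a := by
    simp only [smul_smul, ← Finset.sum_smul, dotProduct]
    congr 1
    exact Finset.sum_congr rfl fun l _ => mul_comm _ _
  simp only [perp, smul_sub, Finset.sum_sub_distrib, h1, h2, hp, zero_smul, sub_zero]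

theorem map_eq_sum_single {M : Type*} [AddCommGroup M] [Module ℝ M] (φ : (Fin s → ℝ) →ₗ[ℝ] M)
    (v : Fin s → ℝ) : φ v = ∑ l, v l • φ (Pi.single l 1) := by
  have h1 : ∑ l, v l • (Pi.single l 1 : Fin s → ℝ) = v := by
    ext j
    simp [Finset.sum_apply, Pi.single_apply]
  conv_lhs => rw [← h1, map_sum]
  simp only [map_smul]

theorem sq_map_le_perp (φ : (Fin s → ℝ) →ₗ[ℝ] ℝ) (a p : Fin s → ℝ) (hp : a ⬝ᵥ p = 0) :
    φ p ^ 2 ≤ (p ⬝ᵥ p) * ∑ l, φ (perp a l) ^ 2 := by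
  have h : φ p = ∑ l, p l * φ (perp a l) := by
    conv_lhs => rw [← sum_smul_perp a p hp, map_sum]
    simp only [map_smul, smul_eq_mul]
  have h2 : p ⬝ᵥ p = ∑ l, p l ^ 2 := by simp only [dotProduct, sq]
  rw [h, h2]
  exact Finset.sum_mul_sq_le_sq_mul_sq _ _ _

theorem sq_map_le (φ : (Fin s → ℝ) →ₗ[ℝ] ℝ) (v : Fin s → ℝ) :
    φ v ^ 2 ≤ (v ⬝ᵥ v) * ∑ l, φ (Pi.single l 1) ^ 2 := by
  have h : φ v = ∑ l, v l * φ (Pi.single l 1) := by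
    rw [map_eq_sum_single φ v]
    simp only [smul_eq_mul]
  have h2 : v ⬝ᵥ v = ∑ l, v l ^ 2 := by simp only [dotProduct, sq]
  rw [h, h2]
  exact Finset.sum_mul_sq_le_sq_mul_sq _ _ _

theorem sum_sq_perp (φ : (Fin s → ℝ) →ₗ[ℝ] ℝ) (a : Fin s → ℝ) (ha : a ⬝ᵥ a = 1) :
    ∑ l, φ (perp a l) ^ 2 + φ a ^ 2 = ∑ l, φ (Pi.single l 1) ^ 2 := by
  have h : φ a = ∑ l, a l * φ (Pi.single l 1) := by
    rw [map_eq_sum_single φ a]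
    simp only [smul_eq_mul]
  have h1 : ∀ l, φ (perp a l) ^ 2 = φ (Pi.single l 1) ^ 2 -
      2 * φ a * (a l * φ (Pi.single l 1)) + φ a ^ 2 * (a l * a l) := by
    intro l
    rw [perp, map_sub, map_smul, smul_eq_mul]
    ring
  simp only [h1, Finset.sum_add_distrib, Finset.sum_sub_distrib, ← Finset.mul_sum, ← h]
  have h2 : ∑ l, a l * a l = 1 := ha
  rw [h2]
  ring

end Directions

section Superadditivity

variable {n κ : Type*} [Fintype n] [DecidableEq n] [Fintype κ] {s : ℕ}

/-- The form that penalizes, with weight `β`, the contractions with vectors orthogonal to `a`. -/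
noncomputable def penal (β γ : ℝ) (G : Matrix n n ℝ) (L : (Fin s → ℝ) →ₗ[ℝ] κ → n → ℝ)
    (a : Fin s → ℝ) : Matrix n n ℝ :=
  γ • G⁻¹ + β • gram fun t : Fin s × κ => L (perp a t.1) t.2

theorem penal_posDef {β γ : ℝ} (hβ : 0 ≤ β) (hγ : 0 < γ) {G : Matrix n n ℝ} (hG : G.PosDef)
    (L : (Fin s → ℝ) →ₗ[ℝ] κ → n → ℝ) (a : Fin s → ℝ) : (penal β γ G L a).PosDef :=
  (hG.inv.smul hγ).add_posSemidef ((gram_posSemidef _).smul hβ)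

/-- The functional `a ↦ L a α ⬝ᵥ x`. -/
def dotMap (L : (Fin s → ℝ) →ₗ[ℝ] κ → n → ℝ) (x : n → ℝ) (α : κ) : (Fin s → ℝ) →ₗ[ℝ] ℝ where
  toFun a := L a α ⬝ᵥ x
  map_add' a b := by simp [add_dotProduct]
  map_smul' c a := by simp [smul_dotProduct]

/-- Effective dimensions add up over well conditioned directions: if the unit vectors `a i` have
dual vectors `v i` of length at most `D`, the effective dimensions `∑ α, qf (..)⁻¹ (L (a i) α)` of
the contractions with the `a i` sum to at most `5 eff G`. -/
theorem sum_eff_le {G : Matrix n n ℝ} (hG : G.PosDef) {L : (Fin s → ℝ) →ₗ[ℝ] κ → n → ℝ}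
    (hL : ∀ x, ∑ α, ∑ l, (L (Pi.single l 1) α ⬝ᵥ x) ^ 2 ≤ x ⬝ᵥ x) {β γ D : ℝ} (hD : 1 ≤ D)
    (hβ : (2 * s + 2) * D ^ 2 ≤ β) (hγ : β ≤ γ) {a v : Fin s → Fin s → ℝ}
    (ha : ∀ i, a i ⬝ᵥ a i = 1) (hav : ∀ i j, a i ⬝ᵥ v j = if i = j then 1 else 0)
    (hv : ∀ i, v i ⬝ᵥ v i ≤ D ^ 2) :
    ∑ i, ∑ α, qf (penal β γ G L (a i) + gram (L (a i)))⁻¹ (L (a i) α) ≤ 5 * eff G := by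
  have hD2 : 1 ≤ D ^ 2 := one_le_pow₀ hD
  have hs0 : (0 : ℝ) ≤ s := Nat.cast_nonneg s
  have hβ0 : 0 < β := by nlinarith
  have hγ0 : 0 < γ := hβ0.trans_le hγ
  have hQ : ∀ i, (penal β γ G L (a i)).PosDef := fun i => penal_posDef hβ0.le hγ0 hG L (a i)
  have hH : ∀ i, (penal β γ G L (a i) + gram (L (a i))).PosDef := fun i =>
    (hQ i).add_posSemidef (gram_posSemidef _)
  have hGi : (γ • G⁻¹).PosDef := hG.inv.smul hγ0
  have hF0 : ∀ x, 0 ≤ ∑ α, ∑ l, (L (Pi.single l 1) α ⬝ᵥ x) ^ 2 := fun x =>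
    Finset.sum_nonneg fun _ _ => Finset.sum_nonneg fun _ _ => sq_nonneg _
  have hp : ∀ i, a i ⬝ᵥ (v i - a i) = 0 := fun i => by
    rw [dotProduct_sub, ha, hav, if_pos rfl, sub_self]
  have hpD : ∀ i, (v i - a i) ⬝ᵥ (v i - a i) ≤ D ^ 2 := fun i => by
    have h1 := hav i i
    rw [if_pos rfl] at h1
    rw [dotProduct_sub, sub_dotProduct, sub_dotProduct, ha, h1, dotProduct_comm (v i) (a i), h1]
    linarith [hv i]
  -- the contraction with `v l` is controlled by the forms attached to `a i`
  have hdom : ∀ i x, (1 / 2) * ∑ l, ∑ α, (L (v l) α ⬝ᵥ x) ^ 2 ≤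
      β * ∑ α, ∑ l, (L (perp (a i) l) α ⬝ᵥ x) ^ 2 + ∑ α, (L (a i) α ⬝ᵥ x) ^ 2 := by
    intro i x
    set E := ∑ α, ∑ l, (L (perp (a i) l) α ⬝ᵥ x) ^ 2 with hE
    have hE0 : 0 ≤ E := Finset.sum_nonneg fun _ _ => Finset.sum_nonneg fun _ _ => sq_nonneg _
    have hq : ∀ q, a i ⬝ᵥ q = 0 → q ⬝ᵥ q ≤ D ^ 2 → ∑ α, (L q α ⬝ᵥ x) ^ 2 ≤ D ^ 2 * E := by
      intro q h1 h2
      rw [hE, Finset.mul_sum]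
      refine Finset.sum_le_sum fun α _ => ?_
      exact (sq_map_le_perp (dotMap L x α) (a i) q h1).trans
        (mul_le_mul_of_nonneg_right h2 (Finset.sum_nonneg fun _ _ => sq_nonneg _))
    have hl : ∀ l, ∑ α, (L (v l) α ⬝ᵥ x) ^ 2 ≤
        2 * D ^ 2 * E + if i = l then 2 * ∑ α, (L (a i) α ⬝ᵥ x) ^ 2 else 0 := by
      intro l
      split_ifs with h
      · subst h
        have h3 := hq _ (hp i) (hpD i)
        have h4 : ∑ α, (L (v i) α ⬝ᵥ x) ^ 2 ≤
            ∑ α, (2 * (L (v i - a i) α ⬝ᵥ x) ^ 2 + 2 * (L (a i) α ⬝ᵥ x) ^ 2) := by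
          refine Finset.sum_le_sum fun α _ => ?_
          have h5 : L (v i) α ⬝ᵥ x = L (v i - a i) α ⬝ᵥ x + L (a i) α ⬝ᵥ x := by
            rw [map_sub, Pi.sub_apply, sub_dotProduct]
            ring
          rw [h5]
          nlinarith [sq_nonneg (L (v i - a i) α ⬝ᵥ x - L (a i) α ⬝ᵥ x)]
        rw [Finset.sum_add_distrib, ← Finset.mul_sum, ← Finset.mul_sum] at h4
        linarith
      · have h3 := hq (v l) (by rw [hav, if_neg h]) (hv l)
        nlinarith
    have h6 := Finset.sum_le_sum fun l (_ : l ∈ Finset.univ) => hl l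
    rw [Finset.sum_add_distrib, Finset.sum_ite_eq, if_pos (Finset.mem_univ _), Finset.sum_const,
      Finset.card_univ, Fintype.card_fin, nsmul_eq_mul] at h6
    nlinarith [mul_le_mul_of_nonneg_right hβ hE0]
  -- the vectors `v i` together
  set c : ℝ := Real.sqrt (1 / 2) with hc
  have hc2 : c ^ 2 = 1 / 2 := Real.sq_sqrt (by norm_num)
  set w : Fin s × κ → n → ℝ := fun t => c • L (v t.1) t.2 with hw
  have hwx : ∀ x, ∑ t, (w t ⬝ᵥ x) ^ 2 = (1 / 2) * ∑ l, ∑ α, (L (v l) α ⬝ᵥ x) ^ 2 := by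
    intro x
    rw [Fintype.sum_prod_type, Finset.mul_sum]
    refine Finset.sum_congr rfl fun l _ => ?_
    rw [Finset.mul_sum]
    refine Finset.sum_congr rfl fun α _ => ?_
    rw [hw, smul_dotProduct, smul_eq_mul, mul_pow, hc2]
  have hv1 : ∑ i, ∑ α, qf (γ • G⁻¹ + gram w)⁻¹ (L (v i) α) ≤ 2 * eff G := by
    have h := sum_qf_le_eff hG hγ0 w fun x => by
      rw [hwx]
      have h1 : ∀ l, ∑ α, (L (v l) α ⬝ᵥ x) ^ 2 ≤ D ^ 2 * (x ⬝ᵥ x) := by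
        intro l
        refine le_trans ?_ (mul_le_mul (hv l) (hL x) (hF0 x) (by positivity))
        rw [Finset.mul_sum]
        exact Finset.sum_le_sum fun α _ => sq_map_le (dotMap L x α) (v l)
      have h2 := Finset.sum_le_sum fun l (_ : l ∈ Finset.univ) => h1 l
      rw [Finset.sum_const, Finset.card_univ, Fintype.card_fin, nsmul_eq_mul] at h2
      have h3 := dot_sq_nonneg x
      have h4 : (1 / 2) * (s * (D ^ 2 * (x ⬝ᵥ x))) ≤ γ * (x ⬝ᵥ x) := by
        rw [← mul_assoc, ← mul_assoc]
        refine mul_le_mul_of_nonneg_right ?_ h3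
        nlinarith
      linarith
    rw [Fintype.sum_prod_type] at h
    simp only [hw, qf_smul_vec, hc2, ← Finset.mul_sum] at h
    simp only [hw]
    linarith
  have hterm : ∀ i, ∑ α, qf (penal β γ G L (a i) + gram (L (a i)))⁻¹ (L (a i) α) ≤
      2 * ∑ α, qf (γ • G⁻¹ + gram w)⁻¹ (L (v i) α) + 2 * D ^ 2 / β * eff G := by
    intro i
    set H := penal β γ G L (a i) + gram (L (a i)) with hHd
    have hHx : ∀ x, qf H x = γ * qf G⁻¹ x + β * ∑ α, ∑ l, (L (perp (a i) l) α ⬝ᵥ x) ^ 2 +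
        ∑ α, (L (a i) α ⬝ᵥ x) ^ 2 := by
      intro x
      rw [hHd, penal, qf_add, qf_add, qf_smul, qf_smul, qf_gram, qf_gram, Fintype.sum_prod_type,
        Finset.sum_comm]
    obtain ⟨B, hB⟩ := PosSemidef.exists_gram (hH i).inv.posSemidef
    have hBq : ∀ y, qf H⁻¹ y = ∑ r, (y ⬝ᵥ B r) ^ 2 := by
      intro y
      rw [hHd, hB, qf_gram]
      simp only [dotProduct_comm]
    have h1 : ∀ α, qf H⁻¹ (L (a i) α) ≤
        2 * qf H⁻¹ (L (v i) α) + 2 * (D ^ 2 * ∑ l, qf H⁻¹ (L (perp (a i) l) α)) := by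
      intro α
      simp only [hBq]
      rw [Finset.sum_comm, Finset.mul_sum, Finset.mul_sum, Finset.mul_sum,
        ← Finset.sum_add_distrib]
      refine Finset.sum_le_sum fun r _ => ?_
      have h2 := (sq_map_le_perp (dotMap L (B r) α) (a i) _ (hp i)).trans
        (mul_le_mul_of_nonneg_right (hpD i) (Finset.sum_nonneg fun _ _ => sq_nonneg _))
      have h3 : L (a i) α ⬝ᵥ B r = L (v i) α ⬝ᵥ B r - dotMap L (B r) α (v i - a i) := by
        rw [map_sub]
        simp only [dotMap, LinearMap.coe_mk, AddHom.coe_mk]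
        ring
      simp only [dotMap, LinearMap.coe_mk, AddHom.coe_mk] at h2 h3
      rw [h3]
      nlinarith [sq_nonneg (L (v i) α ⬝ᵥ B r + L (v i - a i) α ⬝ᵥ B r)]
    have h2 := Finset.sum_le_sum fun α (_ : α ∈ Finset.univ) => h1 α
    rw [Finset.sum_add_distrib, ← Finset.mul_sum, ← Finset.mul_sum, ← Finset.mul_sum] at h2
    -- the part of `v i` along `a i` is bounded by the form `γ G⁻¹ + ½ ∑ (v l)`
    have h3 : ∑ α, qf H⁻¹ (L (v i) α) ≤ ∑ α, qf (γ • G⁻¹ + gram w)⁻¹ (L (v i) α) := by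
      refine Finset.sum_le_sum fun α _ => qf_inv_anti (hGi.add_posSemidef (gram_posSemidef w))
        (hH i) (fun x => ?_) _
      rw [← hHd, hHx, qf_add, qf_smul, qf_gram, hwx]
      linarith [hdom i x]
    -- the part orthogonal to `a i` is small because of the weight `β`
    have h4 : β * ∑ α, ∑ l, qf H⁻¹ (L (perp (a i) l) α) ≤ eff G := by
      set z : Fin s × κ → n → ℝ := fun t => Real.sqrt β • L (perp (a i) t.1) t.2 with hz
      have hzx : ∀ x, ∑ t, (z t ⬝ᵥ x) ^ 2 = β * ∑ α, ∑ l, (L (perp (a i) l) α ⬝ᵥ x) ^ 2 := by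
        intro x
        rw [Fintype.sum_prod_type, Finset.sum_comm, Finset.mul_sum]
        refine Finset.sum_congr rfl fun l _ => ?_
        rw [Finset.mul_sum]
        refine Finset.sum_congr rfl fun α _ => ?_
        rw [hz, smul_dotProduct, smul_eq_mul, mul_pow, Real.sq_sqrt hβ0.le]
      have h5 := sum_qf_le_eff hG hγ0 z fun x => by
        rw [hzx]
        refine mul_le_mul hγ (le_trans ?_ (hL x)) ?_ hγ0.le
        · refine Finset.sum_le_sum fun α _ => ?_
          have h6 := sum_sq_perp (dotMap L x α) (a i) (ha i)
          simp only [dotMap, LinearMap.coe_mk, AddHom.coe_mk] at h6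
          rw [← h6]
          linarith [sq_nonneg (L (a i) α ⬝ᵥ x)]
        · exact Finset.sum_nonneg fun _ _ => Finset.sum_nonneg fun _ _ => sq_nonneg _
      refine le_trans ?_ h5
      rw [Fintype.sum_prod_type, Finset.sum_comm, Finset.mul_sum]
      refine Finset.sum_le_sum fun l _ => ?_
      rw [Finset.mul_sum]
      refine Finset.sum_le_sum fun α _ => ?_
      rw [hz, qf_smul_vec, Real.sq_sqrt hβ0.le]
      refine mul_le_mul_of_nonneg_left ?_ hβ0.le
      refine qf_inv_anti (hGi.add_posSemidef (gram_posSemidef z)) (hH i) (fun x => ?_) _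
      rw [← hHd, hHx, qf_add, qf_smul, qf_gram, hzx]
      linarith [Finset.sum_nonneg fun α (_ : α ∈ Finset.univ) => sq_nonneg (L (a i) α ⬝ᵥ x)]
    have h5 : 2 * (D ^ 2 * ∑ α, ∑ l, qf H⁻¹ (L (perp (a i) l) α)) ≤ 2 * D ^ 2 / β * eff G := by
      have h6 : 2 * (D ^ 2 * ∑ α, ∑ l, qf H⁻¹ (L (perp (a i) l) α)) =
          2 * D ^ 2 / β * (β * ∑ α, ∑ l, qf H⁻¹ (L (perp (a i) l) α)) := by
        field_simp
      rw [h6]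
      exact mul_le_mul_of_nonneg_left h4 (by positivity)
    linarith
  have hsum := Finset.sum_le_sum fun i (_ : i ∈ Finset.univ) => hterm i
  rw [Finset.sum_add_distrib, ← Finset.mul_sum, Finset.sum_const, Finset.card_univ,
    Fintype.card_fin, nsmul_eq_mul] at hsum
  have heff : 0 ≤ eff G := by
    rw [eff_eq hG]
    have h := sum_qf_le_eff hG hγ0 (fun _ : Fin 0 => (0 : n → ℝ)) fun x => by
      simpa using mul_nonneg hγ0.le (dot_sq_nonneg x)
    rw [eff_eq hG] at h
    simpa using h
  have hlast : s * (2 * D ^ 2 / β * eff G) ≤ eff G := by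
    have h7 : s * (2 * D ^ 2 / β) ≤ 1 := by
      rw [mul_div_assoc', div_le_one hβ0]
      nlinarith
    calc s * (2 * D ^ 2 / β * eff G) = s * (2 * D ^ 2 / β) * eff G := by ring
      _ ≤ 1 * eff G := mul_le_mul_of_nonneg_right h7 heff
      _ = eff G := one_mul _
  linarith

end Superadditivity

/-! ### A hyperplane close to all directions of a set without a well conditioned basis -/

/-- Either some `s` vectors of `T` have dual vectors of length at most `D`, or all of `T` is within
`1 / D` of a hyperplane.  Cramer's rule shows this for the `s`-tuple with the largest
determinant. -/
theorem exists_dual_or_perp {s : ℕ} {T : Set (Fin s → ℝ)} (hT : T.Finite) {D : ℝ}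
    (hD : 0 < D) :
    (∃ a v : Fin s → Fin s → ℝ, (∀ i, a i ∈ T) ∧
      (∀ i j, a i ⬝ᵥ v j = if i = j then 1 else 0) ∧ ∀ i, v i ⬝ᵥ v i ≤ D ^ 2) ∨
    ∃ v : Fin s → ℝ, v ⬝ᵥ v = 1 ∧ ∀ u ∈ T, |v ⬝ᵥ u| ≤ 1 / D := by
  have normalize : ∀ (v : Fin s → ℝ) (c : ℝ), 0 < v ⬝ᵥ v → (c / Real.sqrt (v ⬝ᵥ v) ≤ 1 / D) →
      (∀ u ∈ T, |v ⬝ᵥ u| ≤ c) → ∃ v : Fin s → ℝ, v ⬝ᵥ v = 1 ∧ ∀ u ∈ T, |v ⬝ᵥ u| ≤ 1 / D := by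
    intro v c hv hc hu
    have hr : 0 < Real.sqrt (v ⬝ᵥ v) := Real.sqrt_pos.2 hv
    refine ⟨(Real.sqrt (v ⬝ᵥ v))⁻¹ • v, ?_, fun u hu' => le_trans ?_ hc⟩
    · rw [smul_dotProduct, dotProduct_smul, smul_eq_mul, smul_eq_mul, ← mul_assoc, ← mul_inv,
        Real.mul_self_sqrt hv.le, inv_mul_cancel₀ hv.ne']
    · rw [smul_dotProduct, smul_eq_mul, abs_mul, abs_inv, abs_of_pos hr, inv_mul_eq_div]
      exact div_le_div_of_nonneg_right (hu u hu') hr.le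
  have : Finite T := hT
  by_cases hspan : Submodule.span ℝ T = ⊤
  · obtain ⟨a₀, ha₀⟩ : ∃ a : Fin s → T, (of fun i => (a i : Fin s → ℝ)).det ≠ 0 := by
      let b := Module.Basis.ofSpan hspan.ge
      have hb : ∀ i, b i ∈ T := fun i =>
        Module.Basis.ofSpan_subset hspan.ge ⟨i, rfl⟩
      let e := b.indexEquiv (Pi.basisFun ℝ (Fin s))
      refine ⟨fun i => ⟨b (e.symm i), hb _⟩, ?_⟩
      have hli : LinearIndependent ℝ fun i => b (e.symm i) :=
        b.linearIndependent.comp _ e.symm.injective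
      have := (Matrix.linearIndependent_rows_iff_isUnit (A := of fun i => b (e.symm i))).1 hli
      exact ((Matrix.isUnit_iff_isUnit_det _).1 this).ne_zero
    have : Nonempty (Fin s → T) := ⟨a₀⟩
    obtain ⟨a, ha⟩ := Finite.exists_max fun a : Fin s → T => |(of fun i => (a i : Fin s → ℝ)).det|
    set A : Matrix (Fin s) (Fin s) ℝ := of fun i => (a i : Fin s → ℝ) with hA
    have hdet : 0 < |A.det| := (abs_pos.2 ha₀).trans_le (ha a₀)
    have hdet' : A.det ≠ 0 := abs_pos.1 hdet
    have hAA : A * A⁻¹ = 1 := mul_nonsing_inv _ (isUnit_iff_ne_zero.2 hdet')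
    let v : Fin s → Fin s → ℝ := fun j i => A⁻¹ i j
    have hav : ∀ i j, (a i : Fin s → ℝ) ⬝ᵥ v j = if i = j then 1 else 0 := by
      intro i j
      have := congrFun (congrFun hAA i) j
      rw [mul_apply, one_apply] at this
      exact this
    have hvu : ∀ j, ∀ u ∈ T, |v j ⬝ᵥ u| ≤ 1 := by
      intro j u hu
      have h1 : u ⬝ᵥ v j = (A.updateRow j u).det / A.det := by
        rw [← cramer_transpose_apply, cramer_eq_adjugate_mulVec, ← adjugate_transpose]
        have h2 : A⁻¹ = A.det⁻¹ • A.adjugate := by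
          rw [inv_def, Ring.inverse_eq_inv']
        simp only [v, h2, dotProduct, mulVec, transpose_apply, Matrix.smul_apply, smul_eq_mul]
        rw [Finset.sum_div]
        refine Finset.sum_congr rfl fun i _ => ?_
        field_simp
      have h3 : A.updateRow j u = of fun i => ((Function.update a j ⟨u, hu⟩ i : T) : Fin s → ℝ) := by
        ext i l
        rw [updateRow_apply, of_apply, Function.update_apply]
        split_ifs <;> simp [hA]
      rw [dotProduct_comm, h1, abs_div, div_le_one hdet, h3]
      exact ha _
    by_cases hD' : ∀ i, v i ⬝ᵥ v i ≤ D ^ 2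
    · exact Or.inl ⟨fun i => a i, v, fun i => (a i).2, hav, hD'⟩
    · push Not at hD'
      obtain ⟨i, hi⟩ := hD'
      refine Or.inr (normalize (v i) 1 (lt_trans (by positivity) hi) ?_ (hvu i))
      refine one_div_le_one_div_of_le hD ?_
      exact Real.le_sqrt_of_sq_le hi.le
  · obtain ⟨f, hf, hTf⟩ := Submodule.exists_le_ker_of_lt_top _ (lt_top_iff_ne_top.2 hspan)
    have hfv : ∀ u, (fun i => f (Pi.single i 1)) ⬝ᵥ u = f u := by
      intro u
      rw [map_eq_sum_single f u, dotProduct]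
      exact Finset.sum_congr rfl fun i _ => by rw [smul_eq_mul, mul_comm]
    refine Or.inr (normalize (fun i => f (Pi.single i 1)) 0 (dot_sq_pos fun h0 => hf ?_) ?_ ?_)
    · ext i
      simpa using congrFun h0 i
    · simp [hD.le]
    · intro u hu
      rw [hfv, show f u = 0 from hTf (Submodule.subset_span hu), abs_zero]

/-- If contraction with every unit vector of `T` leaves an effective dimension above
`5 / s * eff G`, then `T` is close to a hyperplane. -/
theorem exists_perp_of_eff {n κ : Type*} [Fintype n] [DecidableEq n] [Fintype κ] {s : ℕ}
    (hs : 0 < s) {G : Matrix n n ℝ} (hG : G.PosDef) {L : (Fin s → ℝ) →ₗ[ℝ] κ → n → ℝ}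
    (hL : ∀ x, ∑ α, ∑ l, (L (Pi.single l 1) α ⬝ᵥ x) ^ 2 ≤ x ⬝ᵥ x) {β γ D κ₀ : ℝ} (hD : 1 ≤ D)
    (hβ : (2 * s + 2) * D ^ 2 ≤ β) (hγ : β ≤ γ) {T : Set (Fin s → ℝ)} (hT : T.Finite)
    (hT1 : ∀ a ∈ T, a ⬝ᵥ a = 1) (hκ : 5 * eff G ≤ s * κ₀)
    (hTκ : ∀ a ∈ T, κ₀ < ∑ α, qf (penal β γ G L a + gram (L a))⁻¹ (L a α)) :
    ∃ v : Fin s → ℝ, v ⬝ᵥ v = 1 ∧ ∀ u ∈ T, |v ⬝ᵥ u| ≤ 1 / D := by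
  rcases exists_dual_or_perp hT (one_pos.trans_le hD) with ⟨a, v, ha, hav, hv⟩ | h
  · exfalso
    have h1 := sum_eff_le hG hL hD hβ hγ (fun i => hT1 _ (ha i)) hav hv
    have : Nonempty (Fin s) := ⟨⟨0, hs⟩⟩
    have h2 := Finset.sum_lt_sum_of_nonempty (Finset.univ_nonempty (α := Fin s))
      fun i _ => hTκ _ (ha i)
    rw [Finset.sum_const, Finset.card_univ, Fintype.card_fin, nsmul_eq_mul] at h2
    linarith
  · exact h

/-! ### Vectors, tensor products and orthonormal lists -/

section Vectors

variable {m n : ℕ}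

/-- The Euclidean length of a vector. -/
noncomputable def len (x : Fin m → ℝ) : ℝ := Real.sqrt (x ⬝ᵥ x)

theorem len_nonneg (x : Fin m → ℝ) : 0 ≤ len x := Real.sqrt_nonneg _

theorem len_sq (x : Fin m → ℝ) : len x ^ 2 = x ⬝ᵥ x := Real.sq_sqrt (dot_sq_nonneg x)

theorem len_eq_norm (x : Fin m → ℝ) : len x = ‖(WithLp.toLp 2 x : EuclideanSpace ℝ (Fin m))‖ := by
  rw [EuclideanSpace.norm_eq, len]
  congr 1
  exact Finset.sum_congr rfl fun i _ => by simp [sq]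

theorem len_add_le (x y : Fin m → ℝ) : len (x + y) ≤ len x + len y := by
  simp only [len_eq_norm, WithLp.toLp_add]
  exact norm_add_le _ _

theorem len_smul (c : ℝ) (x : Fin m → ℝ) : len (c • x) = |c| * len x := by
  simp only [len_eq_norm, WithLp.toLp_smul, norm_smul, Real.norm_eq_abs]

theorem abs_dot_le (x y : Fin m → ℝ) : |x ⬝ᵥ y| ≤ len x * len y := by
  have h := abs_real_inner_le_norm (WithLp.toLp 2 x : EuclideanSpace ℝ (Fin m)) (WithLp.toLp 2 y)
  rw [EuclideanSpace.inner_eq_star_dotProduct] at h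
  simpa [len_eq_norm, dotProduct_comm] using h

theorem len_zero : len (0 : Fin m → ℝ) = 0 := by simp [len]

theorem len_eq_one {x : Fin m → ℝ} (h : x ⬝ᵥ x = 1) : len x = 1 := by simp [len, h]

/-- The tensor product of two vectors, with the index of the first factor the major one. -/
def kron (u : Fin m → ℝ) (f : Fin n → ℝ) : Fin (m * n) → ℝ := fun t => u t.divNat * f t.modNat

theorem sum_fin_mul (g : Fin (m * n) → ℝ) : ∑ t, g t = ∑ i, ∑ j, g (finProdFinEquiv (i, j)) := by
  rw [← finProdFinEquiv.sum_comp, Fintype.sum_prod_type]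

theorem kron_apply (u : Fin m → ℝ) (f : Fin n → ℝ) (i : Fin m) (j : Fin n) :
    kron u f (finProdFinEquiv (i, j)) = u i * f j := by
  have h := finProdFinEquiv.symm_apply_apply (i, j)
  have h1 : (finProdFinEquiv (i, j)).divNat = i := congrArg Prod.fst h
  have h2 : (finProdFinEquiv (i, j)).modNat = j := congrArg Prod.snd h
  rw [kron, h1, h2]

theorem kron_dot (u x : Fin m → ℝ) (f y : Fin n → ℝ) :
    kron u f ⬝ᵥ kron x y = (u ⬝ᵥ x) * (f ⬝ᵥ y) := by
  simp only [dotProduct]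
  rw [sum_fin_mul]
  simp only [kron_apply]
  rw [Finset.sum_mul]
  refine Finset.sum_congr rfl fun i _ => ?_
  rw [Finset.mul_sum]
  exact Finset.sum_congr rfl fun j _ => by ring

theorem kron_add_left (u v : Fin m → ℝ) (f : Fin n → ℝ) : kron (u + v) f = kron u f + kron v f := by
  ext t; simp [kron, add_mul]

theorem kron_smul_left (c : ℝ) (u : Fin m → ℝ) (f : Fin n → ℝ) :
    kron (c • u) f = c • kron u f := by
  ext t; simp [kron, mul_assoc]

theorem kron_single_dot (u : Fin m → ℝ) (α : Fin n) (x : Fin (m * n) → ℝ) :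
    kron u (Pi.single α 1) ⬝ᵥ x = ∑ i, u i * x (finProdFinEquiv (i, α)) := by
  rw [dotProduct, sum_fin_mul]
  refine Finset.sum_congr rfl fun i _ => ?_
  simp only [kron_apply]
  rw [Finset.sum_eq_single α]
  · simp
  · intro j _ hj
    simp [hj]
  · simp

/-- Contraction with an orthonormal system does not increase lengths. -/
theorem sum_sq_kron_le {s : ℕ} {b : Fin s → Fin m → ℝ}
    (hb : ∀ i j, b i ⬝ᵥ b j = if i = j then 1 else 0) (x : Fin (m * n) → ℝ) :
    ∑ α, ∑ l, (kron (b l) (Pi.single α 1) ⬝ᵥ x) ^ 2 ≤ x ⬝ᵥ x := by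
  have h1 : x ⬝ᵥ x = ∑ α : Fin n, ∑ i : Fin m, x (finProdFinEquiv (i, α)) ^ 2 := by
    rw [dotProduct, sum_fin_mul, Finset.sum_comm]
    simp only [sq]
  rw [h1]
  refine Finset.sum_le_sum fun α _ => ?_
  simp only [kron_single_dot]
  have hon : Orthonormal ℝ fun l => (WithLp.toLp 2 (b l) : EuclideanSpace ℝ (Fin m)) := by
    rw [orthonormal_iff_ite]
    intro i j
    rw [EuclideanSpace.inner_eq_star_dotProduct]
    simpa [dotProduct_comm] using hb i j
  have h2 := hon.sum_inner_products_le
    (x := WithLp.toLp 2 fun i => x (finProdFinEquiv (i, α))) (s := Finset.univ)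
  rw [EuclideanSpace.norm_sq_eq] at h2
  simp only [Real.norm_eq_abs, sq_abs] at h2
  refine le_trans (le_of_eq (Finset.sum_congr rfl fun l _ => ?_)) h2
  rw [EuclideanSpace.inner_eq_star_dotProduct]
  congr 1
  simp [dotProduct, mul_comm]

/-- The standard basis as a list. -/
def unitVecs (n : ℕ) : List (Fin n → ℝ) := List.ofFn fun i => Pi.single i 1

/-- A list of orthonormal vectors. -/
def ON (B : List (Fin m → ℝ)) : Prop := B.Pairwise (fun a b => a ⬝ᵥ b = 0) ∧ ∀ b ∈ B, b ⬝ᵥ b = 1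

/-- The orthogonal projection to the span of a list of orthonormal vectors. -/
def proj (B : List (Fin m → ℝ)) (x : Fin m → ℝ) : Fin m → ℝ := (B.map fun b => (b ⬝ᵥ x) • b).sum

theorem proj_cons (b : Fin m → ℝ) (B : List (Fin m → ℝ)) (x : Fin m → ℝ) :
    proj (b :: B) x = (b ⬝ᵥ x) • b + proj B x := rfl

theorem proj_add (B : List (Fin m → ℝ)) (x y : Fin m → ℝ) :
    proj B (x + y) = proj B x + proj B y := by
  induction B with
  | nil => simp [proj]
  | cons b B ih =>
    rw [proj_cons, proj_cons, proj_cons, ih, dotProduct_add, add_smul]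
    abel

theorem proj_smul (B : List (Fin m → ℝ)) (c : ℝ) (x : Fin m → ℝ) :
    proj B (c • x) = c • proj B x := by
  induction B with
  | nil => simp [proj]
  | cons b B ih => rw [proj_cons, proj_cons, ih, dotProduct_smul, smul_add, smul_smul, smul_eq_mul]

theorem ON.of_cons {b : Fin m → ℝ} {B : List (Fin m → ℝ)} (h : ON (b :: B)) : ON B :=
  ⟨(List.pairwise_cons.1 h.1).2, fun c hc => h.2 c (List.mem_cons_of_mem _ hc)⟩

theorem proj_eq_zero {B : List (Fin m → ℝ)} {x : Fin m → ℝ} (h : ∀ b ∈ B, b ⬝ᵥ x = 0) :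
    proj B x = 0 := by
  induction B with
  | nil => rfl
  | cons b B ih =>
    rw [proj_cons, h b (List.mem_cons_self), ih fun c hc => h c (List.mem_cons_of_mem _ hc),
      zero_smul, zero_add]

theorem ON.proj_mem {B : List (Fin m → ℝ)} (h : ON B) {b : Fin m → ℝ} (hb : b ∈ B) :
    proj B b = b := by
  induction B with
  | nil => simp at hb
  | cons c B ih =>
    have hp := List.pairwise_cons.1 h.1
    rw [proj_cons]
    rcases List.mem_cons.1 hb with rfl | hb'
    · rw [h.2 b List.mem_cons_self, one_smul, proj_eq_zero, add_zero]
      intro a ha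
      rw [dotProduct_comm]
      exact hp.1 a ha
    · rw [hp.1 b hb', zero_smul, zero_add, ih h.of_cons hb']

theorem dot_proj_comm (B : List (Fin m → ℝ)) (x y : Fin m → ℝ) :
    x ⬝ᵥ proj B y = proj B x ⬝ᵥ y := by
  induction B with
  | nil => simp [proj]
  | cons b B ih =>
    rw [proj_cons, proj_cons, dotProduct_add, add_dotProduct, ih, dotProduct_smul, smul_dotProduct,
      dotProduct_comm x b, smul_eq_mul, smul_eq_mul, mul_comm]

theorem ON.proj_sum {s : ℕ} {B : List (Fin m → ℝ)} (h : ON B) {b : Fin s → Fin m → ℝ}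
    (hb : ∀ i, b i ∈ B) (c : Fin s → ℝ) : proj B (∑ i, c i • b i) = ∑ i, c i • b i := by
  have h0 : proj B 0 = 0 := proj_eq_zero fun b _ => dotProduct_zero b
  have : ∀ S : Finset (Fin s), proj B (∑ i ∈ S, c i • b i) = ∑ i ∈ S, c i • b i := by
    intro S
    induction S using Finset.induction_on with
    | empty => simpa using h0
    | insert i S hi ih =>
      rw [Finset.sum_insert hi, proj_add, proj_smul, h.proj_mem (hb i), ih]
  exact this _

/-- The reflection in the hyperplane orthogonal to `w`. -/
noncomputable def reflect (w b : Fin m → ℝ) : Fin m → ℝ := b - (2 * (w ⬝ᵥ b) / (w ⬝ᵥ w)) • w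

theorem reflect_dot (w a b : Fin m → ℝ) : reflect w a ⬝ᵥ b = a ⬝ᵥ reflect w b := by
  simp only [reflect, sub_dotProduct, dotProduct_sub, smul_dotProduct, dotProduct_smul, smul_eq_mul]
  rw [dotProduct_comm a w]
  ring

theorem reflect_reflect (w b : Fin m → ℝ) : reflect w (reflect w b) = b := by
  by_cases hw : w = 0
  · simp [reflect, hw]
  · have h := (dot_sq_pos hw).ne'
    simp only [reflect, dotProduct_sub, dotProduct_smul, smul_eq_mul]
    have : 2 * (w ⬝ᵥ b - 2 * (w ⬝ᵥ b) / (w ⬝ᵥ w) * (w ⬝ᵥ w)) / (w ⬝ᵥ w)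
        = -(2 * (w ⬝ᵥ b) / (w ⬝ᵥ w)) := by
      field_simp
      ring
    rw [this]
    simp

theorem reflect_dot_reflect (w a b : Fin m → ℝ) : reflect w a ⬝ᵥ reflect w b = a ⬝ᵥ b := by
  rw [reflect_dot, reflect_reflect]

theorem reflect_add (w a b : Fin m → ℝ) : reflect w (a + b) = reflect w a + reflect w b := by
  have : 2 * (w ⬝ᵥ a + w ⬝ᵥ b) / (w ⬝ᵥ w) = 2 * (w ⬝ᵥ a) / (w ⬝ᵥ w) + 2 * (w ⬝ᵥ b) / (w ⬝ᵥ w) := by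
    ring
  simp only [reflect, dotProduct_add, this, add_smul]
  abel

theorem reflect_smul (w : Fin m → ℝ) (c : ℝ) (a : Fin m → ℝ) :
    reflect w (c • a) = c • reflect w a := by
  have : 2 * (c * (w ⬝ᵥ a)) / (w ⬝ᵥ w) = c * (2 * (w ⬝ᵥ a) / (w ⬝ᵥ w)) := by ring
  simp only [reflect, dotProduct_smul, smul_eq_mul, this, smul_sub, smul_smul]

/-- The reflection with `w = v - b` exchanges the unit vectors `b` and `v`. -/
theorem reflect_sub_self {v b : Fin m → ℝ} (hv : v ⬝ᵥ v = 1) (hb : b ⬝ᵥ b = 1) :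
    reflect (v - b) b = v := by
  by_cases hw : v - b = 0
  · rw [hw, sub_eq_zero.1 hw]
    simp [reflect]
  · have h := dot_sq_pos hw
    have h1 : 2 * ((v - b) ⬝ᵥ b) = -((v - b) ⬝ᵥ (v - b)) := by
      simp only [sub_dotProduct, dotProduct_sub, hv, hb, dotProduct_comm b v]
      ring
    rw [reflect, h1, neg_div, div_self h.ne']
    simp

theorem proj_map_reflect (w : Fin m → ℝ) (B : List (Fin m → ℝ)) (x : Fin m → ℝ) :
    proj (B.map (reflect w)) x = reflect w (proj B (reflect w x)) := by
  induction B with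
  | nil => simp [proj, reflect]
  | cons b B ih =>
    rw [List.map_cons, proj_cons, proj_cons, ih, reflect_add, reflect_smul, reflect_dot]

/-- Reflecting an orthonormal system in a vector of its span does not change the span. -/
theorem proj_map_reflect_eq {w : Fin m → ℝ} {B : List (Fin m → ℝ)} (hw : proj B w = w)
    (x : Fin m → ℝ) : proj (B.map (reflect w)) x = proj B x := by
  have h1 : ∀ (y : Fin m → ℝ) (c : ℝ), reflect w (y - c • w) = reflect w y + c • w := by
    intro y c
    rw [sub_eq_add_neg, ← neg_smul, reflect_add, reflect_smul]
    congr 1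
    by_cases hw0 : w = 0
    · simp [hw0, reflect]
    · have h := (dot_sq_pos hw0).ne'
      rw [reflect, mul_div_assoc, div_self h]
      module
  have h2 : proj B (reflect w x) = proj B x - (2 * (w ⬝ᵥ x) / (w ⬝ᵥ w)) • w := by
    rw [reflect, sub_eq_add_neg, ← neg_smul, proj_add, proj_smul, hw]
    module
  rw [proj_map_reflect, h2, h1, reflect, dot_proj_comm, hw]
  simp

theorem ON.map_reflect {B : List (Fin m → ℝ)} (h : ON B) (w : Fin m → ℝ) :
    ON (B.map (reflect w)) := by
  refine ⟨h.1.map _ fun a b hab => by rwa [reflect_dot_reflect], fun b hb => ?_⟩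
  obtain ⟨a, ha, rfl⟩ := List.mem_map.1 hb
  rw [reflect_dot_reflect, h.2 a ha]

theorem ON.of_tail {B : List (Fin m → ℝ)} (h : ON B) : ON B.tail := by
  cases B with
  | nil => exact h
  | cons b B => exact h.of_cons

/-- An orthonormal basis of the orthogonal complement of `v` in the span of `B`: the images of all
vectors of `B` but the first under the reflection that takes the first one to `v`. -/
noncomputable def cut (B : List (Fin m → ℝ)) (v : Fin m → ℝ) : List (Fin m → ℝ) :=
  B.tail.map (reflect (v - B.headI))

theorem length_cut (B : List (Fin m → ℝ)) (v : Fin m → ℝ) : (cut B v).length = B.length - 1 := by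
  simp [cut]

theorem ON.cut {B : List (Fin m → ℝ)} (h : ON B) (v : Fin m → ℝ) : ON (cut B v) :=
  h.of_tail.map_reflect _

theorem ON.proj_cut {B : List (Fin m → ℝ)} (h : ON B) (hB : B ≠ []) {v : Fin m → ℝ}
    (hv : v ⬝ᵥ v = 1) (hvB : proj B v = v) (x : Fin m → ℝ) :
    proj B x = (v ⬝ᵥ x) • v + proj (NearZeroCover.cut B v) x := by
  cases B with
  | nil => exact absurd rfl hB
  | cons b B =>
    have hb := h.2 b List.mem_cons_self
    have hw : proj (b :: B) (v - b) = v - b := by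
      have h1 : v - b = v + (-1 : ℝ) • b := by module
      rw [h1, proj_add, proj_smul, hvB, h.proj_mem List.mem_cons_self]
    rw [← proj_map_reflect_eq hw, List.map_cons, proj_cons, reflect_sub_self hv hb]
    rfl

end Vectors

/-! ### Nets -/

section Nets

variable {m : ℕ}

/-- All combinations of the vectors `bs` with coefficients from `grid`. -/
def comb (grid : List ℝ) (bs : List (Fin m → ℝ)) : List (Fin m → ℝ) :=
  bs.foldl (fun acc b => acc.flatMap fun p => grid.map fun c => p + c • b) [0]

theorem comb_append (grid : List ℝ) (bs : List (Fin m → ℝ)) (b : Fin m → ℝ) :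
    comb grid (bs ++ [b]) = (comb grid bs).flatMap fun p => grid.map fun c => p + c • b := by
  simp [comb, List.foldl_append]

theorem length_comb (grid : List ℝ) (bs : List (Fin m → ℝ)) :
    (comb grid bs).length = grid.length ^ bs.length := by
  induction bs using List.reverseRecOn with
  | nil => simp [comb]
  | append_singleton bs b ih =>
    rw [comb_append, List.length_flatMap]
    simp [ih, pow_succ]

theorem mem_comb {grid : List ℝ} {s : ℕ} {b : Fin s → Fin m → ℝ} {p : Fin m → ℝ} :
    p ∈ comb grid (List.ofFn b) ↔ ∃ c : Fin s → ℝ, (∀ i, c i ∈ grid) ∧ p = ∑ i, c i • b i := by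
  induction s generalizing p with
  | zero => simp [comb]
  | succ s ih =>
    rw [List.ofFn_succ', List.concat_eq_append, comb_append]
    simp only [List.mem_flatMap, List.mem_map, ih]
    constructor
    · rintro ⟨p, ⟨c, hc, rfl⟩, d, hd, rfl⟩
      refine ⟨Fin.snoc c d, fun i => ?_, ?_⟩
      · refine Fin.lastCases ?_ (fun i => ?_) i <;> simp [hd, hc]
      · rw [Fin.sum_univ_castSucc]
        simp
    · rintro ⟨c, hc, rfl⟩
      exact ⟨_, ⟨fun i => c i.castSucc, fun i => hc _, rfl⟩, c (Fin.last s), hc _,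
        (Fin.sum_univ_castSucc fun i => c i • b i).symm⟩

/-- `grid` is an `h`-net of the interval `[-1, 1]`. -/
def IsGrid (grid : List ℝ) (h : ℝ) : Prop := ∀ t : ℝ, |t| ≤ 1 → ∃ g ∈ grid, |g - t| ≤ h

theorem IsGrid.exists_close {grid : List ℝ} {h τ : ℝ} (hg : IsGrid grid h) {s : ℕ}
    (hτ : s * h ≤ τ) (x : Fin s → ℝ) (hx : len x ≤ 1) :
    ∃ c : Fin s → ℝ, (∀ i, c i ∈ grid) ∧ len (c - x) ≤ τ := by
  have hxi : ∀ i, |x i| ≤ 1 := by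
    intro i
    have := abs_dot_le x (Pi.single i 1)
    rw [dotProduct_single_one] at this
    rw [len_eq_one (by simp : (Pi.single i 1 : Fin s → ℝ) ⬝ᵥ Pi.single i 1 = 1)] at this
    linarith
  choose c hc hcx using fun i => hg (x i) (hxi i)
  refine ⟨c, hc, le_trans ?_ hτ⟩
  rcases Nat.eq_zero_or_pos s with rfl | hs
  · simp [len]
  have hh : 0 ≤ h := (abs_nonneg _).trans (hcx ⟨0, hs⟩)
  have h1 : (c - x) ⬝ᵥ (c - x) ≤ (s * h) ^ 2 := by
    have h2 : ∀ i ∈ Finset.univ, (c - x) i * (c - x) i ≤ h ^ 2 := by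
      intro i _
      rw [← sq, ← sq_abs]
      exact pow_le_pow_left₀ (abs_nonneg _) (hcx i) 2
    have h3 := Finset.sum_le_sum h2
    rw [Finset.sum_const, Finset.card_univ, Fintype.card_fin, nsmul_eq_mul] at h3
    refine h3.trans ?_
    have : (1 : ℝ) ≤ s := by exact_mod_cast hs
    rw [mul_pow]
    exact mul_le_mul_of_nonneg_right (by nlinarith) (sq_nonneg h)
  rw [len]
  exact Real.sqrt_le_iff.2 ⟨by positivity, h1⟩

/-- The unit vector in the direction of `u` (zero for `u = 0`). -/
noncomputable def normalize (u : Fin m → ℝ) : Fin m → ℝ := (len u)⁻¹ • u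

theorem normalize_dot_self {u : Fin m → ℝ} (hu : u ≠ 0) : normalize u ⬝ᵥ normalize u = 1 := by
  have h := dot_sq_pos hu
  rw [normalize, smul_dotProduct, dotProduct_smul, smul_eq_mul, smul_eq_mul, ← mul_assoc, ← mul_inv,
    ← sq, len_sq, inv_mul_cancel₀ h.ne']

theorem len_smul_normalize (u : Fin m → ℝ) : len u • normalize u = u := by
  by_cases hu : u = 0
  · simp [hu, normalize]
  · have h : len u ≠ 0 := (Real.sqrt_pos.2 (dot_sq_pos hu)).ne'
    rw [normalize, smul_smul, mul_inv_cancel₀ h, one_smul]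

end Nets

/-! ### Contraction of a covariance matrix -/

section Contraction

variable {m n : ℕ}

/-- The inverse of the form that penalizes the contractions with vectors of `bs` orthogonal
to `u`. -/
noncomputable def penInv (β : ℝ) (bs : List (Fin m → ℝ)) (G : Matrix (Fin (m * n)) (Fin (m * n)) ℝ)
    (u : Fin m → ℝ) : Matrix (Fin (m * n)) (Fin (m * n)) ℝ :=
  (bs.flatMap fun b => (unitVecs n).map (kron (b - (b ⬝ᵥ u) • u))).foldl (upd (1 / β))
    ((1 / β) • G)

/-- The covariance matrix of the contractions with `u`. -/
noncomputable def child (β : ℝ) (bs : List (Fin m → ℝ)) (G : Matrix (Fin (m * n)) (Fin (m * n)) ℝ)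
    (u : Fin m → ℝ) : Matrix (Fin n) (Fin n) ℝ :=
  image (fun α => kron u (Pi.single α 1)) (penInv β bs G u)

/-- The effective dimension of `child`. -/
noncomputable def childEff (β : ℝ) (bs : List (Fin m → ℝ))
    (G : Matrix (Fin (m * n)) (Fin (m * n)) ℝ) (u : Fin m → ℝ) : ℝ :=
  (((unitVecs n).map (kron u)).map
    (qf (((unitVecs n).map (kron u)).foldl (upd 1) (penInv β bs G u)))).sum

/-- The contractions with the vectors of `b`, in coordinates. -/
noncomputable def kronMap (n : ℕ) {s : ℕ} (b : Fin s → Fin m → ℝ) :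
    (Fin s → ℝ) →ₗ[ℝ] Fin n → Fin (m * n) → ℝ where
  toFun a α := kron (∑ l, a l • b l) (Pi.single α 1)
  map_add' a a' := by
    ext α t
    simp [add_smul, Finset.sum_add_distrib, kron_add_left]
  map_smul' c a := by
    ext α t
    simp [mul_smul, ← Finset.smul_sum, kron_smul_left]

theorem kronMap_apply {s : ℕ} (b : Fin s → Fin m → ℝ) (a : Fin s → ℝ) (α : Fin n) :
    kronMap n b a α = kron (∑ l, a l • b l) (Pi.single α 1) := rfl

variable {s : ℕ} {b : Fin s → Fin m → ℝ} {G : Matrix (Fin (m * n)) (Fin (m * n)) ℝ} {β : ℝ}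

theorem dot_sum_smul (hb : ∀ i j, b i ⬝ᵥ b j = if i = j then 1 else 0) (l : Fin s)
    (a : Fin s → ℝ) : b l ⬝ᵥ ∑ i, a i • b i = a l := by
  rw [dotProduct_sum]
  simp [dotProduct_smul, hb]

theorem sum_smul_dot_sum_smul (hb : ∀ i j, b i ⬝ᵥ b j = if i = j then 1 else 0)
    (a c : Fin s → ℝ) : (∑ i, a i • b i) ⬝ᵥ (∑ i, c i • b i) = a ⬝ᵥ c := by
  rw [sum_dotProduct]
  simp only [smul_dotProduct, dot_sum_smul hb, smul_eq_mul]
  rfl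

theorem sum_smul_dot (b : Fin s → Fin m → ℝ) (a : Fin s → ℝ) (x : Fin m → ℝ) :
    (∑ l, a l • b l) ⬝ᵥ x = a ⬝ᵥ fun l => b l ⬝ᵥ x := by
  rw [sum_dotProduct]
  simp only [smul_dotProduct, smul_eq_mul]
  rfl

theorem len_sum_smul (hb : ∀ i j, b i ⬝ᵥ b j = if i = j then 1 else 0) (a : Fin s → ℝ) :
    len (∑ l, a l • b l) = len a := by
  rw [len, len, sum_smul_dot_sum_smul hb]

/-- Bessel's inequality. -/
theorem len_coord_le (hb : ∀ i j, b i ⬝ᵥ b j = if i = j then 1 else 0) {x : Fin m → ℝ}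
    (hx : len x ≤ 1) : len (fun l => b l ⬝ᵥ x) ≤ 1 := by
  set ξ : Fin s → ℝ := fun l => b l ⬝ᵥ x with hξ
  have h1 : ξ ⬝ᵥ ξ ≤ len ξ * 1 := by
    rw [← len_sum_smul hb]
    conv_lhs => rw [hξ, ← sum_smul_dot]
    exact (le_abs_self _).trans ((abs_dot_le _ _).trans
      (mul_le_mul_of_nonneg_left hx (len_nonneg _)))
  rw [← len_sq] at h1
  nlinarith [len_nonneg ξ]

theorem sum_perp_smul (hb : ∀ i j, b i ⬝ᵥ b j = if i = j then 1 else 0) (a : Fin s → ℝ)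
    (l : Fin s) : ∑ i, perp a l i • b i = b l - (b l ⬝ᵥ ∑ i, a i • b i) • ∑ i, a i • b i := by
  rw [dot_sum_smul hb]
  simp only [perp, Pi.sub_apply, Pi.smul_apply, sub_smul, Finset.sum_sub_distrib, smul_assoc,
    ← Finset.smul_sum]
  congr 1
  simp [Pi.single_apply]

theorem sum_map_vecMulVec_flatMap {k : ℕ} (F : Fin s → Fin n → Fin k → ℝ) :
    (((List.ofFn fun l => List.ofFn fun α => F l α).flatten).map fun y => vecMulVec y y).sum =
      gram fun t : Fin s × Fin n => F t.1 t.2 := by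
  rw [List.map_flatten, List.sum_flatten, List.map_map, List.map_ofFn, List.sum_ofFn, gram,
    Fintype.sum_prod_type]
  refine Finset.sum_congr rfl fun l _ => ?_
  simp [List.map_ofFn, List.sum_ofFn]

theorem penInv_eq (hb : ∀ i j, b i ⬝ᵥ b j = if i = j then 1 else 0) (hβ : 0 < β) (hG : G.PosDef)
    (a : Fin s → ℝ) : penInv β (List.ofFn b) G (∑ l, a l • b l) =
      (penal β β G (kronMap n b) a)⁻¹ := by
  have h0 : (1 / β) • G = (β • G⁻¹)⁻¹ := by
    symm
    apply inv_eq_left_inv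
    rw [smul_mul_smul_comm, posDef_mul_inv hG, one_div, inv_mul_cancel₀ hβ.ne', one_smul]
  have h1 : ((List.ofFn b).flatMap fun c => (unitVecs n).map
      (kron (c - (c ⬝ᵥ ∑ l, a l • b l) • ∑ l, a l • b l))) =
      (List.ofFn fun l => List.ofFn fun α => kronMap n b (perp a l) α).flatten := by
    rw [List.flatMap_def, List.map_ofFn]
    congr 1
    refine congrArg List.ofFn (funext fun l => ?_)
    simp only [Function.comp, unitVecs, List.map_ofFn, kronMap_apply, sum_perp_smul hb]
    rfl
  rw [penInv, h1, h0, foldl_upd_inv (hG.inv.smul hβ) (by positivity), penal,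
    sum_map_vecMulVec_flatMap (fun l α => kronMap n b (perp a l) α), one_div, inv_inv]

theorem sum_map_unitVecs (u : Fin m → ℝ) :
    (((unitVecs n).map (kron u)).map fun y => vecMulVec y y).sum =
      gram fun α : Fin n => kron u (Pi.single α 1) := by
  simp only [unitVecs, List.map_ofFn, List.sum_ofFn, gram]
  rfl

theorem childEff_eq (hb : ∀ i j, b i ⬝ᵥ b j = if i = j then 1 else 0) (hβ : 0 < β)
    (hG : G.PosDef) (a : Fin s → ℝ) : childEff β (List.ofFn b) G (∑ l, a l • b l) =
      ∑ α, qf (penal β β G (kronMap n b) a + gram (kronMap n b a))⁻¹ (kronMap n b a α) := by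
  rw [childEff, penInv_eq hb hβ hG, foldl_upd_inv (penal_posDef hβ.le hβ hG _ _) one_pos,
    sum_map_unitVecs, inv_one, one_smul]
  simp only [unitVecs, List.map_ofFn, List.sum_ofFn]
  rfl

theorem child_eq (hb : ∀ i j, b i ⬝ᵥ b j = if i = j then 1 else 0) (hβ : 0 < β)
    (hG : G.PosDef) (a : Fin s → ℝ) : child β (List.ofFn b) G (∑ l, a l • b l) =
      image (kronMap n b a) (penal β β G (kronMap n b) a)⁻¹ := by
  rw [child, penInv_eq hb hβ hG]
  rfl

theorem vecMul_kron_injective {u : Fin m → ℝ} (hu : u ≠ 0) :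
    Function.Injective (of fun α : Fin n => kron u (Pi.single α 1)).vecMul := by
  obtain ⟨i, hi⟩ := Function.ne_iff.1 hu
  have h : ∀ (c : Fin n → ℝ) α, (c ᵥ* of fun α : Fin n => kron u (Pi.single α 1))
      (finProdFinEquiv (i, α)) = c α * u i := by
    intro c α
    simp only [vecMul, dotProduct, of_apply, kron_apply]
    rw [Finset.sum_eq_single α]
    · simp
    · intro j _ hj
      simp [hj.symm]
    · simp
  intro c c' hcc
  ext α
  have h1 := congrFun hcc (finProdFinEquiv (i, α))
  dsimp only at h1
  rw [h, h] at h1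
  exact mul_right_cancel₀ hi h1

/-- Contraction with the (approximate) direction `a` of the component of `x` in the span of `b`
turns a covariance matrix that captures `x ⊗ y` into one that captures `y`. -/
theorem qf_child_le (hb : ∀ i j, b i ⬝ᵥ b j = if i = j then 1 else 0) (hβ : 0 < β)
    (hG : G.PosDef) {a : Fin s → ℝ} (ha : a ⬝ᵥ a = 1) {x : Fin m → ℝ} {y : Fin n → ℝ}
    (hy : y ⬝ᵥ y ≤ 1) {ω τ ρ t : ℝ} (hω : qf G⁻¹ (kron x y) ≤ ω) (hτ : 2 * τ ≤ ρ) (hρ : 0 < ρ)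
    (hτ0 : 0 ≤ τ) (hx : ρ ≤ len fun l => b l ⬝ᵥ x)
    (hax : len (t • a - fun l => b l ⬝ᵥ x) ≤ τ) :
    (child β (List.ofFn b) G (∑ l, a l • b l)).PosDef ∧
    qf (child β (List.ofFn b) G (∑ l, a l • b l))⁻¹ y ≤ 4 * β / ρ ^ 2 * (ω + τ ^ 2) := by
  set u := ∑ l, a l • b l with hu
  set ξ : Fin s → ℝ := fun l => b l ⬝ᵥ x with hξ
  have huu : u ⬝ᵥ u = 1 := by rw [hu, sum_smul_dot_sum_smul hb, ha]
  have hu0 : u ≠ 0 := by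
    rintro h
    rw [h] at huu
    simp at huu
  have hux : u ⬝ᵥ x = a ⬝ᵥ ξ := by
    rw [hu, sum_smul_dot]
  have hQ := penal_posDef hβ.le hβ hG (kronMap n b) a
  have hpd : (child β (List.ofFn b) G u).PosDef := by
    rw [hu, child_eq hb hβ hG]
    exact image_posDef hQ.inv (vecMul_kron_injective hu0)
  refine ⟨hpd, ?_⟩
  -- the distance of `ξ` to the line spanned by `a`
  set φ : (Fin s → ℝ) →ₗ[ℝ] ℝ :=
    { toFun := fun c => c ⬝ᵥ ξ
      map_add' := fun c c' => add_dotProduct _ _ _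
      map_smul' := fun c c' => smul_dotProduct _ _ _ } with hφ
  have hφa : ∀ c, φ c = c ⬝ᵥ ξ := fun c => rfl
  have hperp := sum_sq_perp φ a ha
  have hξξ : ∑ l, φ (Pi.single l 1) ^ 2 = len ξ ^ 2 := by
    rw [len_sq]
    simp only [hφa, single_one_dotProduct]
    simp only [dotProduct, sq]
  have hdist : len ξ ^ 2 - (a ⬝ᵥ ξ) ^ 2 ≤ τ ^ 2 := by
    have h1 : len (t • a - ξ) ^ 2 ≤ τ ^ 2 := pow_le_pow_left₀ (len_nonneg _) hax 2
    refine le_trans ?_ h1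
    rw [len_sq, len_sq, dotProduct_sub, sub_dotProduct, sub_dotProduct, smul_dotProduct,
      smul_dotProduct, dotProduct_smul, dotProduct_smul, ha, dotProduct_comm ξ a]
    simp only [smul_eq_mul]
    nlinarith [sq_nonneg (t - a ⬝ᵥ ξ)]
  have hρ2 : ρ ^ 2 ≤ len ξ ^ 2 := pow_le_pow_left₀ hρ.le hx 2
  have haξ : ρ ^ 2 / 4 ≤ (a ⬝ᵥ ξ) ^ 2 := by nlinarith
  have haξ0 : (a ⬝ᵥ ξ) ≠ 0 := by
    intro h
    rw [h] at haξ
    nlinarith [sq_pos_of_pos hρ]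
  -- the tensor `x ⊗ y / ⟪u, x⟫` is mapped to `y`
  set z : Fin (m * n) → ℝ := (a ⬝ᵥ ξ)⁻¹ • kron x y with hz
  have hyz : y = fun α => kronMap n b a α ⬝ᵥ z := by
    ext α
    rw [kronMap_apply, ← hu, hz, dotProduct_smul, kron_dot, hux, single_one_dotProduct, smul_eq_mul,
      inv_mul_cancel_left₀ haξ0]
  have hle : qf (child β (List.ofFn b) G u)⁻¹ y ≤ qf (penal β β G (kronMap n b) a) z := by
    rw [hu, child_eq hb hβ hG]
    rw [hu, child_eq hb hβ hG] at hpd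
    conv_lhs => rw [hyz]
    exact qf_image_inv_le hQ hpd z
  have hval : qf (penal β β G (kronMap n b) a) z =
      ((a ⬝ᵥ ξ) ^ 2)⁻¹ * (β * qf G⁻¹ (kron x y) +
        β * ((len ξ ^ 2 - (a ⬝ᵥ ξ) ^ 2) * (y ⬝ᵥ y))) := by
    rw [hz, qf_smul_vec, penal, qf_add, qf_smul, qf_smul, qf_gram, Fintype.sum_prod_type, inv_pow]
    congr 3
    rw [← hξξ, ← hperp, hφa a, add_sub_cancel_right, Finset.sum_mul]
    refine Finset.sum_congr rfl fun l _ => ?_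
    rw [dotProduct, Finset.mul_sum]
    refine Finset.sum_congr rfl fun α _ => ?_
    rw [kronMap_apply, kron_dot, single_one_dotProduct, sum_dotProduct, hφa]
    simp only [smul_dotProduct, smul_eq_mul]
    rw [mul_pow, ← sq, dotProduct]
  have hq0 : 0 ≤ len ξ ^ 2 - (a ⬝ᵥ ξ) ^ 2 := by
    rw [← hξξ, ← hperp, hφa a, add_sub_cancel_right]
    exact Finset.sum_nonneg fun _ _ => sq_nonneg _
  have h1 : (len ξ ^ 2 - (a ⬝ᵥ ξ) ^ 2) * (y ⬝ᵥ y) ≤ τ ^ 2 := by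
    nlinarith [mul_le_mul hdist hy (dot_sq_nonneg y) (sq_nonneg τ)]
  have h2 : β * qf G⁻¹ (kron x y) + β * ((len ξ ^ 2 - (a ⬝ᵥ ξ) ^ 2) * (y ⬝ᵥ y)) ≤
      β * (ω + τ ^ 2) := by nlinarith
  have hω0 : 0 ≤ ω := (qf_nonneg hG.inv.posSemidef _).trans hω
  calc qf (child β (List.ofFn b) G u)⁻¹ y ≤ _ := hle
    _ = _ := hval
    _ ≤ ((a ⬝ᵥ ξ) ^ 2)⁻¹ * (β * (ω + τ ^ 2)) :=
        mul_le_mul_of_nonneg_left h2 (by positivity)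
    _ ≤ (ρ ^ 2 / 4)⁻¹ * (β * (ω + τ ^ 2)) := by
        refine mul_le_mul_of_nonneg_right (inv_anti₀ (by positivity) haξ) (by positivity)
    _ = 4 * β / ρ ^ 2 * (ω + τ ^ 2) := by field_simp

theorem eff_child (hb : ∀ i j, b i ⬝ᵥ b j = if i = j then 1 else 0) (hβ : 0 < β)
    (hG : G.PosDef) (a : Fin s → ℝ) :
    eff (child β (List.ofFn b) G (∑ l, a l • b l)) =
      childEff β (List.ofFn b) G (∑ l, a l • b l) := by
  rw [child_eq hb hβ hG, childEff_eq hb hβ hG, eff_image (penal_posDef hβ.le hβ hG _ _)]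

end Contraction

/-! ### One state of the search -/

section State

variable {m n : ℕ}

/-- The parameters of the search: the dimension `s` of the subspaces in which directions are tried,
the weight `β`, a grid for coefficients and the tolerance `tol` for near orthogonality. -/
structure Params where
  /-- the number of vectors whose combinations are tried as directions -/
  s : ℕ
  /-- the weight of the penalty -/
  β : ℝ
  /-- the coefficients of the combinations -/
  grid : List ℝ
  /-- the tolerance for near orthogonality -/
  tol : ℝ

/-- The directions that are tried. -/
noncomputable def dirs (p : Params) (B : List (Fin m → ℝ)) : List (Fin m → ℝ) :=
  (comb p.grid (B.take p.s)).map normalize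

/-- `v` is not zero and nearly orthogonal to all directions in `us` whose effective dimension
exceeds `κ`. -/
def Separates (κ tol : ℝ) (us : List ((Fin m → ℝ) × ℝ)) (v : Fin m → ℝ) : Prop :=
  ¬ v ⬝ᵥ v ≤ 0 ∧ ∀ u ∈ us, u.2 ≤ κ ∨ |v ⬝ᵥ u.1| ≤ tol

open Classical in
/-- A separating direction among the given ones, if there is one. -/
noncomputable def pick (κ tol : ℝ) (us : List ((Fin m → ℝ) × ℝ)) : Fin m → ℝ :=
  us.foldl (fun acc u => if Separates κ tol us u.1 then u.1 else acc) 0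

theorem pick_spec {κ tol : ℝ} {us : List ((Fin m → ℝ) × ℝ)}
    (h : ∃ u ∈ us, Separates κ tol us u.1) :
    Separates κ tol us (pick κ tol us) ∧ ∃ u ∈ us, pick κ tol us = u.1 := by
  classical
  have key : ∀ (l : List ((Fin m → ℝ) × ℝ)) (acc : Fin m → ℝ),
      ((∃ u ∈ l, Separates κ tol us u.1) ∨ Separates κ tol us acc ∧ ∃ u ∈ us, acc = u.1) →
      (∀ u ∈ l, u ∈ us) →
      Separates κ tol us (l.foldl (fun acc u => if Separates κ tol us u.1 then u.1 else acc) acc) ∧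
      ∃ u ∈ us, l.foldl (fun acc u => if Separates κ tol us u.1 then u.1 else acc) acc = u.1 := by
    intro l
    induction l with
    | nil =>
      rintro acc (⟨u, hu, -⟩ | h) -
      · simp at hu
      · exact h
    | cons c l ih =>
      intro acc h hl
      rw [List.foldl_cons]
      refine ih _ ?_ fun u hu => hl u (List.mem_cons_of_mem _ hu)
      by_cases hc : Separates κ tol us c.1
      · rw [if_pos hc]
        exact Or.inr ⟨hc, c, hl c List.mem_cons_self, rfl⟩
      · rw [if_neg hc]
        rcases h with ⟨u, hu, hs⟩ | h
        · rcases List.mem_cons.1 hu with rfl | hu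
          · exact absurd hs hc
          · exact Or.inl ⟨u, hu, hs⟩
        · exact Or.inr h
  exact key us 0 (Or.inl h) fun u hu => hu

/-- The directions tried, with their effective dimensions. -/
noncomputable def scores (p : Params) (G : Matrix (Fin (m * n)) (Fin (m * n)) ℝ)
    (B : List (Fin m → ℝ)) : List ((Fin m → ℝ) × ℝ) :=
  (dirs p B).map fun u => (u, childEff p.β (B.take p.s) G u)

/-- One round: all directions give a child, and the directions of too large effective dimension are
made harmless by passing to a hyperplane. -/
noncomputable def round (p : Params) (κ : ℝ) (G : Matrix (Fin (m * n)) (Fin (m * n)) ℝ)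
    (X : List (Fin m → ℝ) × List (Matrix (Fin n) (Fin n) ℝ)) :
    List (Fin m → ℝ) × List (Matrix (Fin n) (Fin n) ℝ) :=
  (cut X.1 (pick κ p.tol (scores p G X.1)),
    (dirs p X.1).map (child p.β (X.1.take p.s) G) ++ X.2)

/-- The rounds for a state, until the subspace has dimension less than `s`. -/
noncomputable def rounds (p : Params) (κ : ℝ) (G : Matrix (Fin (m * n)) (Fin (m * n)) ℝ) :
    List (Fin m → ℝ) × List (Matrix (Fin n) (Fin n) ℝ) :=
  (round p κ G)^[m + 1 - p.s] (unitVecs m, [])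

/-- The covariance matrix `G` captures the tensor `y`: the effective dimension of `G` is at most
`κ`, and `y` is of the size expected of a vector with covariance `G`, up to the factor `ω`. -/
def Captures {N : ℕ} (G : Matrix (Fin N) (Fin N) ℝ) (κ ω : ℝ) (y : Fin N → ℝ) : Prop :=
  G.PosDef ∧ eff G ≤ κ ∧ qf G⁻¹ y ≤ ω

theorem ON.exists_fin {B : List (Fin m → ℝ)} (h : ON B) {s : ℕ} (hs : s ≤ B.length) :
    ∃ b : Fin s → Fin m → ℝ, List.ofFn b = B.take s ∧ (∀ i, b i ∈ B) ∧
      ∀ i j, b i ⬝ᵥ b j = if i = j then 1 else 0 := by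
  refine ⟨fun i => B.get ⟨i, i.2.trans_le hs⟩, ?_, fun i => List.get_mem _ _, fun i j => ?_⟩
  · refine List.ext_get (by simp [hs]) fun k h1 h2 => by simp
  · have hp := List.pairwise_iff_get.1 h.1
    rcases lt_trichotomy i j with hij | rfl | hij
    · rw [if_neg hij.ne]
      exact hp _ _ hij
    · rw [if_pos rfl]
      exact h.2 _ (List.get_mem _ _)
    · rw [if_neg hij.ne', dotProduct_comm]
      exact hp _ _ hij

/-- The numerical conditions on the parameters: `τ` is the fineness of the net of directions, `ρ`
the length below which a component is neglected, `err` the loss in one round. -/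
structure Params.Valid (p : Params) (D τ ρ err : ℝ) : Prop where
  s_pos : 0 < p.s
  one_le_D : 1 ≤ D
  β_ge : (2 * p.s + 2) * D ^ 2 ≤ p.β
  tol_eq : p.tol = 2 / D
  grid : ∃ h, IsGrid p.grid h ∧ p.s * h ≤ τ
  τ_nonneg : 0 ≤ τ
  τ_le : 2 * τ ≤ 1 / D
  ρ_pos : 0 < ρ
  τ_le_ρ : 2 * τ ≤ ρ
  ρ_le : ρ ≤ err
  tol_le : 2 * p.tol + τ ≤ err

/-- In each round, either a child captures `y`, or `x` is nearly orthogonal to the chosen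
direction. -/
theorem round_spec {p : Params} {D τ ρ err : ℝ} (hp : p.Valid D τ ρ err) {κ κ₀ ω : ℝ}
    (hκ : 5 * κ ≤ p.s * κ₀) (hκ0 : 0 ≤ κ₀) {G : Matrix (Fin (m * n)) (Fin (m * n)) ℝ}
    {x : Fin m → ℝ} {y : Fin n → ℝ} (hx : len x ≤ 1) (hy : y ⬝ᵥ y ≤ 1)
    (hG : Captures G κ ω (kron x y)) {B : List (Fin m → ℝ)} (hB : ON B) (hs : p.s ≤ B.length) :
    (∃ G' ∈ (dirs p B).map (child p.β (B.take p.s) G),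
      Captures G' κ₀ (4 * p.β / ρ ^ 2 * (ω + τ ^ 2)) y) ∨
    ∃ v, v = pick κ₀ p.tol (scores p G B) ∧ v ⬝ᵥ v = 1 ∧ proj B v = v ∧ |v ⬝ᵥ x| ≤ err := by
  obtain ⟨hpd, heff, hqf⟩ := hG
  obtain ⟨h, hgrid, hh⟩ := hp.grid
  have hD0 : 0 < D := one_pos.trans_le hp.one_le_D
  have hβ : 0 < p.β := lt_of_lt_of_le (by positivity) hp.β_ge
  obtain ⟨b, hbB, hbm, hb⟩ := hB.exists_fin hs
  set ξ : Fin p.s → ℝ := fun l => b l ⬝ᵥ x with hξ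
  have hlen : ∀ c : Fin p.s → ℝ, len (∑ l, c l • b l) = len c := len_sum_smul hb
  have hdot : ∀ c : Fin p.s → ℝ, (∑ l, c l • b l) ⬝ᵥ x = c ⬝ᵥ ξ := fun c => sum_smul_dot b c x
  have hξ1 : len ξ ≤ 1 := len_coord_le hb hx
  have hnorm : ∀ c : Fin p.s → ℝ, normalize (∑ l, c l • b l) = ∑ l, normalize c l • b l := by
    intro c
    rw [normalize, hlen, normalize, Finset.smul_sum]
    simp [smul_smul]
  have hdirs : ∀ u, u ∈ dirs p B ↔
      ∃ c : Fin p.s → ℝ, (∀ i, c i ∈ p.grid) ∧ u = ∑ l, normalize c l • b l := by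
    intro u
    rw [dirs, ← hbB, List.mem_map]
    constructor
    · rintro ⟨q, hq, rfl⟩
      obtain ⟨c, hc, rfl⟩ := mem_comb.1 hq
      exact ⟨c, hc, hnorm c⟩
    · rintro ⟨c, hc, rfl⟩
      exact ⟨_, mem_comb.2 ⟨c, hc, rfl⟩, hnorm c⟩
  have hn0 : ∀ c : Fin p.s → ℝ, len c ≠ 0 → normalize c ⬝ᵥ normalize c = 1 := fun c hc =>
    normalize_dot_self fun h0 => hc (by rw [h0, len_zero])
  -- a separating direction exists
  have hexists : ∃ u ∈ scores p G B, Separates κ₀ p.tol (scores p G B) u.1 := by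
    set T : Set (Fin p.s → ℝ) := {a | ∃ c : Fin p.s → ℝ, (∀ i, c i ∈ p.grid) ∧ a = normalize c ∧
      κ₀ < childEff p.β (B.take p.s) G (∑ l, a l • b l)} with hT
    have hTfin : T.Finite := by
      have h1 : {c : Fin p.s → ℝ | ∀ i, c i ∈ p.grid}.Finite := by
        have h2 := Set.Finite.pi' fun _ : Fin p.s => p.grid.finite_toSet
        simpa using h2
      refine (h1.image normalize).subset ?_
      rintro a ⟨c, hc, rfl, -⟩
      exact ⟨c, hc, rfl⟩
    have hT1 : ∀ a ∈ T, a ⬝ᵥ a = 1 := by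
      rintro a ⟨c, hc, rfl, hlt⟩
      refine normalize_dot_self ?_
      rintro rfl
      have h1 : normalize (0 : Fin p.s → ℝ) = 0 := by simp [normalize]
      have h2 : ∀ f : Fin n → ℝ, kron (0 : Fin m → ℝ) f = 0 := fun f => by ext t; simp [kron]
      rw [h1] at hlt
      have h3 : childEff p.β (B.take p.s) G (∑ l, (0 : Fin p.s → ℝ) l • b l) = 0 := by
        simp [childEff, h2, qf, Function.comp_def]
      linarith
    have hTκ : ∀ a ∈ T, κ₀ < ∑ α, qf (penal p.β p.β G (kronMap n b) a + gram (kronMap n b a))⁻¹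
        (kronMap n b a α) := by
      rintro a ⟨c, hc, h1, hlt⟩
      rwa [← childEff_eq hb hβ hpd, hbB]
    have hL : ∀ z, ∑ α : Fin n, ∑ l, (kronMap n b (Pi.single l 1) α ⬝ᵥ z) ^ 2 ≤ z ⬝ᵥ z := by
      intro z
      have h1 : ∀ l, ∑ i, (Pi.single l 1 : Fin p.s → ℝ) i • b i = b l := fun l => by
        simp [Pi.single_apply]
      simp only [kronMap_apply, h1]
      exact sum_sq_kron_le hb z
    obtain ⟨v, hv1, hvT⟩ := exists_perp_of_eff hp.s_pos hpd hL hp.one_le_D hp.β_ge le_rfl hTfin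
      hT1 (by linarith) hTκ
    obtain ⟨c, hc, hcv⟩ := hgrid.exists_close hh v (len_eq_one hv1).le
    have hcl : |len c - 1| ≤ τ := by
      rw [abs_le]
      have h1 := len_add_le (c - v) v
      have h2 := len_add_le (v - c) c
      have h3 : len (v - c) = len (c - v) := by
        rw [← neg_sub, ← neg_one_smul ℝ, len_smul]
        simp
      rw [sub_add_cancel, len_eq_one hv1] at h1 h2
      constructor <;> linarith
    have hτ2 : 2 * τ ≤ 1 := hp.τ_le.trans ((div_le_one hD0).2 hp.one_le_D)
    have hc0 : 0 < len c := by
      rw [abs_le] at hcl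
      linarith
    have hcv2 : len (normalize c - v) ≤ 2 * τ := by
      have h1 : normalize c - v = (1 - len c) • normalize c + (c - v) := by
        rw [sub_smul, one_smul, len_smul_normalize]
        abel
      rw [h1]
      refine (len_add_le _ _).trans ?_
      rw [len_smul, len_eq_one (hn0 c hc0.ne'), abs_sub_comm]
      linarith
    refine ⟨(∑ l, normalize c l • b l, _), List.mem_map.2 ⟨_, (hdirs _).2 ⟨c, hc, rfl⟩, rfl⟩,
      ?_, ?_⟩
    · rw [sum_smul_dot_sum_smul hb, hn0 c hc0.ne']
      norm_num
    · rintro u hu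
      obtain ⟨u, hu', rfl⟩ := List.mem_map.1 hu
      obtain ⟨c', hc', rfl⟩ := (hdirs _).1 hu'
      by_cases hle : childEff p.β (B.take p.s) G (∑ l, normalize c' l • b l) ≤ κ₀
      · exact Or.inl hle
      · right
        have hmem : normalize c' ∈ T := ⟨c', hc', rfl, not_le.1 hle⟩
        simp only [sum_smul_dot_sum_smul hb]
        have h1 : normalize c ⬝ᵥ normalize c' =
            v ⬝ᵥ normalize c' + (normalize c - v) ⬝ᵥ normalize c' := by
          rw [sub_dotProduct]
          ring
        have h2 := hvT _ hmem
        have h3 := abs_dot_le (normalize c - v) (normalize c')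
        rw [len_eq_one (hT1 _ hmem), mul_one] at h3
        rw [h1, hp.tol_eq]
        have h4 : 2 / D = 1 / D + 1 / D := by ring
        linarith [abs_add_le (v ⬝ᵥ normalize c') ((normalize c - v) ⬝ᵥ normalize c'), hp.τ_le]
  obtain ⟨hsep, u, hu, hpu⟩ := pick_spec hexists
  set v := pick κ₀ p.tol (scores p G B) with hv
  obtain ⟨u', hu', rfl⟩ := List.mem_map.1 hu
  dsimp only at hpu
  obtain ⟨cv, hcv, hcv'⟩ := (hdirs _).1 hu'
  have hvc : v = ∑ l, normalize cv l • b l := hpu.trans hcv'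
  have hvv : v ⬝ᵥ v = 1 := by
    rw [hvc, sum_smul_dot_sum_smul hb]
    refine hn0 cv fun h0 => hsep.1 ?_
    rw [hvc, sum_smul_dot_sum_smul hb, normalize, h0]
    simp
  have hvB : proj B v = v := by
    rw [hvc]
    exact hB.proj_sum hbm _
  have hvl : len (normalize cv) = 1 := by
    refine len_eq_one ?_
    rw [← sum_smul_dot_sum_smul hb, ← hvc, hvv]
  have hvx : v ⬝ᵥ x = normalize cv ⬝ᵥ ξ := by rw [hvc, hdot]
  by_cases hρ : len ξ ≤ ρ
  · refine Or.inr ⟨v, rfl, hvv, hvB, ?_⟩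
    rw [hvx]
    refine (abs_dot_le _ _).trans ?_
    rw [hvl, one_mul]
    exact hρ.trans hp.ρ_le
  · push Not at hρ
    obtain ⟨c, hc, hcξ⟩ := hgrid.exists_close hh ξ hξ1
    have hc0 : 0 < len c := by
      have h1 := len_add_le (ξ - c) c
      have h3 : len (ξ - c) = len (c - ξ) := by
        rw [← neg_sub, ← neg_one_smul ℝ, len_smul]
        simp
      rw [sub_add_cancel, h3] at h1
      linarith [hp.τ_le_ρ, hp.τ_nonneg, hp.ρ_pos]
    have hmem : ∑ l, normalize c l • b l ∈ dirs p B := (hdirs _).2 ⟨c, hc, rfl⟩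
    by_cases hgood : childEff p.β (B.take p.s) G (∑ l, normalize c l • b l) ≤ κ₀
    · left
      refine ⟨_, List.mem_map.2 ⟨_, hmem, rfl⟩, ?_⟩
      rw [← hbB]
      rw [← hbB] at hgood
      have h1 := qf_child_le (t := len c) hb hβ hpd (hn0 c hc0.ne') hy hqf hp.τ_le_ρ hp.ρ_pos
        hp.τ_nonneg hρ.le (by rw [len_smul_normalize]; exact hcξ)
      refine ⟨h1.1, ?_, h1.2⟩
      rw [eff_child hb hβ hpd]
      exact hgood
    · refine Or.inr ⟨v, rfl, hvv, hvB, ?_⟩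
      rcases hsep.2 _ (List.mem_map.2 ⟨_, hmem, rfl⟩) with h1 | h1
      · exact absurd h1 hgood
      · dsimp only at h1
        have hcl : len c ≤ 2 := by
          have h2 := len_add_le (c - ξ) ξ
          have h3 : 1 / D ≤ 1 := (div_le_one hD0).2 hp.one_le_D
          rw [sub_add_cancel] at h2
          linarith [hp.τ_le, hp.τ_nonneg]
        have h2 : v ⬝ᵥ (∑ l, normalize c l • b l) = normalize cv ⬝ᵥ normalize c := by
          rw [hvc, sum_smul_dot_sum_smul hb]
        have h3 : normalize cv ⬝ᵥ ξ =
            len c * (normalize cv ⬝ᵥ normalize c) - normalize cv ⬝ᵥ (c - ξ) := by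
          conv_rhs => rw [dotProduct_sub]
          conv_rhs => rw [← smul_eq_mul, ← dotProduct_smul, len_smul_normalize]
          ring
        have h4 := abs_dot_le (normalize cv) (c - ξ)
        rw [hvl, one_mul] at h4
        rw [h2] at h1
        have h5 : |len c * (normalize cv ⬝ᵥ normalize c)| ≤ 2 * p.tol := by
          rw [abs_mul, abs_of_pos hc0]
          exact mul_le_mul hcl h1 (abs_nonneg _) (by norm_num)
        rw [hvx, h3]
        linarith [abs_sub (len c * (normalize cv ⬝ᵥ normalize c)) (normalize cv ⬝ᵥ (c - ξ)),
          hp.tol_le]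

theorem unitVecs_ON (m : ℕ) : ON (unitVecs m) := by
  refine ⟨?_, ?_⟩
  · rw [unitVecs, List.pairwise_ofFn]
    intro i j hij
    simp [hij.ne]
  · intro b hb
    obtain ⟨i, rfl⟩ := (List.mem_ofFn' _ _).1 hb
    simp

theorem proj_unitVecs (x : Fin m → ℝ) : proj (unitVecs m) x = x := by
  rw [proj, unitVecs, List.map_ofFn, List.sum_ofFn]
  ext j
  simp [Finset.sum_apply, Pi.single_apply]

theorem length_round_iterate (p : Params) (κ : ℝ) (G : Matrix (Fin (m * n)) (Fin (m * n)) ℝ)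
    (k : ℕ) : ((round p κ G)^[k] (unitVecs m, [])).1.length = m - k := by
  induction k with
  | zero => simp [unitVecs]
  | succ k ih =>
    rw [Function.iterate_succ_apply', round, length_cut, ih]
    omega

/-- A state that captures `x ⊗ y` has a child that captures `y`, or the final subspace has a net
point close to `x`. -/
theorem rounds_spec {p : Params} {D τ ρ err : ℝ} (hp : p.Valid D τ ρ err) {κ κ₀ ω : ℝ}
    (hκ : 5 * κ ≤ p.s * κ₀) (hκ0 : 0 ≤ κ₀) {G : Matrix (Fin (m * n)) (Fin (m * n)) ℝ}
    {x : Fin m → ℝ} {y : Fin n → ℝ} (hx : len x ≤ 1) (hy : y ⬝ᵥ y ≤ 1)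
    (hG : Captures G κ ω (kron x y)) :
    (∃ G' ∈ (rounds p κ₀ G).2, Captures G' κ₀ (4 * p.β / ρ ^ 2 * (ω + τ ^ 2)) y) ∨
    ∃ q ∈ comb p.grid (rounds p κ₀ G).1, len (q - x) ≤ m * err + τ := by
  obtain ⟨h, hgrid, hh⟩ := hp.grid
  have hh0 : 0 ≤ h := by
    obtain ⟨g, -, hg⟩ := hgrid 0 (by simp)
    exact (abs_nonneg _).trans hg
  have herr : 0 ≤ err := hp.ρ_pos.le.trans hp.ρ_le
  have hind : ∀ k, k ≤ m + 1 - p.s →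
      (∃ G' ∈ ((round p κ₀ G)^[k] (unitVecs m, [])).2,
        Captures G' κ₀ (4 * p.β / ρ ^ 2 * (ω + τ ^ 2)) y) ∨
      ON ((round p κ₀ G)^[k] (unitVecs m, [])).1 ∧
        len (proj ((round p κ₀ G)^[k] (unitVecs m, [])).1 x - x) ≤ k * err := by
    intro k
    induction k with
    | zero =>
      intro _
      refine Or.inr ⟨unitVecs_ON m, ?_⟩
      simp [proj_unitVecs, len_zero]
    | succ k ih =>
      intro hk
      rw [Function.iterate_succ_apply']
      have hlen := length_round_iterate p κ₀ G k
      set X := (round p κ₀ G)^[k] (unitVecs m, []) with hX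
      rcases ih (by omega) with ⟨G', hG', hc⟩ | ⟨hON, hdist⟩
      · exact Or.inl ⟨G', List.mem_append_right _ hG', hc⟩
      · rcases round_spec hp hκ hκ0 hx hy hG hON (by omega) with ⟨G', hG', hc⟩ | ⟨v, hv, hvv, hvB, hvx⟩
        · exact Or.inl ⟨G', List.mem_append_left _ hG', hc⟩
        · refine Or.inr ⟨hON.cut _, ?_⟩
          have hne : X.1 ≠ [] := by
            intro h0
            rw [h0, List.length_nil] at hlen
            have := hp.s_pos
            omega
          have h1 := hON.proj_cut hne hvv hvB x
          have h2 : proj (round p κ₀ G X).1 x - x = (proj X.1 x - x) + (-(v ⬝ᵥ x)) • v := by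
            rw [h1, round, ← hv]
            module
          rw [h2]
          refine (len_add_le _ _).trans ?_
          rw [len_smul, len_eq_one hvv, abs_neg]
          push_cast
          linarith
  have hlen := length_round_iterate p κ₀ G (m + 1 - p.s)
  rcases hind _ le_rfl with h1 | ⟨hON, hdist⟩
  · exact Or.inl h1
  · right
    rw [← rounds] at hON hdist hlen
    generalize (rounds p κ₀ G).1 = B at hON hdist hlen ⊢
    obtain ⟨b, hbB, hbm, hb⟩ := hON.exists_fin le_rfl
    rw [List.take_length] at hbB
    have hBs : (B.length : ℝ) * h ≤ τ := by
      refine le_trans (mul_le_mul_of_nonneg_right ?_ hh0) hh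
      have := hp.s_pos
      exact_mod_cast (by omega : B.length ≤ p.s)
    set ξ : Fin B.length → ℝ := fun l => b l ⬝ᵥ x with hξ
    have hproj : proj B x = ∑ l, ξ l • b l := by
      have h1 : proj (List.ofFn b) x = ∑ l, ξ l • b l := by
        rw [proj, List.map_ofFn, List.sum_ofFn]
        rfl
      rwa [hbB] at h1
    have hξ1 : len ξ ≤ 1 := len_coord_le hb hx
    obtain ⟨c, hc, hcξ⟩ := hgrid.exists_close hBs ξ hξ1
    refine ⟨∑ l, c l • b l, ?_, ?_⟩
    · have h1 := (mem_comb (grid := p.grid) (b := b)).2 ⟨c, hc, rfl⟩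
      rwa [hbB] at h1
    · have h1 : ∑ l, c l • b l - x = ∑ l, (c - ξ) l • b l + (proj B x - x) := by
        rw [hproj]
        simp only [Pi.sub_apply, sub_smul, Finset.sum_sub_distrib]
        abel
      rw [h1]
      refine (len_add_le _ _).trans ?_
      rw [len_sum_smul hb]
      have h4 : ((m + 1 - p.s : ℕ) : ℝ) * err ≤ m * err := by
        refine mul_le_mul_of_nonneg_right ?_ herr
        have := hp.s_pos
        exact_mod_cast (by omega : m + 1 - p.s ≤ m)
      linarith

end State

/-! ### Tensors -/

section Tensors

variable {m : ℕ}

/-- The dimension of the space of tensors of order `j` over `ℝᵐ`. -/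
abbrev tdim (m : ℕ) : ℕ → ℕ
  | 0 => 1
  | j + 1 => m * tdim m j

theorem tdim_eq (m j : ℕ) : tdim m j = m ^ j := by
  induction j with
  | zero => rfl
  | succ j ih => rw [tdim, ih, pow_succ']

/-- The tensor power of a vector. -/
def tpow (x : Fin m → ℝ) : (j : ℕ) → Fin (tdim m j) → ℝ
  | 0 => fun _ => 1
  | j + 1 => kron x (tpow x j)

theorem tpow_dot_self (x : Fin m → ℝ) (j : ℕ) : tpow x j ⬝ᵥ tpow x j = (x ⬝ᵥ x) ^ j := by
  induction j with
  | zero =>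
    show ∑ i : Fin 1, (1 : ℝ) * 1 = _
    simp
  | succ j ih => rw [tpow, kron_dot, ih, pow_succ']

/-- The exponent vector of the monomial that belongs to an entry of a tensor. -/
def cnt (m : ℕ) : (j : ℕ) → Fin (tdim m j) → Fin m → ℝ
  | 0 => fun _ => 0
  | j + 1 => fun t => (Pi.single (Fin.divNat t : Fin m) 1 : Fin m → ℝ) + cnt m j (Fin.modNat t)

/-- Index tuples as indices of entries of tensors. -/
def tupleEquiv (m : ℕ) : (j : ℕ) → (Fin j → Fin m) ≃ Fin (tdim m j)
  | 0 => Equiv.ofUnique (Fin 0 → Fin m) (Fin 1)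
  | j + 1 => (Fin.consEquiv fun _ => Fin m).symm.trans
      (((Equiv.refl _).prodCongr (tupleEquiv m j)).trans finProdFinEquiv)

theorem tupleEquiv_succ (j : ℕ) (α : Fin (j + 1) → Fin m) :
    tupleEquiv m (j + 1) α = finProdFinEquiv (α 0, tupleEquiv m j fun i => α i.succ) := rfl

theorem tpow_tupleEquiv (x : Fin m → ℝ) (j : ℕ) (α : Fin j → Fin m) :
    tpow x j (tupleEquiv m j α) = ∏ i, x (α i) := by
  induction j with
  | zero => rfl
  | succ j ih => rw [tupleEquiv_succ, tpow, kron_apply, ih, Fin.prod_univ_succ]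

theorem cnt_tupleEquiv (j : ℕ) (α : Fin j → Fin m) (i : Fin m) :
    cnt m j (tupleEquiv m j α) i = (indexCount α i : ℝ) := by
  induction j with
  | zero => simp [cnt, indexCount]
  | succ j ih =>
    have h := finProdFinEquiv.symm_apply_apply (α 0, tupleEquiv m j fun i => α i.succ)
    have h1 := congrArg Prod.fst h
    have h2 := congrArg Prod.snd h
    have h3 : indexCount α = Finsupp.single (α 0) 1 + indexCount fun i => α i.succ := by
      rw [indexCount, Fin.sum_univ_succ, indexCount]
    rw [tupleEquiv_succ, h3, Finsupp.add_apply, Nat.cast_add, ← ih]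
    change (Pi.single (finProdFinEquiv.symm _).1 1 : Fin m → ℝ) i +
      cnt m j (finProdFinEquiv.symm _).2 i = _
    congr 1
    · rw [h1, Pi.single_apply, Finsupp.single_apply]
      simp only [eq_comm (a := i)]
      split_ifs <;> simp
    · rw [h2]

theorem cnt_eq_iff {j : ℕ} (α α' : Fin j → Fin m) :
    cnt m j (tupleEquiv m j α) = cnt m j (tupleEquiv m j α') ↔ indexCount α = indexCount α' := by
  constructor
  · intro h
    ext i
    have := congrFun h i
    rw [cnt_tupleEquiv, cnt_tupleEquiv] at this
    exact_mod_cast this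
  · intro h
    ext i
    rw [cnt_tupleEquiv, cnt_tupleEquiv, h]

open Classical in
/-- The number of entries of a symmetric tensor with the same monomial as the given one. -/
noncomputable def mult (m d : ℕ) (t : Fin (tdim m d)) : ℝ :=
  ∑ t', if cnt m d t = cnt m d t' then 1 else 0

theorem mult_tupleEquiv {d : ℕ} (α : Fin d → Fin m) :
    mult m d (tupleEquiv m d α) = ((indexCount α).multinomial : ℝ) := by
  classical
  have hdeg : (indexCount α).degree = d := by
    simp [indexCount, map_sum, Finsupp.degree_single]
  rw [← card_indexCount _ hdeg, mult, ← (tupleEquiv m d).sum_comp]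
  simp only [cnt_eq_iff, eq_comm (a := indexCount α)]
  rw [Finset.sum_boole]

theorem mult_pos {d : ℕ} (t : Fin (tdim m d)) : 0 < mult m d t := by
  classical
  refine Finset.sum_pos' (fun t' _ => ?_) ⟨t, Finset.mem_univ _, by simp⟩
  split_ifs <;> norm_num

theorem mult_congr {d : ℕ} {t t' : Fin (tdim m d)} (h : cnt m d t = cnt m d t') :
    mult m d t = mult m d t' := by
  simp only [mult, h]

/-- The symmetric tensor of a polynomial, as a vector. -/
noncomputable def tens (d : ℕ) (p : MvPolynomial (Fin m) ℝ) (t : Fin (tdim m d)) : ℝ :=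
  symTensor d p ((tupleEquiv m d).symm t)

theorem tens_add (d : ℕ) (p q : MvPolynomial (Fin m) ℝ) :
    tens d (p + q) = tens d p + tens d q := by
  ext t
  simp [tens, symTensor, add_div]

theorem tens_smul (d : ℕ) (c : ℝ) (p : MvPolynomial (Fin m) ℝ) :
    tens d (c • p) = c • tens d p := by
  ext t
  simp [tens, symTensor, mul_div_assoc]

/-- `tens` as a linear map. -/
noncomputable def tensMap (m d : ℕ) : MvPolynomial (Fin m) ℝ →ₗ[ℝ] Fin (tdim m d) → ℝ where
  toFun := tens d
  map_add' := tens_add d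
  map_smul' := tens_smul d

theorem polyNorm_eq (d : ℕ) (p : MvPolynomial (Fin m) ℝ) : polyNorm d p = len (tens d p) := by
  rw [polyNorm, len, dotProduct, ← (tupleEquiv m d).sum_comp]
  simp [tens, sq]

theorem eval_eq_tens {d : ℕ} {p : MvPolynomial (Fin m) ℝ} (hp : p.IsHomogeneous d)
    (x : Fin m → ℝ) : MvPolynomial.eval x p = tens d p ⬝ᵥ tpow x d := by
  rw [eval_eq_symTensor hp, dotProduct, ← (tupleEquiv m d).sum_comp]
  simp only [tpow_tupleEquiv, tens, Equiv.symm_apply_apply]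

theorem tens_eq_zero {d : ℕ} {p : MvPolynomial (Fin m) ℝ} (hp : p.IsHomogeneous d)
    (h : tens d p = 0) : p = 0 := by
  refine MvPolynomial.funext fun x => ?_
  rw [eval_eq_tens hp, h, zero_dotProduct, map_zero]

/-- A tensor whose entries depend only on the monomial. -/
def IsSymm {d : ℕ} (z : Fin (tdim m d) → ℝ) : Prop :=
  ∀ t t', cnt m d t = cnt m d t' → z t = z t'

theorem tens_symm (d : ℕ) (p : MvPolynomial (Fin m) ℝ) : IsSymm (tens d p) := by
  intro t t' h
  have h1 : indexCount ((tupleEquiv m d).symm t) = indexCount ((tupleEquiv m d).symm t') := by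
    rw [← cnt_eq_iff, Equiv.apply_symm_apply, Equiv.apply_symm_apply, h]
  simp only [tens, symTensor, h1]

theorem tpow_symm (x : Fin m → ℝ) (d : ℕ) : IsSymm (tpow x d) := by
  intro t t' h
  obtain ⟨α, rfl⟩ := (tupleEquiv m d).surjective t
  obtain ⟨α', rfl⟩ := (tupleEquiv m d).surjective t'
  rw [cnt_eq_iff] at h
  have h1 : ∀ β : Fin d → Fin m, ∏ i, x (β i) = ∏ j, x j ^ (indexCount β) j := by
    intro β
    have h2 : (∏ i, (MvPolynomial.X (β i) : MvPolynomial (Fin m) ℝ))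
        = MvPolynomial.monomial (indexCount β) 1 := by
      simp only [indexCount, MvPolynomial.X, MvPolynomial.monomial_sum_one]
    have h3 := congrArg (MvPolynomial.eval x) h2
    rw [map_prod, MvPolynomial.eval_monomial, Finsupp.prod_fintype _ _ (by simp)] at h3
    simpa using h3
  rw [tpow_tupleEquiv, tpow_tupleEquiv, h1, h1, h]

open Classical in
/-- The orthogonal projection to the symmetric tensors. -/
noncomputable def symProj (m d : ℕ) : Matrix (Fin (tdim m d)) (Fin (tdim m d)) ℝ :=
  of fun t t' => if cnt m d t = cnt m d t' then 1 / mult m d t else 0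

theorem symProj_mulVec {d : ℕ} {z : Fin (tdim m d) → ℝ} (hz : IsSymm z) :
    symProj m d *ᵥ z = z := by
  classical
  ext t
  have h : ∀ t', (if cnt m d t = cnt m d t' then 1 / mult m d t else 0) * z t' =
      (if cnt m d t = cnt m d t' then 1 else 0) * (z t / mult m d t) := by
    intro t'
    split_ifs with h
    · rw [hz t t' h]
      ring
    · simp
  simp only [mulVec, dotProduct, symProj, of_apply, h]
  rw [← Finset.sum_mul]
  exact mul_div_cancel₀ _ (mult_pos t).ne'

theorem symProj_transpose (m d : ℕ) : (symProj m d)ᵀ = symProj m d := by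
  ext t t'
  simp only [transpose_apply, symProj, of_apply]
  by_cases h : cnt m d t = cnt m d t'
  · rw [if_pos h, if_pos h.symm, mult_congr h]
  · rw [if_neg h, if_neg (Ne.symm h)]

theorem symProj_mul_self (m d : ℕ) : symProj m d * symProj m d = symProj m d := by
  classical
  have hz : ∀ t', IsSymm fun t => symProj m d t t' := by
    intro t' t₁ t₂ h
    simp only [symProj, of_apply, h, mult_congr h]
  ext t t'
  exact congrFun (symProj_mulVec (hz t')) t

instance (m d : ℕ) : FiniteDimensional ℝ (MvPolynomial.homogeneousSubmodule (Fin m) ℝ d) :=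
  Module.Finite.iff_fg.2 (MvPolynomial.homogeneousSubmodule_fg _ _ _)

/-- The trace of `symProj m d` is the number of monomials of degree `d`. -/
theorem trace_symProj (m d : ℕ) :
    trace (symProj m d) ≤ Module.finrank ℝ (MvPolynomial.homogeneousSubmodule (Fin m) ℝ d) := by
  classical
  set I : Finset (Fin m →₀ ℕ) := Finset.univ.image fun α : Fin d → Fin m => indexCount α with hI
  have hdeg : ∀ a ∈ I, a.degree = d := by
    intro a ha
    obtain ⟨α, -, rfl⟩ := Finset.mem_image.1 ha
    simp [indexCount, map_sum, Finsupp.degree_single]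
  have htr : trace (symProj m d) = I.card := by
    have h1 : trace (symProj m d) = ∑ α : Fin d → Fin m, 1 / ((indexCount α).multinomial : ℝ) := by
      rw [trace, ← (tupleEquiv m d).sum_comp]
      simp [symProj, mult_tupleEquiv]
    rw [h1, ← Finset.sum_fiberwise_of_maps_to (s := Finset.univ) (t := I) (g := indexCount)
      (fun α hα => Finset.mem_image_of_mem _ hα), Finset.card_eq_sum_ones, Nat.cast_sum]
    refine Finset.sum_congr rfl fun a ha => ?_
    have hpos : (a.multinomial : ℝ) ≠ 0 := by
      rw [Finsupp.multinomial_eq]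
      exact_mod_cast (Nat.multinomial_pos _ _).ne'
    rw [Finset.sum_congr rfl (g := fun _ => 1 / (a.multinomial : ℝ)), Finset.sum_const,
      nsmul_eq_mul, card_indexCount a (hdeg a ha)]
    · rw [mul_one_div_cancel hpos, Nat.cast_one]
    · intro α hα
      rw [(Finset.mem_filter.1 hα).2]
  let f : I → MvPolynomial.homogeneousSubmodule (Fin m) ℝ d := fun a =>
    ⟨MvPolynomial.monomial a.1 1, MvPolynomial.isHomogeneous_monomial _ (hdeg a.1 a.2)⟩
  have hf : LinearIndependent ℝ f := by
    refine LinearIndependent.of_comp (Submodule.subtype _) ?_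
    have := (MvPolynomial.basisMonomials (Fin m) ℝ).linearIndependent
    exact this.comp (fun a : I => a.1) Subtype.val_injective
  rw [htr]
  have := hf.fintype_card_le_finrank
  rw [Fintype.card_coe] at this
  exact_mod_cast this

end Tensors

/-! ### The covariance matrix of a space of polynomials -/

section Start

variable {N : ℕ}

/-- Orthogonal projection matrices. -/
def IsProj (P : Matrix (Fin N) (Fin N) ℝ) : Prop := Pᵀ = P ∧ P * P = P

theorem IsProj.isHermitian {P : Matrix (Fin N) (Fin N) ℝ} (hP : IsProj P) : P.IsHermitian := by
  simpa [IsHermitian] using hP.1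

theorem IsProj.mulVec_mulVec {P : Matrix (Fin N) (Fin N) ℝ} (hP : IsProj P) (z : Fin N → ℝ) :
    P *ᵥ P *ᵥ z = P *ᵥ z := by rw [Matrix.mulVec_mulVec, hP.2]

theorem IsProj.qf_eq {P : Matrix (Fin N) (Fin N) ℝ} (hP : IsProj P) (z : Fin N → ℝ) :
    qf P z = (P *ᵥ z) ⬝ᵥ (P *ᵥ z) := by
  rw [← dot_mulVec_comm hP.isHermitian, hP.mulVec_mulVec, qf]

theorem IsProj.compl {P : Matrix (Fin N) (Fin N) ℝ} (hP : IsProj P) : IsProj (1 - P) := by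
  refine ⟨by rw [transpose_sub, hP.1, transpose_one], ?_⟩
  rw [sub_mul, one_mul, mul_sub, hP.2, mul_one, sub_self, sub_zero]

/-- Projecting out one vector. -/
theorem IsProj.upd {P : Matrix (Fin N) (Fin N) ℝ} (hP : IsProj P) {y : Fin N → ℝ}
    (hy : P *ᵥ y ≠ 0) : IsProj (upd 0 P y) ∧ trace (upd 0 P y) = trace P - 1 ∧
      ∀ z, ∃ c : ℝ, upd 0 P y *ᵥ z = P *ᵥ z - c • P *ᵥ y := by
  set w := P *ᵥ y with hw
  have hq : qf P y = w ⬝ᵥ w := hP.qf_eq y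
  have hw0 : w ⬝ᵥ w ≠ 0 := (dot_sq_pos hy).ne'
  have hu : NearZeroCover.upd 0 P y = P - (w ⬝ᵥ w)⁻¹ • vecMulVec w w := by
    rw [upd_eq, zero_add, hq]
  have hPw : P *ᵥ w = w := hP.mulVec_mulVec y
  have hwP : w ᵥ* P = w := by
    rw [← mulVec_transpose, hP.1, hPw]
  refine ⟨⟨?_, ?_⟩, ?_, fun z => ⟨(w ⬝ᵥ w)⁻¹ * (w ⬝ᵥ z), ?_⟩⟩
  · rw [hu, transpose_sub, hP.1, transpose_smul, transpose_vecMulVec]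
  · rw [hu, sub_mul, mul_sub, mul_sub, hP.2, smul_mul_smul_comm, vecMulVec_mul_vecMulVec,
      mul_smul_comm, mul_vecMulVec, hPw, smul_mul_assoc, vecMulVec_mul, hwP, vecMulVec_smul, smul_smul]
    rw [mul_assoc, inv_mul_cancel₀ hw0, mul_one]
    abel
  · rw [hu, trace_sub, trace_smul, trace_vecMulVec, smul_eq_mul, inv_mul_cancel₀ hw0]
  · rw [hu, sub_mulVec, smul_mulVec, vecMulVec_mulVec]
    simp [smul_smul]

/-- Projecting out linearly independent vectors of the range of a projection. -/
theorem IsProj.foldl_upd {P : Matrix (Fin N) (Fin N) ℝ} (hP : IsProj P) {n : ℕ}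
    {y : Fin n → Fin N → ℝ} (hy : ∀ j, P *ᵥ y j = y j) (hl : LinearIndependent ℝ y) :
    IsProj ((List.ofFn y).foldl (NearZeroCover.upd 0) P) ∧
    trace ((List.ofFn y).foldl (NearZeroCover.upd 0) P) = trace P - n ∧
    ∀ z, P *ᵥ z = z → z - ((List.ofFn y).foldl (NearZeroCover.upd 0) P) *ᵥ z ∈
      Submodule.span ℝ (Set.range y) := by
  induction n with
  | zero => simpa using ⟨hP, fun z hz => by rw [hz, sub_self]⟩
  | succ n ih =>
    rw [linearIndependent_finSucc'] at hl
    obtain ⟨h1, h2, h3⟩ := ih (y := Fin.init y) (fun j => hy _) hl.1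
    have hn : (List.ofFn y).foldl (NearZeroCover.upd 0) P = NearZeroCover.upd 0
        ((List.ofFn (Fin.init y)).foldl (NearZeroCover.upd 0) P) (y (Fin.last n)) := by
      rw [List.ofFn_succ', List.concat_eq_append, List.foldl_append]
      rfl
    set P' := (List.ofFn (Fin.init y)).foldl (NearZeroCover.upd 0) P with hP'
    have hmono : Submodule.span ℝ (Set.range (Fin.init y)) ≤ Submodule.span ℝ (Set.range y) := by
      refine Submodule.span_mono ?_
      rintro _ ⟨j, rfl⟩
      exact ⟨_, rfl⟩
    have hlast := h3 _ (hy (Fin.last n))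
    have hne : P' *ᵥ y (Fin.last n) ≠ 0 := by
      intro h0
      rw [h0, sub_zero] at hlast
      exact hl.2 hlast
    obtain ⟨h4, h5, h6⟩ := h1.upd hne
    rw [hn]
    refine ⟨h4, by rw [h5, h2]; push_cast; ring, fun z hz => ?_⟩
    obtain ⟨c, hc⟩ := h6 z
    have hdec : z - (P' *ᵥ z - c • P' *ᵥ y (Fin.last n)) =
        (z - P' *ᵥ z) + c • (y (Fin.last n) - (y (Fin.last n) - P' *ᵥ y (Fin.last n))) := by
      rw [sub_sub_cancel]
      abel
    rw [hc, hdec]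
    exact add_mem (hmono (h3 z hz)) (Submodule.smul_mem _ _
      (sub_mem (Submodule.subset_span ⟨_, rfl⟩) (hmono hlast)))

/-- The covariance matrix with variance `Λ` on the range of `P` and `σ` on its complement. -/
def spread (Λ σ : ℝ) (P : Matrix (Fin N) (Fin N) ℝ) : Matrix (Fin N) (Fin N) ℝ :=
  of fun i j => (Λ - σ) * P i j + σ * (1 : Matrix (Fin N) (Fin N) ℝ) i j

theorem spread_eq (Λ σ : ℝ) (P : Matrix (Fin N) (Fin N) ℝ) :
    spread Λ σ P = Λ • P + σ • (1 - P) := by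
  ext i j
  simp [spread]
  ring

theorem IsProj.spread_posDef {P : Matrix (Fin N) (Fin N) ℝ} (hP : IsProj P) {Λ σ : ℝ}
    (hΛ : 0 < Λ) (hσ : 0 < σ) : (spread Λ σ P).PosDef := by
  rw [spread_eq]
  refine posDef_iff_qf.2 ⟨?_, fun x hx => ?_⟩
  · rw [IsHermitian, conjTranspose_eq_transpose_of_trivial, transpose_add, transpose_smul,
      transpose_smul, hP.1, hP.compl.1]
  · rw [qf_add, qf_smul, qf_smul, hP.qf_eq, hP.compl.qf_eq]
    have h1 := dot_sq_nonneg (P *ᵥ x)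
    have h2 := dot_sq_nonneg ((1 - P) *ᵥ x)
    rcases h1.lt_or_eq with h | h
    · positivity
    · have h3 : P *ᵥ x = 0 := dotProduct_self_eq_zero.1 h.symm
      have h4 : (1 - P) *ᵥ x = x := by rw [sub_mulVec, one_mulVec, h3, sub_zero]
      have h5 := dot_sq_pos hx
      rw [h4]
      positivity

theorem IsProj.spread_mul {P : Matrix (Fin N) (Fin N) ℝ} (hP : IsProj P) (Λ σ Λ' σ' : ℝ) :
    spread Λ σ P * spread Λ' σ' P = spread (Λ * Λ') (σ * σ') P := by
  simp only [spread_eq, add_mul, mul_add, smul_mul_smul_comm, hP.2, hP.compl.2]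
  have h1 : P * (1 - P) = 0 := by rw [mul_sub, hP.2, mul_one, sub_self]
  have h2 : (1 - P) * P = 0 := by rw [sub_mul, hP.2, one_mul, sub_self]
  rw [h1, h2]
  simp

theorem spread_one_one (P : Matrix (Fin N) (Fin N) ℝ) : spread 1 1 P = 1 := by
  rw [spread_eq]
  simp

theorem IsProj.spread_inv {P : Matrix (Fin N) (Fin N) ℝ} (hP : IsProj P) {Λ σ : ℝ}
    (hΛ : 0 < Λ) (hσ : 0 < σ) : (spread Λ σ P)⁻¹ = spread Λ⁻¹ σ⁻¹ P := by
  apply inv_eq_left_inv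
  rw [hP.spread_mul, inv_mul_cancel₀ hΛ.ne', inv_mul_cancel₀ hσ.ne', spread_one_one]

theorem IsProj.qf_spread {P : Matrix (Fin N) (Fin N) ℝ} (hP : IsProj P) (Λ σ : ℝ)
    (z : Fin N → ℝ) : qf (spread Λ σ P) z =
      Λ * ((P *ᵥ z) ⬝ᵥ (P *ᵥ z)) + σ * ((z - P *ᵥ z) ⬝ᵥ (z - P *ᵥ z)) := by
  rw [spread_eq, qf_add, qf_smul, qf_smul, hP.qf_eq, hP.compl.qf_eq, sub_mulVec, one_mulVec]

theorem IsProj.eff_spread_le {P : Matrix (Fin N) (Fin N) ℝ} (hP : IsProj P) {Λ σ : ℝ}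
    (hΛ : 0 < Λ) (hσ : 0 < σ) : eff (spread Λ σ P) ≤ trace P + σ * N := by
  have h1 : 1 + spread Λ σ P = spread (1 + Λ) (1 + σ) P := by
    rw [spread_eq, spread_eq]
    module
  have htr : 0 ≤ trace P ∧ trace P ≤ N := by
    have h : ∀ i, P i i = (P *ᵥ Pi.single i 1) ⬝ᵥ (P *ᵥ Pi.single i 1) := by
      intro i
      rw [← hP.qf_eq, qf]
      simp
    have h' : ∀ i, (1 - P) i i = ((1 - P) *ᵥ Pi.single i 1) ⬝ᵥ ((1 - P) *ᵥ Pi.single i 1) := by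
      intro i
      rw [← hP.compl.qf_eq, qf]
      simp
    constructor
    · exact Finset.sum_nonneg fun i _ => by
        rw [diag_apply, h]
        exact dot_sq_nonneg _
    · have h2 : 0 ≤ trace (1 - P) := Finset.sum_nonneg fun i _ => by
        rw [diag_apply, h']
        exact dot_sq_nonneg _
      rw [trace_sub, trace_one, Fintype.card_fin] at h2
      linarith
  rw [eff, h1, hP.spread_inv (by positivity) (by positivity), hP.spread_mul, spread_eq, trace_add,
    trace_smul, trace_smul, trace_sub, trace_one, Fintype.card_fin, smul_eq_mul, smul_eq_mul]
  have h2 : Λ * (1 + Λ)⁻¹ ≤ 1 := by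
    rw [← div_eq_mul_inv, div_le_one (by positivity)]
    linarith
  have h3 : σ * (1 + σ)⁻¹ ≤ σ := by
    rw [← div_eq_mul_inv]
    exact div_le_self hσ.le (by linarith)
  have h4 := mul_le_mul_of_nonneg_right h2 htr.1
  have h5 := mul_le_mul h3 (by linarith : (N : ℝ) - trace P ≤ N) (by linarith) hσ.le
  linarith

variable {m d n : ℕ}

/-- The orthogonal projection to the symmetric tensors orthogonal to those of the given
polynomials. -/
noncomputable def residual (m d : ℕ) (ys : List (Fin (tdim m d) → ℝ)) :
    Matrix (Fin (tdim m d)) (Fin (tdim m d)) ℝ :=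
  ys.foldl (upd 0) (symProj m d)

/-- The tensor powers of the near-zero points of a space of polynomials of small codimension are
captured by a matrix of small effective dimension. -/
theorem captures_start {V : Submodule ℝ (MvPolynomial (Fin m) ℝ)}
    (hV : V ≤ MvPolynomial.homogeneousSubmodule (Fin m) ℝ d) {k : ℕ}
    (hk : Module.finrank ℝ (MvPolynomial.homogeneousSubmodule (Fin m) ℝ d)
      ≤ Module.finrank ℝ V + k) (b : Module.Basis (Fin n) ℝ V) {x : Fin m → ℝ} {δ : ℝ}
    (hδ : 0 ≤ δ) (hx : len x ≤ 1)
    (hxV : ∀ p ∈ V, |MvPolynomial.eval x p| ≤ δ * polyNorm d p) {Λ σ : ℝ} (hΛ : 0 < Λ)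
    (hσ : 0 < σ) :
    Captures (spread Λ σ (residual m d (List.ofFn fun j => tens d (b j : MvPolynomial (Fin m) ℝ))))
      (k + σ * tdim m d) (Λ⁻¹ + σ⁻¹ * δ ^ 2) (tpow x d) := by
  have hsym : IsProj (symProj m d) := ⟨symProj_transpose m d, symProj_mul_self m d⟩
  have hli : LinearIndependent ℝ fun j => tens d (b j : MvPolynomial (Fin m) ℝ) := by
    have h1 := b.linearIndependent
    have h2 : LinearIndependent ℝ (((tensMap m d).comp V.subtype) ∘ b) := by
      refine h1.map' _ (LinearMap.ker_eq_bot'.2 fun p hp => ?_)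
      exact Subtype.ext (tens_eq_zero (hV p.2) hp)
    exact h2
  obtain ⟨hP, htr, hspan⟩ := hsym.foldl_upd (fun j => symProj_mulVec (tens_symm d _)) hli
  rw [← residual] at hP htr hspan
  set P := residual m d (List.ofFn fun j => tens d (b j : MvPolynomial (Fin m) ℝ)) with hPdef
  refine ⟨hP.spread_posDef hΛ hσ, ?_, ?_⟩
  · refine (hP.eff_spread_le hΛ hσ).trans (add_le_add_left ?_ _)
    have h1 := trace_symProj m d
    have h2 : Module.finrank ℝ V = n := by
      rw [Module.finrank_eq_card_basis b, Fintype.card_fin]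
    rw [h2] at hk
    have h3 : (Module.finrank ℝ (MvPolynomial.homogeneousSubmodule (Fin m) ℝ d) : ℝ) ≤ n + k := by
      exact_mod_cast hk
    rw [htr]
    linarith
  · set z := tpow x d with hz
    set w := z - P *ᵥ z with hw
    have hzz : z ⬝ᵥ z ≤ 1 := by
      rw [hz, tpow_dot_self, ← len_sq]
      exact pow_le_one₀ (by positivity) (pow_le_one₀ (len_nonneg _) hx)
    -- the component of the tensor power in the span of the given tensors is a tensor of a
    -- polynomial of `V`
    obtain ⟨q, hqV, hq⟩ : ∃ q ∈ V, tens d q = w := by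
      have h1 := hspan z (symProj_mulVec (tpow_symm x d))
      have h2 : Submodule.span ℝ (Set.range fun j => tens d (b j : MvPolynomial (Fin m) ℝ)) ≤
          V.map (tensMap m d) := by
        refine Submodule.span_le.2 ?_
        rintro _ ⟨j, rfl⟩
        exact ⟨b j, (b j).2, rfl⟩
      obtain ⟨q, hq1, hq2⟩ := h2 h1
      exact ⟨q, hq1, hq2⟩
    have hPz : (P *ᵥ z) ⬝ᵥ w = 0 := by
      rw [hw, dotProduct_sub, ← hP.qf_eq, qf, dotProduct_comm, sub_self]
    have hsum : z ⬝ᵥ z = (P *ᵥ z) ⬝ᵥ (P *ᵥ z) + w ⬝ᵥ w := by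
      have h1 : z = P *ᵥ z + w := by rw [hw]; abel
      conv_lhs => rw [h1]
      rw [add_dotProduct, dotProduct_add, dotProduct_add, hPz, dotProduct_comm w, hPz]
      ring
    have hwz : w ⬝ᵥ w = MvPolynomial.eval x q := by
      rw [eval_eq_tens (hV hqV), hq]
      have h1 : w ⬝ᵥ z = w ⬝ᵥ (P *ᵥ z + w) := by
        rw [hw]
        congr 1
        abel
      rw [h1, dotProduct_add, dotProduct_comm w (P *ᵥ z), hPz, zero_add]
    have hle := hxV q hqV
    rw [polyNorm_eq, hq, ← hwz, abs_of_nonneg (dot_sq_nonneg _)] at hle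
    have hw2 : w ⬝ᵥ w ≤ δ ^ 2 := by
      have h1 := len_sq w
      have h2 := len_nonneg w
      rw [← h1] at hle ⊢
      rcases h2.lt_or_eq with h | h
      · have h3 : len w ≤ δ := by
          by_contra h4
          nlinarith
        nlinarith
      · rw [← h, zero_pow two_ne_zero]
        positivity
    rw [hP.spread_inv hΛ hσ, hP.qf_spread]
    refine add_le_add ?_ (mul_le_mul_of_nonneg_left hw2 (by positivity))
    have h1 := dot_sq_nonneg w
    have h2 : (P *ᵥ z) ⬝ᵥ (P *ᵥ z) ≤ 1 := by linarith
    have h3 : 0 ≤ Λ⁻¹ := by positivity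
    nlinarith

end Start

/-! ### Contraction level by level -/

section Levels

variable {m : ℕ}

/-- The search in progress. -/
structure Level (m : ℕ) where
  /-- the order of the tensors -/
  j : ℕ
  /-- the bound on effective dimensions -/
  κ : ℝ
  /-- the covariance matrices -/
  S : List (Matrix (Fin (tdim m j)) (Fin (tdim m j)) ℝ)
  /-- the points found -/
  out : List (Fin m → ℝ)

/-- From tensors of order `j + 1` to tensors of order `j`: every covariance matrix is replaced by its
contractions, and the net of the small subspace that the rounds leave is added to the output. -/
noncomputable def Level.step (p : Params) : Level m → Level m
  | ⟨0, κ, S, out⟩ => ⟨0, κ, S, out⟩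
  | ⟨j + 1, κ, S, out⟩ => ⟨j, 5 * κ / p.s, S.flatMap fun G => (rounds p (5 * κ / p.s) G).2,
      (S.flatMap fun G => comb p.grid (rounds p (5 * κ / p.s) G).1) ++ out⟩

theorem Level.step_out_subset (p : Params) (X : Level m) : X.out ⊆ (X.step p).out := by
  rcases X with ⟨_ | j, κ, S, out⟩
  · exact fun _ h => h
  · exact List.subset_append_right _ _

theorem Level.iterate_out_subset (p : Params) (X : Level m) (t : ℕ) :
    X.out ⊆ ((Level.step p)^[t] X).out := by
  induction t with
  | zero => exact fun _ h => h
  | succ t ih =>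
    rw [Function.iterate_succ_apply']
    exact fun _ h => Level.step_out_subset p _ (ih h)

theorem Level.iterate_j (p : Params) (X : Level m) (t : ℕ) :
    ((Level.step p)^[t] X).j = X.j - t := by
  induction t with
  | zero => rfl
  | succ t ih =>
    rw [Function.iterate_succ_apply', Nat.sub_succ, ← ih]
    rcases (Level.step p)^[t] X with ⟨_ | j, κ, S, out⟩ <;> rfl

/-- Tensors of order `0` have too large effective dimension. -/
theorem not_captures_zero {G : Matrix (Fin (tdim m 0)) (Fin (tdim m 0)) ℝ} {κ ω : ℝ}
    {x : Fin m → ℝ} (hω : ω ≤ 1) (hκ : κ < 1 / 2) : ¬ Captures G κ ω (tpow x 0) := by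
  rintro ⟨hG, he, hq⟩
  set v : Fin (tdim m 0) → ℝ := tpow x 0 with hv
  have hvv : v ⬝ᵥ v = 1 := by rw [hv, tpow_dot_self, pow_zero]
  have h1 := sum_qf_le_eff hG one_pos (fun _ : Fin 1 => v) fun z => by
    simp [dotProduct, hv, tpow, sq]
  have hQ : ((1 : ℝ) • G⁻¹ + gram fun _ : Fin 1 => v).PosDef :=
    (hG.inv.smul one_pos).add_posSemidef (gram_posSemidef _)
  have h2 := two_dot_le hQ ((1 / 2 : ℝ) • v) v
  rw [qf_smul_vec, qf_add, qf_gram, one_smul, smul_dotProduct, hvv] at h2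
  simp only [Finset.univ_unique, Finset.sum_const, Finset.card_singleton, one_smul,
    smul_eq_mul] at h1 h2
  linarith

/-- A point whose tensor power is captured is close to a point of the output. -/
theorem Level.spec {p : Params} {D τ ρ err : ℝ} (hp : p.Valid D τ ρ err)
    (hA : ρ ^ 2 ≤ 4 * p.β) {x : Fin m → ℝ} (hx : len x ≤ 1) (j : ℕ) :
    ∀ {κ ω : ℝ} {S : List (Matrix (Fin (tdim m j)) (Fin (tdim m j)) ℝ)} {out : List (Fin m → ℝ)},
      0 ≤ κ → (∃ G ∈ S, Captures G κ ω (tpow x j)) → τ ^ 2 ≤ ω →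
      (2 * (4 * p.β / ρ ^ 2)) ^ j * ω ≤ 1 → κ * (5 / p.s) ^ j < 1 / 2 →
      ∃ q ∈ ((Level.step p)^[j] ⟨j, κ, S, out⟩).out, len (q - x) ≤ m * err + τ := by
  have hs : (0 : ℝ) < p.s := by exact_mod_cast hp.s_pos
  have hA1 : 1 ≤ 4 * p.β / ρ ^ 2 := by
    have := hp.ρ_pos
    rwa [one_le_div (by positivity)]
  set A := 4 * p.β / ρ ^ 2 with hAdef
  induction j with
  | zero =>
    rintro κ ω S out - ⟨G, -, hG⟩ - h1 h2
    exact absurd hG (not_captures_zero (by simpa using h1) (by simpa using h2))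
  | succ j ih =>
    rintro κ ω S out hκ ⟨G, hGS, hG⟩ hτ h1 h2
    have hω : 0 ≤ ω := (sq_nonneg τ).trans hτ
    have hy : tpow x j ⬝ᵥ tpow x j ≤ 1 := by
      rw [tpow_dot_self, ← len_sq]
      exact pow_le_one₀ (by positivity) (pow_le_one₀ (len_nonneg _) hx)
    have h5 : 5 * κ ≤ p.s * (5 * κ / p.s) := by rw [mul_div_cancel₀ _ hs.ne']
    rw [Function.iterate_succ_apply, Level.step]
    rcases rounds_spec hp h5 (by positivity) hx hy hG with ⟨G', hG', hc⟩ | ⟨q, hq, hd⟩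
    · refine ih (by positivity) ⟨G', List.mem_flatMap.2 ⟨G, hGS, hG'⟩, hc⟩ ?_ ?_ ?_
      · nlinarith
      · refine le_trans ?_ h1
        rw [pow_succ (2 * A), mul_assoc]
        refine mul_le_mul_of_nonneg_left ?_ (by positivity)
        nlinarith
      · refine lt_of_eq_of_lt ?_ h2
        rw [pow_succ]
        ring
    · exact ⟨q, Level.iterate_out_subset p _ _ (List.mem_append_left _
        (List.mem_flatMap.2 ⟨G, hGS, hq⟩)), hd⟩

theorem length_dirs_le (p : Params) (hg : 1 ≤ p.grid.length) (B : List (Fin m → ℝ)) :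
    (dirs p B).length ≤ p.grid.length ^ p.s := by
  rw [dirs, List.length_map, length_comb, List.length_take]
  exact Nat.pow_le_pow_right hg (by omega)

theorem length_round_iterate_snd_le (p : Params) (hg : 1 ≤ p.grid.length) {n : ℕ} (κ : ℝ)
    (G : Matrix (Fin (m * n)) (Fin (m * n)) ℝ) (k : ℕ) :
    ((round p κ G)^[k] (unitVecs m, [])).2.length ≤ k * p.grid.length ^ p.s := by
  induction k with
  | zero => simp
  | succ k ih =>
    rw [Function.iterate_succ_apply', round, List.length_append, List.length_map, add_mul, one_mul,
      add_comm]
    exact Nat.add_le_add ih (length_dirs_le p hg _)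

theorem length_rounds_snd_le (p : Params) (hs : 0 < p.s) (hg : 1 ≤ p.grid.length) {n : ℕ} (κ : ℝ)
    (G : Matrix (Fin (m * n)) (Fin (m * n)) ℝ) :
    (rounds p κ G).2.length ≤ m * p.grid.length ^ p.s :=
  (length_round_iterate_snd_le p hg κ G _).trans (Nat.mul_le_mul_right _ (by omega))

theorem length_comb_rounds_le (p : Params) (hs : 0 < p.s) (hg : 1 ≤ p.grid.length) {n : ℕ} (κ : ℝ)
    (G : Matrix (Fin (m * n)) (Fin (m * n)) ℝ) :
    (comb p.grid (rounds p κ G).1).length ≤ p.grid.length ^ p.s := by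
  rw [length_comb, rounds, length_round_iterate]
  exact Nat.pow_le_pow_right hg (by omega)

theorem length_flatMap_le {α β : Type*} (l : List α) (f : α → List β) {c : ℕ}
    (h : ∀ a, (f a).length ≤ c) : (l.flatMap f).length ≤ l.length * c := by
  induction l with
  | nil => simp
  | cons a l ih =>
    rw [List.flatMap_cons, List.length_append, List.length_cons, add_mul, one_mul, add_comm]
    exact Nat.add_le_add ih (h a)

theorem Level.length_S_le (p : Params) (hs : 0 < p.s) (hg : 1 ≤ p.grid.length) (hm : 0 < m)
    (X : Level m) (t : ℕ) :
    ((Level.step p)^[t] X).S.length ≤ X.S.length * (m * p.grid.length ^ p.s) ^ t := by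
  have hc : 1 ≤ m * p.grid.length ^ p.s := Nat.mul_pos hm (Nat.pow_pos hg)
  induction t with
  | zero => simp
  | succ t ih =>
    rw [Function.iterate_succ_apply', pow_succ, ← mul_assoc]
    generalize (Level.step p)^[t] X = Y at ih ⊢
    rcases Y with ⟨_ | j, κ, S, out⟩
    · exact ih.trans (Nat.le_mul_of_pos_right _ hc)
    · exact (length_flatMap_le _ _ fun G => length_rounds_snd_le p hs hg _ G).trans
        (Nat.mul_le_mul_right _ ih)

theorem Level.length_out_le (p : Params) (hs : 0 < p.s) (hg : 1 ≤ p.grid.length) (hm : 0 < m)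
    (X : Level m) (t : ℕ) :
    ((Level.step p)^[t] X).out.length ≤
      X.out.length + t * (X.S.length * (m * p.grid.length ^ p.s) ^ t) := by
  have hc : 1 ≤ m * p.grid.length ^ p.s := Nat.mul_pos hm (Nat.pow_pos hg)
  induction t with
  | zero => simp
  | succ t ih =>
    have hS := Level.length_S_le p hs hg hm X t
    have h1 : X.S.length * (m * p.grid.length ^ p.s) ^ t ≤
        X.S.length * (m * p.grid.length ^ p.s) ^ (t + 1) :=
      Nat.mul_le_mul_left _ (Nat.pow_le_pow_right hc (by omega))
    have h2 : t * (X.S.length * (m * p.grid.length ^ p.s) ^ t) ≤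
      t * (X.S.length * (m * p.grid.length ^ p.s) ^ (t + 1)) := Nat.mul_le_mul_left _ h1
    rw [Function.iterate_succ_apply', add_mul, one_mul]
    generalize (Level.step p)^[t] X = Y at ih hS ⊢
    rcases Y with ⟨_ | j, κ, S, out⟩
    · exact ih.trans (by omega)
    · have h3 := length_flatMap_le S _ fun G => length_comb_rounds_le p hs hg (5 * κ / p.s) G
      have h4 : S.length * p.grid.length ^ p.s ≤
          X.S.length * (m * p.grid.length ^ p.s) ^ (t + 1) := by
        rw [pow_succ, ← mul_assoc]
        exact Nat.mul_le_mul hS (Nat.le_mul_of_pos_left _ hm)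
      have h5 : S.length ≤ X.S.length * (m * p.grid.length ^ p.s) ^ t := hS
      refine List.length_append.le.trans ((Nat.add_le_add (h3.trans h4) ih).trans ?_)
      omega

end Levels

/-! ### The cover -/

/-- An admissible input of the covering problem, with `C = 100`. -/
structure Input where
  d : ℕ
  k : ℕ
  m : ℕ
  d_pos : 0 < d
  k_pos : 0 < k
  m_pos : 0 < m
  V : Submodule ℝ (MvPolynomial (Fin m) ℝ)
  hV : V ≤ MvPolynomial.homogeneousSubmodule (Fin m) ℝ d
  codim : Module.finrank ℝ (MvPolynomial.homogeneousSubmodule (Fin m) ℝ d)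
    ≤ Module.finrank ℝ V + k
  n : ℕ
  basis : Module.Basis (Fin n) ℝ V
  R : ℝ
  ε : ℝ
  δ : ℝ
  R_pos : 0 < R
  δ_pos : 0 < δ
  ε_le : ε ≤ R
  le_ε : δ ^ (1 / (((100 : ℝ) + 1) * d)) * (2 * R * d * k * m) ^ ((100 : ℝ) / (100 + 1)) ≤ ε

/-- Equally spaced points of `[-1, 1]` with distance `h`. -/
noncomputable def gridList (h : ℝ) : List ℝ :=
  (List.range (⌊2 / h⌋₊ + 1)).map fun t : ℕ => -1 + t * h

theorem isGrid_gridList {h : ℝ} (hh : 0 < h) : IsGrid (gridList h) h := by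
  intro t ht
  rw [abs_le] at ht
  have h0 : 0 ≤ (t + 1) / h := div_nonneg (by linarith) hh.le
  refine ⟨-1 + ⌊(t + 1) / h⌋₊ * h, List.mem_map.2 ⟨_, ?_, rfl⟩, ?_⟩
  · rw [List.mem_range, Nat.lt_succ_iff]
    exact Nat.floor_mono (div_le_div_of_nonneg_right (by linarith) hh.le)
  · have h1 := Nat.floor_le h0
    have h2 := Nat.lt_floor_add_one ((t + 1) / h)
    rw [le_div_iff₀ hh] at h1
    rw [div_lt_iff₀ hh] at h2
    rw [abs_le]
    constructor <;> linarith

theorem length_gridList (h : ℝ) : (gridList h).length = ⌊2 / h⌋₊ + 1 := by simp [gridList]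

theorem exists_vecs (d k : ℕ) (hd : 0 < d) : 40 ^ d * k ≤ (40 * k) ^ d := by
  rw [mul_pow]
  exact Nat.mul_le_mul_left _ (Nat.le_self_pow hd.ne' k)

/-- The least `s` with `(s / 40) ^ d ≥ k`.  After `d` contractions the effective dimension is then at
most `(k + 1) (5 / s) ^ d ≤ 2 k / (8 ^ d k) < 1 / 2`. -/
noncomputable def vecs (d k : ℕ) : ℕ := sInf {s | 40 ^ d * k ≤ s ^ d}

theorem vecs_spec {d : ℕ} (k : ℕ) (hd : 0 < d) : 40 ^ d * k ≤ vecs d k ^ d :=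
  Nat.sInf_mem (s := {s | 40 ^ d * k ≤ s ^ d}) ⟨_, exists_vecs d k hd⟩

theorem vecs_le {d : ℕ} (k : ℕ) (hd : 0 < d) : vecs d k ≤ 40 * k := Nat.sInf_le (exists_vecs d k hd)

theorem lt_vecs_iff {d k s : ℕ} (hd : 0 < d) : s < vecs d k ↔ s ^ d < 40 ^ d * k := by
  constructor
  · intro h
    have := Nat.notMem_of_lt_sInf h
    simpa using this
  · intro h
    by_contra h1
    have := vecs_spec k hd
    have := Nat.pow_le_pow_left (not_lt.1 h1) d
    omega

theorem vecs_pos {d k : ℕ} (hd : 0 < d) (hk : 0 < k) : 0 < vecs d k := by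
  rw [lt_vecs_iff hd, zero_pow hd.ne']
  positivity

theorem vecs_le_rpow {d k : ℕ} (hd : 0 < d) (hk : 0 < k) :
    (vecs d k : ℝ) ≤ 41 * (k : ℝ) ^ (1 / (d : ℝ)) := by
  have hk1 : (1 : ℝ) ≤ k := by exact_mod_cast hk
  have h1 : (1 : ℝ) ≤ (k : ℝ) ^ (1 / (d : ℝ)) := Real.one_le_rpow hk1 (by positivity)
  have h2 : (vecs d k - 1 : ℕ) < vecs d k := Nat.sub_lt (vecs_pos hd hk) one_pos
  rw [lt_vecs_iff hd] at h2
  have h3 : ((vecs d k - 1 : ℕ) : ℝ) ^ d ≤ (40 * (k : ℝ) ^ (1 / (d : ℝ))) ^ d := by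
    rw [mul_pow, ← Real.rpow_natCast ((k : ℝ) ^ (1 / (d : ℝ))), ← Real.rpow_mul (by positivity),
      one_div_mul_cancel (by positivity), Real.rpow_one]
    exact_mod_cast h2.le
  have h4 := le_of_pow_le_pow_left₀ hd.ne' (by positivity) h3
  rw [Nat.cast_sub (vecs_pos hd hk), Nat.cast_one] at h4
  linarith

namespace Input

variable (I : Input)

/-- The base of the powers that occur in the bounds. -/
noncomputable def base : ℝ := 2 * (I.R / I.ε) * I.d * I.k * I.m

/-- The spacing of the coefficients.  It has to be exponentially small in `d`: the contraction from
one order to the next multiplies the bound `ω` of `Captures` by up to `base ^ 25`, and the squared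
fineness of the net must stay below that bound throughout. -/
noncomputable def spacing : ℝ := 1 / (I.base ^ 20) ^ I.d

/-- The parameters of the search.  The conditioning of the directions is `D = base ^ 5`; the weight
exceeds `(2 s + 2) D ^ 2`, and the tolerance is `2 / D`, as `Params.Valid` asks. -/
noncomputable def params : Params where
  s := vecs I.d I.k
  β := I.base ^ 18
  grid := gridList I.spacing
  tol := 2 / I.base ^ 5

/-- The symmetric tensors of the given polynomials. -/
noncomputable def tensors : List (Fin (tdim I.m I.d) → ℝ) :=
  List.ofFn fun j => tens I.d (I.basis j : MvPolynomial (Fin I.m) ℝ)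

/-- The initial level, with one covariance matrix: the variance is `base ^ (26 d)` on the symmetric
tensors orthogonal to those of the given polynomials, a space of dimension at most `k`, and
`m ^ (-d)` on its complement, whose `m ^ d` or fewer dimensions add at most `1` to the effective
dimension. -/
noncomputable def start : Level I.m where
  j := I.d
  κ := I.k + 1
  S := [spread ((I.base ^ 26) ^ I.d) (1 / (I.m : ℝ) ^ I.d) (residual I.m I.d I.tensors)]
  out := []

/-- The cover. -/
noncomputable def points : List (EuclideanSpace ℝ (Fin I.m)) :=
  ((Level.step I.params)^[I.d] I.start).out.map fun q => WithLp.toLp 2 (I.R • q)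

theorem ε_pos : 0 < I.ε := by
  refine lt_of_lt_of_le ?_ I.le_ε
  have := I.R_pos
  have := I.δ_pos
  have : (0 : ℝ) < I.d := by exact_mod_cast I.d_pos
  have : (0 : ℝ) < I.k := by exact_mod_cast I.k_pos
  have : (0 : ℝ) < I.m := by exact_mod_cast I.m_pos
  positivity

theorem one_le_ratio : 1 ≤ I.R / I.ε := (one_le_div I.ε_pos).2 I.ε_le

theorem one_le_d : (1 : ℝ) ≤ I.d := by exact_mod_cast I.d_pos

theorem one_le_k : (1 : ℝ) ≤ I.k := by exact_mod_cast I.k_pos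

theorem one_le_m : (1 : ℝ) ≤ I.m := by exact_mod_cast I.m_pos

theorem le_base : 2 * I.d ≤ I.base ∧ 2 * I.k ≤ I.base ∧ 2 * I.m ≤ I.base ∧
    2 * I.m * (I.R / I.ε) ≤ I.base := by
  have h0 := I.one_le_ratio
  have h1 := I.one_le_d
  have h2 := I.one_le_k
  have h3 := I.one_le_m
  have e : I.base = 2 * ((I.R / I.ε) * I.d * I.k * I.m) := by rw [base]; ring
  have p1 := one_le_mul_of_one_le_of_one_le h0 h1
  have p2 := one_le_mul_of_one_le_of_one_le p1 h2
  have p3 := one_le_mul_of_one_le_of_one_le h1 h2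
  refine ⟨?_, ?_, ?_, ?_⟩
  · have := one_le_mul_of_one_le_of_one_le (one_le_mul_of_one_le_of_one_le h0 h2) h3
    rw [e]
    nlinarith
  · have := one_le_mul_of_one_le_of_one_le p1 h3
    rw [e]
    nlinarith
  · rw [e]
    nlinarith
  · rw [e]
    have : 0 < (I.R / I.ε) * I.m := by positivity
    nlinarith

theorem two_le_base : 2 ≤ I.base := by
  have := I.le_base.1
  have := I.one_le_d
  linarith

theorem base_pos : 0 < I.base := two_pos.trans_le I.two_le_base

/-- A power of two is a factor of a power of the base. -/
theorem two_pow_mul_le (j i : ℕ) : 2 ^ j * I.base ^ i ≤ I.base ^ (j + i) := by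
  rw [pow_add]
  have := I.base_pos
  exact mul_le_mul_of_nonneg_right (pow_le_pow_left₀ (by norm_num) I.two_le_base j) (by positivity)

theorem pow_le_pow {i j : ℕ} (h : i ≤ j) : I.base ^ i ≤ I.base ^ j :=
  pow_le_pow_right₀ (by linarith [I.two_le_base]) h

theorem spacing_pos : 0 < I.spacing := by
  have := I.base_pos
  rw [spacing]
  positivity

theorem vecs_le_base : (vecs I.d I.k : ℝ) ≤ 20 * I.base := by
  have h1 : (vecs I.d I.k : ℝ) ≤ 40 * I.k := by exact_mod_cast vecs_le I.k I.d_pos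
  linarith [I.le_base.2.1]

theorem fineness_le : vecs I.d I.k * I.spacing ≤ 1 / I.base ^ (14 * I.d) := by
  have hb := I.base_pos
  have h1 : (vecs I.d I.k : ℝ) ≤ I.base ^ (6 * I.d) := by
    have h1 := I.two_pow_mul_le 5 1
    have h2 := I.pow_le_pow (show 6 ≤ 6 * I.d by have := I.d_pos; omega)
    have h3 := I.vecs_le_base
    rw [pow_one] at h1
    norm_num at h1
    linarith
  rw [spacing, ← pow_mul, mul_one_div, div_le_div_iff₀ (by positivity) (by positivity), one_mul]
  calc _ ≤ I.base ^ (6 * I.d) * I.base ^ (14 * I.d) :=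
        mul_le_mul_of_nonneg_right h1 (by positivity)
    _ = I.base ^ (20 * I.d) := by rw [← pow_add]; congr 1; ring

theorem fineness_le' : vecs I.d I.k * I.spacing ≤ 1 / I.base ^ 14 := by
  have hb := I.base_pos
  refine I.fineness_le.trans (one_div_le_one_div_of_le (by positivity) (I.pow_le_pow ?_))
  have := I.d_pos
  omega

theorem params_valid : I.params.Valid (I.base ^ 5) (vecs I.d I.k * I.spacing) (1 / I.base ^ 2)
    (1 / I.base ^ 2) := by
  have hb := I.base_pos
  have h2b := I.two_le_base
  have hf := I.fineness_le'
  have hs := I.spacing_pos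
  have hle : ∀ {i j l : ℕ}, j + i ≤ l → 2 ^ j * (1 / I.base ^ l) ≤ 1 / I.base ^ i := by
    intro i j l h
    rw [mul_one_div, div_le_div_iff₀ (by positivity) (by positivity), one_mul]
    exact (I.two_pow_mul_le j i).trans (I.pow_le_pow h)
  refine ⟨vecs_pos I.d_pos I.k_pos, one_le_pow₀ (by linarith), ?_, rfl,
    ⟨_, isGrid_gridList I.spacing_pos, le_rfl⟩, by positivity, ?_, by positivity, ?_, le_rfl, ?_⟩
  · have h1 : (1 : ℝ) ≤ vecs I.d I.k := by exact_mod_cast vecs_pos I.d_pos I.k_pos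
    have h2 := I.vecs_le_base
    have h3 := I.two_pow_mul_le 7 1
    rw [pow_one] at h3
    norm_num at h3
    have h4 : 2 * (vecs I.d I.k : ℝ) + 2 ≤ I.base ^ 8 := by linarith
    show (2 * (vecs I.d I.k : ℝ) + 2) * (I.base ^ 5) ^ 2 ≤ I.base ^ 18
    calc _ ≤ I.base ^ 8 * (I.base ^ 5) ^ 2 := mul_le_mul_of_nonneg_right h4 (by positivity)
      _ = I.base ^ 18 := by ring
  · have := hle (i := 5) (j := 1) (l := 14) (by norm_num)
    linarith
  · have := hle (i := 2) (j := 1) (l := 14) (by norm_num)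
    linarith
  · show 2 * (2 / I.base ^ 5) + _ ≤ _
    have h1 := hle (i := 2) (j := 3) (l := 5) (by norm_num)
    have h2 := hle (i := 2) (j := 1) (l := 14) (by norm_num)
    have h3 : 2 / I.base ^ 5 = 2 * (1 / I.base ^ 5) := by ring
    linarith

/-- The hypothesis on `ε`, freed of real exponents. -/
theorem δ_le : I.δ / I.R ^ I.d ≤ 1 / I.base ^ (100 * I.d) := by
  have hε := I.ε_pos
  have hR := I.R_pos
  have hδ := I.δ_pos
  have hd := I.one_le_d
  have hk := I.one_le_k
  have hm := I.one_le_m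
  set D : ℝ := 2 * I.R * I.d * I.k * I.m with hD
  have hD0 : 0 < D := by positivity
  have hbD : I.base = D / I.ε := by rw [base, hD]; ring
  have h1 := pow_le_pow_left₀ (by positivity) I.le_ε (101 * I.d)
  have e1 : (I.δ ^ (1 / (((100 : ℝ) + 1) * I.d))) ^ (101 * I.d) = I.δ := by
    rw [← Real.rpow_natCast, ← Real.rpow_mul hδ.le]
    push_cast
    rw [show 1 / (((100 : ℝ) + 1) * I.d) * (101 * I.d) = 1 by field_simp; norm_num, Real.rpow_one]
  have e2 : (D ^ ((100 : ℝ) / (100 + 1))) ^ (101 * I.d) = D ^ (100 * I.d) := by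
    rw [← Real.rpow_natCast, ← Real.rpow_mul hD0.le, ← Real.rpow_natCast]
    congr 1
    push_cast
    ring
  rw [mul_pow, e1, e2] at h1
  rw [hbD, div_pow, one_div_div, div_le_div_iff₀ (by positivity) (by positivity)]
  refine h1.trans ?_
  rw [show 101 * I.d = 100 * I.d + I.d by ring, pow_add]
  exact mul_le_mul_of_nonneg_left (pow_le_pow_left₀ hε.le I.ε_le _) (by positivity)

theorem tpow_smul {m : ℕ} (c : ℝ) (x : Fin m → ℝ) (j : ℕ) : tpow (c • x) j = c ^ j • tpow x j := by
  induction j with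
  | zero => rw [pow_zero, one_smul]; rfl
  | succ j ih =>
    rw [tpow, ih]
    ext t
    simp only [kron, Pi.smul_apply, smul_eq_mul, tpow]
    ring

/-- The points cover the near-zero set. -/
theorem isCover_points :
    Metric.IsCover I.ε.toNNReal (nearZeroSet I.d I.V I.R I.δ) {x | x ∈ I.points} := by
  rintro x ⟨hxR, hxV⟩
  have hb := I.base_pos
  have h2b := I.two_le_base
  have hR := I.R_pos
  have hε := I.ε_pos
  have hm := I.one_le_m
  have hdpos := I.d_pos
  set x' : Fin I.m → ℝ := I.R⁻¹ • WithLp.ofLp x with hx'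
  have hx1 : len x' ≤ 1 := by
    rw [hx', len_smul, len_eq_norm, abs_of_pos (by positivity), inv_mul_le_iff₀ hR, mul_one]
    exact hxR
  have hxV' : ∀ p ∈ I.V, |MvPolynomial.eval x' p| ≤ I.δ / I.R ^ I.d * polyNorm I.d p := by
    intro p hp
    have h1 : MvPolynomial.eval x' p = (I.R⁻¹) ^ I.d * MvPolynomial.eval (fun i => x i) p := by
      rw [eval_eq_tens (I.hV hp), eval_eq_tens (I.hV hp), hx', tpow_smul, dotProduct_smul,
        smul_eq_mul]
    rw [h1, abs_mul, abs_of_pos (by positivity), inv_pow, div_mul_eq_mul_div, inv_mul_eq_div]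
    exact div_le_div_of_nonneg_right (hxV p hp) (by positivity)
  have hcap := captures_start I.hV I.codim I.basis (δ := I.δ / I.R ^ I.d)
    (by have := I.δ_pos; positivity) hx1 hxV' (Λ := (I.base ^ 26) ^ I.d)
    (σ := 1 / (I.m : ℝ) ^ I.d) (by positivity) (by positivity)
  have hle : ∀ {i j l : ℕ}, j + i ≤ l → 2 ^ j * (1 / I.base ^ l) ≤ 1 / I.base ^ i := by
    intro i j l h
    rw [mul_one_div, div_le_div_iff₀ (by positivity) (by positivity), one_mul]
    exact (I.two_pow_mul_le j i).trans (I.pow_le_pow h)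
  have hκ : (I.k : ℝ) + 1 / (I.m : ℝ) ^ I.d * tdim I.m I.d = I.k + 1 := by
    rw [tdim_eq, Nat.cast_pow, one_div_mul_cancel (by positivity)]
  have hω : ((I.base ^ 26) ^ I.d)⁻¹ + (1 / (I.m : ℝ) ^ I.d)⁻¹ * (I.δ / I.R ^ I.d) ^ 2 ≤
      1 / I.base ^ (25 * I.d) := by
    have h1 : ((I.base ^ 26) ^ I.d)⁻¹ = 1 / I.base ^ (26 * I.d) := by rw [← pow_mul, one_div]
    have h2 : (1 / (I.m : ℝ) ^ I.d)⁻¹ ≤ I.base ^ I.d := by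
      rw [one_div, inv_inv]
      exact pow_le_pow_left₀ (by positivity) (by linarith [I.le_base.2.2.1]) _
    have h3 : (I.δ / I.R ^ I.d) ^ 2 ≤ 1 / I.base ^ (200 * I.d) := by
      refine (pow_le_pow_left₀ (by have := I.δ_pos; positivity) I.δ_le 2).trans_eq ?_
      rw [div_pow, one_pow, ← pow_mul]
      congr 2
      ring
    have h4 : (1 / (I.m : ℝ) ^ I.d)⁻¹ * (I.δ / I.R ^ I.d) ^ 2 ≤ 1 / I.base ^ (199 * I.d) := by
      refine (mul_le_mul h2 h3 (by positivity) (by positivity)).trans_eq ?_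
      rw [mul_one_div, div_eq_div_iff (by positivity) (by positivity), ← pow_add, one_mul]
      congr 1
      ring
    have h5 := hle (i := 25 * I.d) (j := 1) (l := 26 * I.d) (by omega)
    have h6 := hle (i := 25 * I.d) (j := 1) (l := 199 * I.d) (by omega)
    linarith
  rw [hκ] at hcap
  obtain ⟨q, hq, hqx⟩ := Level.spec I.params_valid
    (show (1 / I.base ^ 2) ^ 2 ≤ 4 * I.base ^ 18 by
      have h1 : (1 / I.base ^ 2) ^ 2 ≤ 1 := by
        refine pow_le_one₀ (by positivity) ?_
        rw [div_le_one (by positivity)]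
        exact one_le_pow₀ (by linarith)
      have h2 : (1 : ℝ) ≤ I.base ^ 18 := one_le_pow₀ (by linarith)
      linarith) hx1 I.d (κ := I.k + 1) (ω := 1 / I.base ^ (25 * I.d))
    (S := I.start.S) (out := []) (by positivity)
    ⟨_, List.mem_singleton.2 rfl, hcap.1, hcap.2.1, hcap.2.2.trans hω⟩
    (by
      refine (pow_le_pow_left₀ (by have := I.spacing_pos; positivity) I.fineness_le 2).trans ?_
      rw [div_pow, one_pow, ← pow_mul]
      refine one_div_le_one_div_of_le (by positivity) (I.pow_le_pow ?_)
      omega)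
    (by
      have h1 : 2 * (4 * I.params.β / (1 / I.base ^ 2) ^ 2) ≤ I.base ^ 25 := by
        have h2 := I.two_pow_mul_le 3 22
        have h3 : 2 * (4 * I.params.β / (1 / I.base ^ 2) ^ 2) = 2 ^ 3 * I.base ^ 22 := by
          show 2 * (4 * I.base ^ 18 / (1 / I.base ^ 2) ^ 2) = _
          field_simp
          norm_num
        exact h3.trans_le h2
      have h2 : 0 ≤ I.params.β := by
        show 0 ≤ I.base ^ 18
        positivity
      rw [mul_one_div, div_le_one (by positivity), pow_mul]
      exact pow_le_pow_left₀ (by positivity) h1 _)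
    (by
      have hs : (0 : ℝ) < vecs I.d I.k := by exact_mod_cast vecs_pos I.d_pos I.k_pos
      have h1 : (40 : ℝ) ^ I.d * I.k ≤ (vecs I.d I.k : ℝ) ^ I.d := by
        exact_mod_cast vecs_spec I.k I.d_pos
      have h2 : (40 : ℝ) ^ I.d = 5 ^ I.d * 8 ^ I.d := by rw [← mul_pow]; norm_num
      have h3 : (8 : ℝ) ≤ 8 ^ I.d := le_self_pow₀ (by norm_num) hdpos.ne'
      have h4 := I.one_le_k
      have h5 : (0 : ℝ) < 5 ^ I.d := by positivity
      show ((I.k : ℝ) + 1) * (5 / (vecs I.d I.k : ℝ)) ^ I.d < 1 / 2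
      rw [div_pow, mul_div_assoc', div_lt_div_iff₀ (by positivity) two_pos]
      have h6 : (5 : ℝ) ^ I.d * (8 * I.k) ≤ 40 ^ I.d * I.k := by
        rw [h2]
        nlinarith [mul_le_mul_of_nonneg_right h3 (by positivity : (0 : ℝ) ≤ 5 ^ I.d * I.k)]
      nlinarith)
  refine ⟨WithLp.toLp 2 (I.R • q), List.mem_map.2 ⟨q, hq, rfl⟩, ?_⟩
  have hdist : dist x (WithLp.toLp 2 (I.R • q)) ≤ I.ε := by
    have h1 : x - WithLp.toLp 2 (I.R • q) = WithLp.toLp 2 ((-I.R) • (q - x')) := by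
      ext i
      simp only [hx', PiLp.sub_apply, Pi.smul_apply, Pi.sub_apply, smul_eq_mul]
      field_simp
      ring
    rw [dist_eq_norm, h1, ← len_eq_norm, len_smul, abs_neg, abs_of_pos hR]
    have h2 := I.le_base.2.2.2
    have h3 := I.fineness_le'
    have h4 := hle (i := 1) (j := 0) (l := 14) (by norm_num)
    have h5 : (I.m : ℝ) * (1 / I.base ^ 2) ≤ 1 / 2 * (1 / I.base) * I.m := by
      have h6 := hle (i := 1) (j := 1) (l := 2) (by norm_num)
      simp only [pow_one] at h6
      nlinarith [mul_le_mul_of_nonneg_right h6 (by positivity : (0 : ℝ) ≤ I.m)]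
    have h6 : len (q - x') ≤ 2 * I.m / I.base := by
      rw [pow_one] at h4
      have h7 : 2 * (I.m : ℝ) / I.base = 2 * (1 / I.base * I.m) := by ring
      have h8 : 1 / I.base ≤ 1 / I.base * I.m := le_mul_of_one_le_right (by positivity) hm
      rw [h7]
      have h9 : 0 ≤ 1 / I.base * I.m := by positivity
      linarith
    have h7 : 2 * I.m / I.base ≤ I.ε / I.R := by
      rw [div_le_div_iff₀ hb hR]
      rw [mul_div_assoc', div_le_iff₀ hε] at h2
      linarith
    calc I.R * len (q - x') ≤ I.R * (I.ε / I.R) := mul_le_mul_of_nonneg_left (h6.trans h7) hR.le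
      _ = I.ε := by field_simp
  show edist x (WithLp.toLp 2 (I.R • q)) ≤ (I.ε.toNNReal : ENNReal)
  rw [edist_dist]
  exact ENNReal.ofReal_le_ofReal hdist

theorem one_le_grid : 1 ≤ I.params.grid.length := by
  show 1 ≤ (gridList I.spacing).length
  rw [length_gridList]
  omega

theorem length_grid_le : (I.params.grid.length : ℝ) ≤ I.base ^ (22 * I.d) := by
  have hb := I.base_pos
  show ((gridList I.spacing).length : ℝ) ≤ _
  rw [length_gridList, spacing, div_div_eq_mul_div, div_one, ← pow_mul]
  push_cast
  have h1 := Nat.floor_le (by positivity : 0 ≤ 2 * I.base ^ (20 * I.d))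
  have h2 := I.two_pow_mul_le 2 (20 * I.d)
  have h3 := I.pow_le_pow (show 2 + 20 * I.d ≤ 22 * I.d by have := I.d_pos; omega)
  have h4 : 1 ≤ I.base ^ (20 * I.d) := one_le_pow₀ (by linarith [I.two_le_base])
  linarith

/-- The branching factor of the search. -/
noncomputable def branching : ℕ := I.m * I.params.grid.length ^ I.params.s

theorem branching_pow_le : (I.d * I.branching ^ I.d : ℝ) ≤ coverBound 100 I.d I.k I.m I.R I.ε := by
  have hb := I.base_pos
  have hs : 1 ≤ vecs I.d I.k := vecs_pos I.d_pos I.k_pos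
  have hd := I.d_pos
  have h1 : (I.branching : ℝ) ≤ I.base ^ (23 * I.d * vecs I.d I.k) := by
    rw [branching]
    push_cast
    have h2 : (I.m : ℝ) ≤ I.base ^ 1 := by rw [pow_one]; linarith [I.le_base.2.2.1, I.one_le_m]
    have h3 : (I.params.grid.length : ℝ) ^ I.params.s ≤ (I.base ^ (22 * I.d)) ^ vecs I.d I.k :=
      pow_le_pow_left₀ (by positivity) I.length_grid_le _
    refine (mul_le_mul h2 h3 (by positivity) (by positivity)).trans ?_
    rw [← pow_mul, ← pow_add]
    refine I.pow_le_pow ?_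
    nlinarith [Nat.mul_le_mul hd hs]
  have h2 : (I.d * I.branching ^ I.d : ℝ) ≤ I.base ^ (24 * I.d ^ 2 * vecs I.d I.k) := by
    have h3 : (I.d : ℝ) ≤ I.base ^ 1 := by rw [pow_one]; linarith [I.le_base.1, I.one_le_d]
    refine (mul_le_mul h3 (pow_le_pow_left₀ (by positivity) h1 _) (by positivity)
      (by positivity)).trans ?_
    rw [← pow_mul, ← pow_add]
    refine I.pow_le_pow ?_
    nlinarith [Nat.mul_le_mul (Nat.mul_le_mul hd hd) hs]
  refine h2.trans ?_
  rw [coverBound, ← base, ← Real.rpow_natCast]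
  refine Real.rpow_le_rpow_of_exponent_le (by linarith [I.two_le_base]) ?_
  push_cast
  have h3 := vecs_le_rpow I.d_pos I.k_pos
  have h4 : (0 : ℝ) ≤ (I.k : ℝ) ^ (1 / (I.d : ℝ)) := by positivity
  have h5 : (0 : ℝ) ≤ (I.d : ℝ) ^ 2 := by positivity
  calc 24 * (I.d : ℝ) ^ 2 * vecs I.d I.k
      ≤ 24 * (I.d : ℝ) ^ 2 * (41 * (I.k : ℝ) ^ (1 / (I.d : ℝ))) :=
        mul_le_mul_of_nonneg_left h3 (by positivity)
    _ ≤ 100 ^ 2 * (I.d : ℝ) ^ 2 * (I.k : ℝ) ^ (1 / (I.d : ℝ)) := by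
        nlinarith [mul_nonneg h5 h4]

theorem length_points_le : (I.points.length : ℝ) ≤ coverBound 100 I.d I.k I.m I.R I.ε := by
  refine le_trans ?_ I.branching_pow_le
  have h1 := Level.length_out_le I.params (vecs_pos I.d_pos I.k_pos) I.one_le_grid I.m_pos
    I.start I.d
  rw [points, List.length_map]
  simp only [start, List.length_nil, List.length_singleton, zero_add, one_mul] at h1 ⊢
  exact_mod_cast h1

end Input

/-! ### Programs for lists -/

namespace Comp

section MoreLists

variable {ι : Type*} {sz : ι → ℕ} {e f : ι → Val} {α β γ : ι → Type*}
  {encα : ∀ i, α i → Val} {encβ : ∀ i, β i → Val} {encγ : ∀ i, γ i → Val}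

/-- A computed datum remains available under a new local variable. -/
theorem lift {κ : ι → Type*} {a : ((i : ι) × κ i) → Val} (h : Comp sz e f) :
    Comp (fun x : (i : ι) × κ i => sz x.1) (fun x => .node (a x) (e x.1)) fun x => f x.1 :=
  weak (h.reindex Sigma.fst)

/-- A computed datum remains available under two new local variables. -/
theorem lift₂ {κ : ι → Type*} {a b : ((i : ι) × κ i) → Val} (h : Comp sz e f) :
    Comp (fun x : (i : ι) × κ i => sz x.1) (fun x => .node (a x) (.node (b x) (e x.1)))
      fun x => f x.1 :=
  weak (weak (h.reindex Sigma.fst))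

theorem _root_.NearZeroCover.Bd.lift {κ : ι → Type*} {n : ι → ℕ} (h : Bd sz n) :
    Bd (fun x : (i : ι) × κ i => sz x.1) fun x => n x.1 := h.reindex Sigma.fst

/-- Case distinction on a list. -/
theorem listCases {l : ∀ i, List (α i)} (hl : Comp sz e fun i => encList (encα i) (l i))
    (hnil : Comp (fun i : {i // l i = []} => sz i) (fun i => e i) fun i => f i)
    (hcons : Comp (fun x : (i : ι) × {p : α i × List (α i) // l i = p.1 :: p.2} => sz x.1)
      (fun x => .node (encα x.1 x.2.1.1) (.node (encList (encα x.1) x.2.1.2) (e x.1)))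
      fun x => f x.1) : Comp sz e f := by
  classical
  have ht : Comp sz e fun i => Val.ofProp (l i = []) := by
    refine ofProp_congr (hl.trans (op .isLeaf)) fun i => ?_
    rcases l i with _ | ⟨a, r⟩
    · simp
    · simp
  have h : Comp (fun i : {i // ¬ l i = []} => sz i) (fun i => e i) fun i => f i := by
    have hx : ∀ i : {i // ¬ l i = []}, ∃ p : α i × List (α i), l i = p.1 :: p.2 := fun i =>
      ⟨((l i).head i.2, (l i).tail), (List.cons_head_tail i.2).symm⟩
    choose p hp using hx
    have h1 : Comp (fun i : {i // ¬ l i = []} => sz i) (fun i => e i)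
        fun i => .node (encα i (p i).1) (encList (encα i) (p i).2) :=
      (hl.reindex Subtype.val).congr fun i => by rw [hp i, encList_cons]
    exact (node (fst h1) (node (snd h1) id)).trans (hcons.reindex fun i : {i // ¬ l i = []} =>
      (⟨i.1, p i, hp i⟩ : (i : ι) × {p : α i × List (α i) // l i = p.1 :: p.2}))
  exact (ite' ht hnil h).congr fun i => by simp

/-- `zipWith`, as a fold that consumes the second list. -/
theorem zipWith {l : ∀ i, List (α i)} {l' : ∀ i, List (β i)} {F : ∀ i, α i → β i → γ i}
    (hn : Bd sz fun i => (l i).length) (hl : Comp sz e fun i => encList (encα i) (l i))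
    (hl' : Comp sz e fun i => encList (encβ i) (l' i))
    (hF : Comp (fun x : (i : ι) × α i × β i => sz x.1)
      (fun x => .node (encα x.1 x.2.1) (.node (encβ x.1 x.2.2) (e x.1)))
      fun x => encγ x.1 (F x.1 x.2.1 x.2.2)) :
    Comp sz e fun i => encList (encγ i) (List.zipWith (F i) (l i) (l' i)) := by
  let G : ∀ i, List (β i) × List (γ i) → α i → List (β i) × List (γ i) := fun i X a =>
    match X.1 with
    | [] => X
    | b :: r => (r, F i a b :: X.2)
  let enc : ∀ i, List (β i) × List (γ i) → Val := fun i X =>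
    .node (encList (encβ i) X.1) (encList (encγ i) X.2)
  have hG : ∀ i (l : List (α i)) (X : List (β i) × List (γ i)),
      (l.foldl (G i) X).2 = (List.zipWith (F i) l X.1).reverse ++ X.2 := by
    intro i l
    induction l with
    | nil => intro X; simp
    | cons a l ih =>
      rintro ⟨_ | ⟨b, r⟩, Y⟩
      · rw [List.foldl_cons, ih]
        simp [G]
      · rw [List.foldl_cons, ih]
        simp [G]
  have h := foldl (encα := encα) (encβ := enc) (F := G) (b₀ := fun i => (l' i, [])) hn hl
    (node hl' nil) (by
      refine listCases (l := fun x => x.2.2.1) (encα := fun x => encβ x.1)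
        (fst (weak var)) ?_ ?_
      · refine Comp.congr (weak var) ?_
        rintro ⟨⟨i, a, Y, Z⟩, h⟩
        obtain rfl : Y = [] := h
        rfl
      · have h1 := hF.reindex fun x : (x : (i : ι) × α i × List (β i) × List (γ i)) ×
          {p : β x.1 × List (β x.1) // x.2.2.1 = p.1 :: p.2} =>
            (⟨x.1.1, x.1.2.1, x.2.1.1⟩ : (i : ι) × α i × β i)
        refine (node (weak var) (cons (encα := fun x : (x : (i : ι) × α i × List (β i) × List (γ i)) ×
          {p : β x.1 × List (β x.1) // x.2.2.1 = p.1 :: p.2} => encγ x.1.1)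
          (l := fun x => x.1.2.2.2)
          ((node (weak (weak var)) (node var (weak (weak (weak (weak id)))))).trans h1)
          (weak (weak (snd (weak var)))))).congr ?_
        rintro ⟨⟨i, a, Y, Z⟩, ⟨b, r⟩, h⟩
        change β i at b
        change List (β i) at r
        change Y = b :: r at h
        subst h
        rfl)
  have h2 := snd h
  refine (reverse (encα := encγ) (l := fun i => ((l i).foldl (G i) (l' i, [])).2)
    (hn.mono fun i => ?_) h2).congr fun i => ?_
  · rw [hG]
    simp
  · rw [hG]
    simp

/-- Concatenation of images; the fold goes from right to left, so that only the images are
copied. -/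
theorem flatMap {l : ∀ i, List (α i)} {F : ∀ i, α i → List (β i)}
    (hn : Bd sz fun i => (l i).length)
    (hl : Comp sz e fun i => encList (encα i) (l i))
    (hFn : Bd (fun x : (i : ι) × α i => sz x.1) fun x => (F x.1 x.2).length)
    (hF : Comp (fun x : (i : ι) × α i => sz x.1) (fun x => .node (encα x.1 x.2) (e x.1))
      fun x => encList (encβ x.1) (F x.1 x.2)) :
    Comp sz e fun i => encList (encβ i) ((l i).flatMap (F i)) := by
  let φ : ((i : ι) × α i × List (β i)) → (i : ι) × α i := fun x => ⟨x.1, x.2.1⟩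
  have h := foldl (β := fun i => List (β i)) (encβ := fun i => encList (encβ i))
    (F := fun i acc x => F i x ++ acc) (b₀ := fun _ => []) (l := fun i => (l i).reverse)
    (by simpa using hn) (reverse hn hl) nil
    (append (l := fun x : (i : ι) × α i × List (β i) => F x.1 x.2.1)
      (l' := fun x => x.2.2) (encα := fun x => encβ x.1) (hFn.reindex φ)
      ((node var (weak (weak id))).trans (hF.reindex φ)) (weak var))
  refine h.congr fun i => ?_
  congr 1
  rw [List.foldl_reverse]
  induction l i with
  | nil => rfl
  | cons a r ih => rw [List.foldr_cons, ih, List.flatMap_cons]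

theorem ofProp_forall {l : ∀ i, List (α i)} {p : ∀ i, α i → Prop}
    (hn : Bd sz fun i => (l i).length) (hl : Comp sz e fun i => encList (encα i) (l i))
    (hp : Comp (fun x : (i : ι) × α i => sz x.1) (fun x => .node (encα x.1 x.2) (e x.1))
      fun x => Val.ofProp (p x.1 x.2)) :
    Comp sz e fun i => Val.ofProp (∀ a ∈ l i, p i a) := by
  have h := foldl (β := fun _ => Prop) (encβ := fun _ => Val.ofProp)
    (F := fun i acc x => p i x ∧ acc) (b₀ := fun _ => True) hn hl
    (one.congr fun i => (ofProp_true trivial).symm)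
    (and ((node var (weak (weak id))).trans
      (hp.reindex fun x : (i : ι) × α i × Prop => (⟨x.1, x.2.1⟩ : (i : ι) × α i))) (weak var))
  refine ofProp_congr h fun i => ?_
  have key : ∀ (l : List (α i)) (q : Prop), l.foldl (fun acc x => p i x ∧ acc) q ↔
      q ∧ ∀ a ∈ l, p i a := by
    intro l
    induction l with
    | nil => simp
    | cons a l ih =>
      intro q
      rw [List.foldl_cons, ih, List.forall_mem_cons]
      tauto
  rw [key]
  simp

theorem listSum {l : ∀ i, List (α i)} {F : ∀ i, α i → ℝ} (hn : Bd sz fun i => (l i).length)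
    (hl : Comp sz e fun i => encList (encα i) (l i))
    (hF : Comp (fun x : (i : ι) × α i => sz x.1) (fun x => .node (encα x.1 x.2) (e x.1))
      fun x => .leaf (F x.1 x.2)) :
    Comp sz e fun i => .leaf ((l i).map (F i)).sum := by
  have h := foldl (β := fun _ => ℝ) (encβ := fun _ => Val.leaf)
    (F := fun i acc x => acc + F i x) (b₀ := fun _ => 0) hn hl zero
    (add (weak var) ((node var (weak (weak id))).trans
      (hF.reindex fun x : (i : ι) × α i × ℝ => (⟨x.1, x.2.1⟩ : (i : ι) × α i))))
  refine h.congr fun i => ?_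
  congr 1
  have key : ∀ (l : List (α i)) (q : ℝ), l.foldl (fun acc x => acc + F i x) q =
      q + (l.map (F i)).sum := by
    intro l
    induction l with
    | nil => simp
    | cons a l ih =>
      intro q
      rw [List.foldl_cons, ih, List.map_cons, List.sum_cons, add_assoc]
  rw [key, zero_add]

/-- A `while` loop that leaves the environment alone. -/
theorem whileLoop {K : ι → ℕ} (hK : Bd sz K) {s : ι → ℕ → Val} (h₀ : Comp sz e fun i => s i 0)
    (ht : Comp (fun x : (i : ι) × Fin (K i + 1) => sz x.1) (fun x => .node (s x.1 x.2) (e x.1))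
      fun x => Val.ofProp ((x.2 : ℕ) < K x.1))
    (hb : Comp (fun x : (i : ι) × Fin (K i) => sz x.1) (fun x => .node (s x.1 x.2) (e x.1))
      fun x => s x.1 (x.2 + 1)) :
    Comp sz e fun i => s i (K i) := by
  have h := iterate (s := fun i k => .node (s i k) (e i)) hK ht (node hb (weak id))
  exact (node h₀ id).trans (fst h)

/-- A loop with a counter. -/
theorem loop {K : ι → ℕ} (hK : Bd sz K) (hKc : Comp sz e fun i => .leaf (K i))
    {s : ι → ℕ → Val} (h₀ : Comp sz e fun i => s i 0)
    (hb : Comp (fun x : (i : ι) × Fin (K i) => sz x.1) (fun x => .node (s x.1 x.2) (e x.1))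
      fun x => s x.1 (x.2 + 1)) :
    Comp sz e fun i => s i (K i) := by
  have h := whileLoop (s := fun i k => .node (.leaf k) (s i k)) hK
    (node (zero.congr fun _ => by simp) h₀)
    (ofProp_congr (not (le (hKc.lift) (fst var))) fun x => by simp)
    (node ((add (fst var) one).congr fun x => by simp)
      ((node (snd var) (weak id)).trans hb))
  exact snd h

end MoreLists

section Numbers

variable {ι : Type*} {sz : ι → ℕ} {e : ι → Val} {x : ι → ℝ}

/-- A number in unary. -/
def _root_.NearZeroCover.unary (n : ℕ) : Val := encList (fun _ : Unit => .leaf 0) (.replicate n ())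

theorem unary {n : ι → ℕ} (hn : Bd sz n) (h : Comp sz e fun i => .leaf (n i)) :
    Comp sz e fun i => NearZeroCover.unary (n i) :=
  loop (s := fun _ k => NearZeroCover.unary k) hn h zero (node zero var)

theorem pow (n : ℕ) (hx : Comp sz e fun i => .leaf (x i)) :
    Comp sz e fun i => .leaf (x i ^ n) := by
  induction n with
  | zero => exact one.congr fun _ => by simp
  | succ n ih => exact (mul ih hx).congr fun i => by rw [pow_succ]

theorem pow_nat {n : ι → ℕ} (hn : Bd sz n) (h : Comp sz e fun i => .leaf (n i))
    (hx : Comp sz e fun i => .leaf (x i)) : Comp sz e fun i => .leaf (x i ^ n i) :=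
  loop (s := fun i k => .leaf (x i ^ k)) hn h (one.congr fun _ => by simp)
    ((mul var hx.lift).congr fun x => by rw [pow_succ])

theorem abs (hx : Comp sz e fun i => .leaf (x i)) : Comp sz e fun i => .leaf |x i| := by
  refine (sqrt (mul hx hx)).congr fun i => ?_
  rw [← sq, Real.sqrt_sq_eq_abs]

end Numbers

end Comp

/-! ### Programs for vectors and matrices -/

/-- A vector as the list of its entries. -/
def vecVal {n : ℕ} (v : Fin n → ℝ) : Val := encList .leaf (List.ofFn v)

/-- A matrix as the list of its rows. -/
def matVal {n m : ℕ} (A : Matrix (Fin n) (Fin m) ℝ) : Val :=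
  encList vecVal (List.ofFn fun i => A i)

theorem map_ofFn_eq {α β : Type*} {n : ℕ} (f : Fin n → α) (g : α → β) :
    (List.ofFn f).map g = List.ofFn fun i => g (f i) := List.map_ofFn

theorem zipWith_ofFn {α β γ : Type*} {n : ℕ} (F : α → β → γ) (f : Fin n → α) (g : Fin n → β) :
    List.zipWith F (List.ofFn f) (List.ofFn g) = List.ofFn fun i => F (f i) (g i) := by
  refine List.ext_getElem (by simp) fun k h1 h2 => by simp

theorem zipWith_replicate {α : Type*} (s : ℕ) (l : List α) :
    List.zipWith (fun _ a => a) (List.replicate s ()) l = l.take s := by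
  induction s generalizing l with
  | zero => simp
  | succ s ih =>
    rcases l with _ | ⟨a, l⟩
    · simp
    · rw [List.replicate_succ, List.zipWith_cons_cons, ih, List.take_succ_cons]

theorem ofFn_kron {m n : ℕ} (u : Fin m → ℝ) (f : Fin n → ℝ) :
    List.ofFn (kron u f) = (List.ofFn u).flatMap fun a => (List.ofFn f).map (a * ·) := by
  rw [List.ofFn_mul, List.flatMap_def, List.map_ofFn]
  congr 2
  funext i
  rw [Function.comp, List.map_ofFn]
  congr 1
  funext j
  have h := kron_apply u f i j
  refine (congrArg (kron u f) (Fin.ext ?_)).trans h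
  simp [finProdFinEquiv, add_comm, mul_comm]

namespace Comp

variable {ι : Type*} {sz : ι → ℕ} {e : ι → Val} {m n : ι → ℕ}

section Vector

variable {v w : ∀ i, Fin (n i) → ℝ}

theorem vecMap {F : ι → ℝ → ℝ} (hn : Bd sz n) (hv : Comp sz e fun i => vecVal (v i))
    (hF : Comp (fun x : (_ : ι) × ℝ => sz x.1) (fun x => .node (.leaf x.2) (e x.1))
      fun x => .leaf (F x.1 x.2)) :
    Comp sz e fun i => vecVal fun j => F i (v i j) := by
  have h := map (l := fun i => List.ofFn (v i)) (encα := fun _ => Val.leaf)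
    (encβ := fun _ => Val.leaf) (F := F) (by simpa using hn) hv hF
  exact h.congr fun i => by rw [map_ofFn_eq, vecVal]

theorem vecZip {F : ι → ℝ → ℝ → ℝ} (hn : Bd sz n) (hv : Comp sz e fun i => vecVal (v i))
    (hw : Comp sz e fun i => vecVal (w i))
    (hF : Comp (fun x : (_ : ι) × ℝ × ℝ => sz x.1)
      (fun x => .node (.leaf x.2.1) (.node (.leaf x.2.2) (e x.1)))
      fun x => .leaf (F x.1 x.2.1 x.2.2)) :
    Comp sz e fun i => vecVal fun j => F i (v i j) (w i j) := by
  have h := zipWith (l := fun i => List.ofFn (v i)) (l' := fun i => List.ofFn (w i))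
    (encα := fun _ => Val.leaf) (encβ := fun _ => Val.leaf)
    (encγ := fun _ => Val.leaf) (F := F) (by simpa using hn) hv hw hF
  exact h.congr fun i => by rw [zipWith_ofFn, vecVal]

theorem vecAdd (hn : Bd sz n) (hv : Comp sz e fun i => vecVal (v i))
    (hw : Comp sz e fun i => vecVal (w i)) : Comp sz e fun i => vecVal (v i + w i) :=
  vecZip (F := fun _ a b => a + b) hn hv hw (add var (weak var))

theorem vecSub (hn : Bd sz n) (hv : Comp sz e fun i => vecVal (v i))
    (hw : Comp sz e fun i => vecVal (w i)) : Comp sz e fun i => vecVal (v i - w i) :=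
  vecZip (F := fun _ a b => a - b) hn hv hw (sub var (weak var))

theorem vecSmul {c : ι → ℝ} (hn : Bd sz n) (hc : Comp sz e fun i => .leaf (c i))
    (hv : Comp sz e fun i => vecVal (v i)) : Comp sz e fun i => vecVal (c i • v i) :=
  vecMap (F := fun i a => c i * a) hn hv (mul hc.lift var)

theorem dot (hn : Bd sz n) (hv : Comp sz e fun i => vecVal (v i))
    (hw : Comp sz e fun i => vecVal (w i)) : Comp sz e fun i => .leaf (v i ⬝ᵥ w i) := by
  have h1 := vecZip (F := fun _ a b => a * b) hn hv hw (mul var (weak var))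
  have h := listSum (l := fun i => List.ofFn fun j => v i j * w i j) (encα := fun _ => Val.leaf)
    (F := fun _ a => a) (by simpa using hn) h1 var
  exact h.congr fun i => by rw [List.map_id', List.sum_ofFn]; rfl

theorem vecNormalize (hn : Bd sz n) (hv : Comp sz e fun i => vecVal (v i)) :
    Comp sz e fun i => vecVal (normalize (v i)) :=
  (vecSmul hn (div one (sqrt (dot hn hv hv))) hv).congr fun i => by
    rw [normalize, len, one_div]

theorem vecReflect (hn : Bd sz n) (hv : Comp sz e fun i => vecVal (v i))
    (hw : Comp sz e fun i => vecVal (w i)) : Comp sz e fun i => vecVal (reflect (v i) (w i)) :=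
  vecSub hn hw (vecSmul hn (div (mul ((const 2).congr fun _ => by norm_num) (dot hn hv hw))
    (dot hn hv hv)) hv)

theorem vecKron {u : ∀ i, Fin (m i) → ℝ} (hm : Bd sz m) (hn : Bd sz n)
    (hu : Comp sz e fun i => vecVal (u i)) (hv : Comp sz e fun i => vecVal (v i)) :
    Comp sz e fun i => vecVal (kron (u i) (v i)) := by
  have h := flatMap (l := fun i => List.ofFn (u i)) (encα := fun _ => Val.leaf)
    (encβ := fun _ => Val.leaf) (F := fun i a => (List.ofFn (v i)).map (a * ·))
    (by simpa using hm) hu (by simpa using hn.lift)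
    (map (l := fun x : (_ : ι) × ℝ => List.ofFn (v x.1)) (encα := fun _ => Val.leaf)
      (encβ := fun _ => Val.leaf) (F := fun x b => x.2 * b) (by simpa using hn.lift) hv.lift
      (mul (weak var) var))
  exact h.congr fun i => by rw [vecVal, ofFn_kron]

end Vector

section Mat

variable {A : ∀ i, Matrix (Fin (m i)) (Fin (n i)) ℝ}

theorem mulVec {v : ∀ i, Fin (n i) → ℝ} (hm : Bd sz m) (hn : Bd sz n)
    (hA : Comp sz e fun i => matVal (A i)) (hv : Comp sz e fun i => vecVal (v i)) :
    Comp sz e fun i => vecVal (A i *ᵥ v i) := by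
  have h := map (l := fun i => List.ofFn fun j => A i j) (encα := fun _ => vecVal)
    (encβ := fun _ => Val.leaf) (F := fun i r => r ⬝ᵥ v i) (by simpa using hm) hA
    (dot (n := fun x : (i : ι) × (Fin (n i) → ℝ) => n x.1) (v := fun x => x.2) hn.lift var hv.lift)
  exact h.congr fun i => by rw [map_ofFn_eq]; rfl

theorem matSmul {c : ι → ℝ} (hm : Bd sz m) (hn : Bd sz n) (hc : Comp sz e fun i => .leaf (c i))
    (hA : Comp sz e fun i => matVal (A i)) : Comp sz e fun i => matVal (c i • A i) := by
  have h := map (l := fun i => List.ofFn fun j => A i j) (encα := fun _ => vecVal)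
    (encβ := fun _ => vecVal) (F := fun i r => c i • r) (by simpa using hm) hA
    (vecSmul (n := fun x : (i : ι) × (Fin (n i) → ℝ) => n x.1) (v := fun x => x.2) hn.lift
      hc.lift var)
  exact h.congr fun i => by rw [map_ofFn_eq]; rfl

end Mat

section Square

variable {A : ∀ i, Matrix (Fin (n i)) (Fin (n i)) ℝ} {v : ∀ i, Fin (n i) → ℝ}

theorem comp_qf (hn : Bd sz n) (hA : Comp sz e fun i => matVal (A i))
    (hv : Comp sz e fun i => vecVal (v i)) : Comp sz e fun i => .leaf (qf (A i) (v i)) :=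
  dot hn hv (mulVec hn hn hA hv)

theorem comp_upd {c : ι → ℝ} (hn : Bd sz n) (hc : Comp sz e fun i => .leaf (c i))
    (hA : Comp sz e fun i => matVal (A i)) (hv : Comp sz e fun i => vecVal (v i)) :
    Comp sz e fun i => matVal (upd (c i) (A i) (v i)) := by
  have hw := mulVec hn hn hA hv
  have hs := add hc (dot hn hv hw)
  have h := zipWith (l := fun i => List.ofFn fun j => A i j)
    (l' := fun i => List.ofFn (A i *ᵥ v i)) (encα := fun _ => vecVal)
    (encβ := fun _ => Val.leaf) (encγ := fun _ => vecVal)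
    (F := fun i r a => r - (a / (c i + v i ⬝ᵥ A i *ᵥ v i)) • (A i *ᵥ v i))
    (by simpa using hn) hA hw
    (vecSub (n := fun x : (i : ι) × (Fin (n i) → ℝ) × ℝ => n x.1) (v := fun x => x.2.1) hn.lift
      var (vecSmul hn.lift (div (weak var) hs.lift₂) hw.lift₂))
  exact h.congr fun i => by rw [zipWith_ofFn]; rfl

theorem foldl_upd {c : ι → ℝ} {ys : ∀ i, List (Fin (n i) → ℝ)} (hn : Bd sz n)
    (hc : Comp sz e fun i => .leaf (c i)) (hl : Bd sz fun i => (ys i).length)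
    (hys : Comp sz e fun i => encList vecVal (ys i)) (hA : Comp sz e fun i => matVal (A i)) :
    Comp sz e fun i => matVal ((ys i).foldl (upd (c i)) (A i)) :=
  foldl (encα := fun _ => vecVal) (encβ := fun _ => matVal) (F := fun i => upd (c i)) hl hys hA
    (comp_upd (n := fun x : (i : ι) × (Fin (n i) → ℝ) × Matrix (Fin (n i)) (Fin (n i)) ℝ => n x.1)
      (A := fun x => x.2.2) (v := fun x => x.2.1) hn.lift hc.lift₂ (weak var) var)

end Square

theorem comp_take {α : ι → Type*} {encα : ∀ i, α i → Val} {s : ι → ℕ} {l : ∀ i, List (α i)}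
    (hs : Bd sz s) (hsu : Comp sz e fun i => NearZeroCover.unary (s i))
    (hl : Comp sz e fun i => encList (encα i) (l i)) :
    Comp sz e fun i => encList (encα i) ((l i).take (s i)) := by
  have h := zipWith (l := fun i => List.replicate (s i) ()) (encα := fun _ _ => .leaf 0)
    (encβ := encα) (encγ := encα) (F := fun _ _ a => a) (by simpa using hs) hsu hl (weak var)
  exact h.congr fun i => by rw [zipWith_replicate]

section Nets

variable {grid : ι → List ℝ} {bs : ∀ i, List (Fin (m i) → ℝ)} {s : ι → ℕ}

theorem comp_comb (hm : Bd sz m) (hg : Bd sz fun i => (grid i).length)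
    (hgs : Bd sz fun i => (grid i).length ^ s i) (hgrid : Comp sz e fun i => encList .leaf (grid i))
    (hz : Comp sz e fun i => vecVal (0 : Fin (m i) → ℝ)) (hg1 : ∀ i, 1 ≤ (grid i).length)
    (hbl : Bd sz fun i => (bs i).length) (hbs : ∀ i, (bs i).length ≤ s i)
    (hb : Comp sz e fun i => encList vecVal (bs i)) :
    Comp sz e fun i => encList vecVal (comb (grid i) (bs i)) := by
  refine foldl' (encα := fun _ => vecVal) (encβ := fun _ => encList vecVal)
    (F := fun i acc b => acc.flatMap fun p => (grid i).map fun c => p + c • b)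
    (b₀ := fun _ => [0]) hbl hb (cons (encα := fun _ => vecVal) hz nil) ?_
  refine flatMap (l := fun x : (i : ι) × {p : List (Fin (m i) → ℝ) × (Fin (m i) → ℝ) //
    p.1 ++ [p.2] <+: bs i} => comb (grid x.1) x.2.1.1)
    (F := fun x p => (grid x.1).map fun c => p + c • x.2.1.2)
    (encα := fun _ => vecVal) (encβ := fun _ => vecVal) ?_ (weak var) ?_ ?_
  · refine hgs.lift.mono ?_
    rintro ⟨i, ⟨p, b⟩, h⟩
    rw [length_comb]
    refine Nat.pow_le_pow_right (hg1 i) (le_trans ?_ (hbs i))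
    have := h.length_le
    simp only [List.length_append, List.length_singleton] at this
    dsimp only
    omega
  · simpa using hg.lift.lift
  · refine map (l := fun x : (x : (i : ι) × {p : List (Fin (m i) → ℝ) × (Fin (m i) → ℝ) //
      p.1 ++ [p.2] <+: bs i}) × (Fin (m x.1) → ℝ) => grid x.1.1)
      (encα := fun _ => .leaf) (encβ := fun _ => vecVal) (F := fun x c => x.2 + c • x.1.2.1.2)
      hg.lift.lift ?_ (vecAdd hm.lift.lift.lift (weak var)
        (vecSmul hm.lift.lift.lift var (weak (weak var))))
    exact weak (weak (weak ((hgrid.reindex Sigma.fst).reindex Sigma.fst)))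

theorem comp_dirs {p : ι → Params} (hm : Bd sz m) (hg : Bd sz fun i => (p i).grid.length)
    (hgs : Bd sz fun i => (p i).grid.length ^ (p i).s) (hs : Bd sz fun i => (p i).s)
    (hgrid : Comp sz e fun i => encList .leaf (p i).grid)
    (hsu : Comp sz e fun i => NearZeroCover.unary (p i).s)
    (hz : Comp sz e fun i => vecVal (0 : Fin (m i) → ℝ)) (hg1 : ∀ i, 1 ≤ (p i).grid.length)
    (hb : Comp sz e fun i => encList vecVal (bs i)) :
    Comp sz e fun i => encList vecVal (dirs (p i) (bs i)) := by
  have hle : ∀ i, ((bs i).take (p i).s).length ≤ (p i).s := fun i => by simp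
  have h := comp_comb hm hg hgs hgrid hz hg1 (hs.mono hle) hle
    (comp_take (encα := fun _ => vecVal) hs hsu hb)
  refine map (encα := fun _ => vecVal) (encβ := fun _ => vecVal) (F := fun _ => normalize)
    (hgs.mono fun i => ?_) h (vecNormalize hm.lift var)
  rw [length_comb]
  exact Nat.pow_le_pow_right (hg1 i) (hle i)

end Nets

end Comp

/-! ### The program for one level -/

/-- A direction with its effective dimension. -/
def scoreVal {m : ℕ} (u : (Fin m → ℝ) × ℝ) : Val := .node (vecVal u.1) (.leaf u.2)

namespace Comp

variable {ι : Type*} {sz : ι → ℕ} {e : ι → Val} {m n : ι → ℕ}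

section Children

variable {β : ι → ℝ} {bs : ∀ i, List (Fin (m i) → ℝ)}
  {G : ∀ i, Matrix (Fin (m i * n i)) (Fin (m i * n i)) ℝ} {u : ∀ i, Fin (m i) → ℝ}

theorem comp_kronUnits (hm : Bd sz m) (hn : Bd sz n)
    (hids : Comp sz e fun i => encList vecVal (unitVecs (n i)))
    (hu : Comp sz e fun i => vecVal (u i)) :
    Comp sz e fun i => encList vecVal ((unitVecs (n i)).map (kron (u i))) :=
  map (encα := fun _ => vecVal) (encβ := fun _ => vecVal) (F := fun i => kron (u i))
    (by simpa [unitVecs] using hn) hids (vecKron hm.lift hn.lift hu.lift var)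

theorem comp_penInv (hm : Bd sz m) (hn : Bd sz n) (hbl : Bd sz fun i => (bs i).length)
    (hids : Comp sz e fun i => encList vecVal (unitVecs (n i)))
    (hβ : Comp sz e fun i => .leaf (β i)) (hbs : Comp sz e fun i => encList vecVal (bs i))
    (hG : Comp sz e fun i => matVal (G i)) (hu : Comp sz e fun i => vecVal (u i)) :
    Comp sz e fun i => matVal (penInv (β i) (bs i) (G i) (u i)) := by
  have h := flatMap (encα := fun _ => vecVal) (encβ := fun _ => vecVal)
    (F := fun i b => (unitVecs (n i)).map (kron (b - (b ⬝ᵥ u i) • u i))) hbl hbs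
    (by simpa [unitVecs] using hn.lift)
    (comp_kronUnits (m := fun x : (i : ι) × (Fin (m i) → ℝ) => m x.1) hm.lift hn.lift hids.lift
      (vecSub hm.lift var (vecSmul hm.lift (dot hm.lift var hu.lift) hu.lift)))
  refine foldl_upd (n := fun i => m i * n i) (hm.mul hn) (div one hβ) ?_ h
    (matSmul (hm.mul hn) (hm.mul hn) (div one hβ) hG)
  refine (hbl.mul hn).mono fun i => ?_
  exact length_flatMap_le _ _ fun b => by simp [unitVecs]

theorem comp_child (hm : Bd sz m) (hn : Bd sz n) (hbl : Bd sz fun i => (bs i).length)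
    (hids : Comp sz e fun i => encList vecVal (unitVecs (n i)))
    (hβ : Comp sz e fun i => .leaf (β i)) (hbs : Comp sz e fun i => encList vecVal (bs i))
    (hG : Comp sz e fun i => matVal (G i)) (hu : Comp sz e fun i => vecVal (u i)) :
    Comp sz e fun i => matVal (child (β i) (bs i) (G i) (u i)) := by
  have hA := comp_penInv hm hn hbl hids hβ hbs hG hu
  have hks := comp_kronUnits hm hn hids hu
  have hl : Bd sz fun i => ((unitVecs (n i)).map (kron (u i))).length := by
    simpa [unitVecs] using hn
  have hN := hm.mul hn
  have h := map (encα := fun _ => vecVal) (encβ := fun _ => encList .leaf)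
    (F := fun i a => ((unitVecs (n i)).map (kron (u i))).map fun b =>
      a ⬝ᵥ penInv (β i) (bs i) (G i) (u i) *ᵥ b) hl hks
    (map (l := fun x : (i : ι) × (Fin (m i * n i) → ℝ) =>
        (unitVecs (n x.1)).map (kron (u x.1))) (encα := fun _ => vecVal) (encβ := fun _ => Val.leaf)
      (F := fun x b => x.2 ⬝ᵥ penInv (β x.1) (bs x.1) (G x.1) (u x.1) *ᵥ b) hl.lift hks.lift
      (dot hN.lift.lift (weak var) (mulVec hN.lift.lift hN.lift.lift
        (weak (weak ((hA.reindex Sigma.fst).reindex Sigma.fst))) var)))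
  refine h.congr fun i => ?_
  simp only [matVal, vecVal, encList, unitVecs, map_ofFn_eq, child, image, of_apply]

theorem comp_childEff (hm : Bd sz m) (hn : Bd sz n) (hbl : Bd sz fun i => (bs i).length)
    (hids : Comp sz e fun i => encList vecVal (unitVecs (n i)))
    (hβ : Comp sz e fun i => .leaf (β i)) (hbs : Comp sz e fun i => encList vecVal (bs i))
    (hG : Comp sz e fun i => matVal (G i)) (hu : Comp sz e fun i => vecVal (u i)) :
    Comp sz e fun i => .leaf (childEff (β i) (bs i) (G i) (u i)) := by
  have hA := comp_penInv hm hn hbl hids hβ hbs hG hu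
  have hks := comp_kronUnits hm hn hids hu
  have hl : Bd sz fun i => ((unitVecs (n i)).map (kron (u i))).length := by
    simpa [unitVecs] using hn
  have hN := hm.mul hn
  have hM := foldl_upd (n := fun i => m i * n i) hN one hl hks hA
  exact listSum (encα := fun _ => vecVal)
    (F := fun i => qf (((unitVecs (n i)).map (kron (u i))).foldl (upd 1)
      (penInv (β i) (bs i) (G i) (u i)))) hl hks (comp_qf hN.lift hM.lift var)

end Children

section Rounds

theorem comp_pick {κ tol : ι → ℝ} {us : ∀ i, List ((Fin (m i) → ℝ) × ℝ)} (hm : Bd sz m)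
    (hz : Comp sz e fun i => vecVal (0 : Fin (m i) → ℝ)) (hκ : Comp sz e fun i => .leaf (κ i))
    (htol : Comp sz e fun i => .leaf (tol i)) (hl : Bd sz fun i => (us i).length)
    (hus : Comp sz e fun i => encList scoreVal (us i)) :
    Comp sz e fun i => vecVal (pick (κ i) (tol i) (us i)) := by
  classical
  have ht : Comp (fun x : (i : ι) × (Fin (m i) → ℝ) => sz x.1)
      (fun x => .node (vecVal x.2) (e x.1))
      fun x => Val.ofProp (Separates (κ x.1) (tol x.1) (us x.1) x.2) := by
    refine and (not (le (dot hm.lift var var) zero)) ?_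
    refine ofProp_forall (l := fun x : (i : ι) × (Fin (m i) → ℝ) => us x.1)
      (encα := fun _ => scoreVal) (p := fun x u => u.2 ≤ κ x.1 ∨ |x.2 ⬝ᵥ u.1| ≤ tol x.1)
      hl.lift hus.lift ?_
    exact or (le (snd var) (weak (weak ((hκ.reindex Sigma.fst).reindex Sigma.fst))))
      (le (abs (dot hm.lift.lift (weak var) (fst var)))
        (weak (weak ((htol.reindex Sigma.fst).reindex Sigma.fst))))
  refine (foldl (encα := fun _ => scoreVal) (encβ := fun _ => vecVal) (l := us)
    (F := fun i acc u => if Separates (κ i) (tol i) (us i) u.1 then u.1 else acc)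
    (b₀ := fun _ => 0) hl hus hz ?_).congr fun i => ?_
  · refine (ite ((node (fst var) (weak (weak id))).trans (ht.reindex
      fun x : (i : ι) × ((Fin (m i) → ℝ) × ℝ) × (Fin (m i) → ℝ) =>
        (⟨x.1, x.2.1.1⟩ : (i : ι) × (Fin (m i) → ℝ)))) (fst var) (weak var)).congr fun _ => ?_
    split_ifs <;> rfl
  · rw [pick]

theorem comp_cut {B : ∀ i, List (Fin (m i) → ℝ)} {v : ∀ i, Fin (m i) → ℝ} (hm : Bd sz m)
    (hl : Bd sz fun i => (B i).length) (hB : Comp sz e fun i => encList vecVal (B i))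
    (hv : Comp sz e fun i => vecVal (v i)) :
    Comp sz e fun i => encList vecVal (cut (B i) (v i)) := by
  refine listCases (encα := fun _ => vecVal) hB ?_ ?_
  · refine (nil (encα := fun i : {i // B i = []} => @vecVal (m i))).congr ?_
    rintro ⟨i, hi⟩
    simp [cut, hi]
  · have h1 := hm.lift (κ := fun i => {p : (Fin (m i) → ℝ) × List (Fin (m i) → ℝ) //
      B i = p.1 :: p.2})
    refine (map (l := fun x : (i : ι) × {p : (Fin (m i) → ℝ) × List (Fin (m i) → ℝ) //
      B i = p.1 :: p.2} => x.2.1.2) (encα := fun _ => vecVal) (encβ := fun _ => vecVal)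
      (F := fun x => reflect (v x.1 - x.2.1.1)) (hl.lift.mono ?_) (weak var)
      (vecReflect h1.lift (vecSub h1.lift
        (weak (weak (weak ((hv.reindex Sigma.fst).reindex Sigma.fst)))) (weak var)) var)).congr ?_
    · rintro ⟨i, p, hp⟩
      simp [hp]
    · rintro ⟨i, p, hp⟩
      simp [cut, hp]

/-- The state of the rounds. -/
def _root_.NearZeroCover.roundVal {m n : ℕ}
    (X : List (Fin m → ℝ) × List (Matrix (Fin n) (Fin n) ℝ)) : Val :=
  .node (encList vecVal X.1) (encList matVal X.2)

/-- The data available to the program for the rounds, except for the covariance matrix. -/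
structure Setup (sz : ι → ℕ) (e : ι → Val) (m n : ι → ℕ) (p : ι → Params) (κ : ι → ℝ) : Prop where
  bd_m : Bd sz m
  bd_n : Bd sz n
  bd_s : Bd sz fun i => (p i).s
  bd_grid : Bd sz fun i => (p i).grid.length
  bd_net : Bd sz fun i => (p i).grid.length ^ (p i).s
  grid_pos : ∀ i, 1 ≤ (p i).grid.length
  units : Comp sz e fun i => encList vecVal (unitVecs (m i))
  ids : Comp sz e fun i => encList vecVal (unitVecs (n i))
  zeros : Comp sz e fun i => vecVal (0 : Fin (m i) → ℝ)
  s : Comp sz e fun i => NearZeroCover.unary (p i).s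
  K : Comp sz e fun i => NearZeroCover.unary (m i + 1 - (p i).s)
  β : Comp sz e fun i => .leaf (p i).β
  grid : Comp sz e fun i => encList .leaf (p i).grid
  tol : Comp sz e fun i => .leaf (p i).tol
  κ : Comp sz e fun i => .leaf (κ i)

variable {p : ι → Params} {κ : ι → ℝ}

theorem Setup.weak (h : Setup sz e m n p κ) (a : ι → Val) :
    Setup sz (fun i => .node (a i) (e i)) m n p κ where
  bd_m := h.bd_m
  bd_n := h.bd_n
  bd_s := h.bd_s
  bd_grid := h.bd_grid
  bd_net := h.bd_net
  grid_pos := h.grid_pos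
  units := Comp.weak h.units
  ids := Comp.weak h.ids
  zeros := Comp.weak h.zeros
  s := Comp.weak h.s
  K := Comp.weak h.K
  β := Comp.weak h.β
  grid := Comp.weak h.grid
  tol := Comp.weak h.tol
  κ := Comp.weak h.κ

theorem Setup.reindex {ι' : Type*} (φ : ι' → ι) (h : Setup sz e m n p κ) :
    Setup (fun i => sz (φ i)) (fun i => e (φ i)) (fun i => m (φ i)) (fun i => n (φ i))
      (fun i => p (φ i)) (fun i => κ (φ i)) where
  bd_m := h.bd_m.reindex φ
  bd_n := h.bd_n.reindex φ
  bd_s := h.bd_s.reindex φ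
  bd_grid := h.bd_grid.reindex φ
  bd_net := h.bd_net.reindex φ
  grid_pos i := h.grid_pos (φ i)
  units := h.units.reindex φ
  ids := h.ids.reindex φ
  zeros := h.zeros.reindex φ
  s := h.s.reindex φ
  K := h.K.reindex φ
  β := h.β.reindex φ
  grid := h.grid.reindex φ
  tol := h.tol.reindex φ
  κ := h.κ.reindex φ

theorem Setup.round (h : Setup sz e m n p κ)
    {G : ∀ i, Matrix (Fin (m i * n i)) (Fin (m i * n i)) ℝ}
    (hG : Comp sz e fun i => matVal (G i))
    {X : ∀ i, List (Fin (m i) → ℝ) × List (Matrix (Fin (n i)) (Fin (n i)) ℝ)}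
    (hl : Bd sz fun i => (X i).1.length) (hX : Comp sz e fun i => roundVal (X i)) :
    Comp sz e fun i => roundVal (round (p i) (κ i) (G i) (X i)) := by
  have hB := fst hX
  have hd := comp_dirs h.bd_m h.bd_grid h.bd_net h.bd_s h.grid h.s h.zeros h.grid_pos hB
  have hdl : Bd sz fun i => (dirs (p i) (X i).1).length :=
    h.bd_net.mono fun i => length_dirs_le (p i) (h.grid_pos i) _
  have ht := comp_take (encα := fun _ => vecVal) h.bd_s h.s hB
  have htl : Bd sz fun i => ((X i).1.take (p i).s).length := h.bd_s.mono fun i => by simp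
  have hs : Comp sz e fun i => encList scoreVal (scores (p i) (G i) (X i).1) :=
    map (encα := fun _ => vecVal) (encβ := fun _ => scoreVal)
      (F := fun i u => (u, childEff (p i).β ((X i).1.take (p i).s) (G i) u)) hdl hd
      (node var (comp_childEff h.bd_m.lift h.bd_n.lift htl.lift h.ids.lift h.β.lift ht.lift
        hG.lift var))
  have hc : Comp sz e fun i => encList matVal
      ((dirs (p i) (X i).1).map (child (p i).β ((X i).1.take (p i).s) (G i))) :=
    map (encα := fun _ => vecVal) (encβ := fun _ => matVal)
      (F := fun i u => child (p i).β ((X i).1.take (p i).s) (G i) u) hdl hd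
      (comp_child h.bd_m.lift h.bd_n.lift htl.lift h.ids.lift h.β.lift ht.lift hG.lift var)
  exact node (comp_cut h.bd_m hl hB (comp_pick h.bd_m h.zeros h.κ h.tol
    (hdl.mono fun i => by simp [scores]) hs))
    (append (encα := fun _ => matVal) (hdl.mono fun i => by simp) hc (snd hX))

theorem Setup.rounds (h : Setup sz e m n p κ)
    {G : ∀ i, Matrix (Fin (m i * n i)) (Fin (m i * n i)) ℝ}
    (hG : Comp sz e fun i => matVal (G i)) :
    Comp sz e fun i => roundVal (rounds (p i) (κ i) (G i)) := by
  have hX0 : Comp sz e fun i => roundVal ((unitVecs (m i), []) :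
      List (Fin (m i) → ℝ) × List (Matrix (Fin (n i)) (Fin (n i)) ℝ)) :=
    node h.units (nil (encα := fun _ => matVal))
  have hf := foldl' (l := fun i => List.replicate (m i + 1 - (p i).s) ())
    (encα := fun _ _ => .leaf 0) (encβ := fun _ => roundVal)
    (F := fun i X _ => NearZeroCover.round (p i) (κ i) (G i) X) (b₀ := fun i => (unitVecs (m i), []))
    ((h.bd_m.add (Bd.const 1)).mono fun i => by simp) h.K hX0 ?_
  · refine hf.congr fun i => ?_
    rw [List.foldl_const, List.length_replicate]
    rfl
  · refine Setup.round (((h.reindex Sigma.fst).weak _).weak _)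
      (G := fun x => G x.1) (hG.lift₂) ?_ (Comp.weak var)
    refine h.bd_m.lift.mono fun x => ?_
    rw [List.foldl_const, length_round_iterate]
    omega

/-- The datum of a level. -/
def _root_.NearZeroCover.levelVal {m : ℕ} (X : Level m) : Val :=
  .node (.leaf X.κ) (.node (encList matVal X.S) (encList vecVal X.out))

/-- The program for one level; the effective dimension in `h` is that of the next level. -/
theorem Setup.step {j : ι → ℕ} {κ₀ : ι → ℝ}
    (h : Setup sz e m (fun i => tdim (m i) (j i)) p fun i => 5 * κ₀ i / (p i).s)
    (hs : ∀ i, 0 < (p i).s)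
    {S : ∀ i, List (Matrix (Fin (tdim (m i) (j i + 1))) (Fin (tdim (m i) (j i + 1))) ℝ)}
    {out : ∀ i, List (Fin (m i) → ℝ)} (hl : Bd sz fun i => (S i).length)
    (hS : Comp sz e fun i => encList matVal (S i))
    (hout : Comp sz e fun i => encList vecVal (out i)) :
    Comp sz e fun i => levelVal (Level.step (p i) ⟨j i + 1, κ₀ i, S i, out i⟩) := by
  have hr := Setup.rounds (((h.reindex Sigma.fst).weak
    fun x : (i : ι) × Matrix (Fin (tdim (m i) (j i + 1))) (Fin (tdim (m i) (j i + 1))) ℝ =>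
      matVal x.2)) (G := fun x => x.2) var
  refine node h.κ (node ?_ ?_)
  · exact flatMap (encα := fun _ => matVal) (encβ := fun _ => matVal)
      (F := fun i G => (NearZeroCover.rounds (m := m i) (n := tdim (m i) (j i)) (p i)
        (5 * κ₀ i / (p i).s) G).2) hl hS
      ((h.bd_m.mul h.bd_net).lift.mono fun x =>
        length_rounds_snd_le (p x.1) (hs x.1) (h.grid_pos x.1) _ _) (snd hr)
  · have hc : ∀ i (G : Matrix (Fin (tdim (m i) (j i + 1))) (Fin (tdim (m i) (j i + 1))) ℝ),
        (NearZeroCover.rounds (m := m i) (n := tdim (m i) (j i)) (p i)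
          (5 * κ₀ i / (p i).s) G).1.length ≤ (p i).s := by
      intro i G
      rw [NearZeroCover.rounds, length_round_iterate]
      have := hs i
      omega
    refine append (encα := fun _ => vecVal) ((hl.mul h.bd_net).mono fun i => ?_)
      (flatMap (encα := fun _ => matVal) (encβ := fun _ => vecVal)
        (F := fun i G => comb (p i).grid (NearZeroCover.rounds (m := m i) (n := tdim (m i) (j i))
          (p i) (5 * κ₀ i / (p i).s) G).1) hl hS (h.bd_net.lift.mono fun x =>
        length_comb_rounds_le (p x.1) (hs x.1) (h.grid_pos x.1) _ _) ?_) hout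
    · exact length_flatMap_le _ _ fun G =>
        length_comb_rounds_le (p i) (hs i) (h.grid_pos i) _ _
    · exact comp_comb (s := fun x => (p x.1).s) h.bd_m.lift h.bd_grid.lift h.bd_net.lift
        h.grid.lift h.zeros.lift (fun x => h.grid_pos x.1)
        (h.bd_s.lift.mono fun x => hc x.1 x.2) (fun x => hc x.1 x.2) (fst hr)

end Rounds

end Comp

/-! ### The program for the initial data -/

section Lists

variable {m n : ℕ}

theorem single_kron (i : Fin m) (j : Fin n) :
    (Pi.single (finProdFinEquiv (i, j)) 1 : Fin (m * n) → ℝ) =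
      kron (Pi.single i 1) (Pi.single j 1) := by
  ext t
  obtain ⟨⟨a, b⟩, rfl⟩ := finProdFinEquiv.surjective t
  rw [kron_apply]
  simp only [Pi.single_apply, EmbeddingLike.apply_eq_iff_eq, Prod.mk.injEq]
  split_ifs <;> simp_all

theorem ofFn_mul_eq {α : Type*} (f : Fin (m * n) → α) :
    List.ofFn f = (List.ofFn fun i => List.ofFn fun j => f (finProdFinEquiv (i, j))).flatten := by
  rw [List.ofFn_mul]
  congr 2
  funext i
  congr 1
  funext j
  congr 1
  ext
  simp [finProdFinEquiv, add_comm, mul_comm]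

theorem unitVecs_mul (m n : ℕ) :
    unitVecs (m * n) = (unitVecs m).flatMap fun e => (unitVecs n).map (kron e) := by
  rw [unitVecs, ofFn_mul_eq, List.flatMap_def]
  simp only [single_kron, unitVecs, map_ofFn_eq]

theorem unitVecs_succ (n : ℕ) : unitVecs (n + 1) =
    (Fin.cons 1 0 : Fin (n + 1) → ℝ) :: (unitVecs n).map fun v => (Fin.cons 0 v : Fin (n + 1) → ℝ) := by
  rw [unitVecs, List.ofFn_succ, unitVecs, map_ofFn_eq]
  have h0 : (Pi.single 0 1 : Fin (n + 1) → ℝ) = (Fin.cons 1 0 : Fin (n + 1) → ℝ) := by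
    ext j
    refine Fin.cases ?_ (fun j => ?_) j <;> simp
  have h1 : ∀ i : Fin n, (Pi.single i.succ 1 : Fin (n + 1) → ℝ) =
      (Fin.cons 0 (Pi.single i 1) : Fin (n + 1) → ℝ) := by
    intro i
    ext j
    refine Fin.cases ?_ (fun j => ?_) j <;> simp [Pi.single_apply]
  simp only [h0, h1]

theorem ofFn_cnt_succ (m j : ℕ) : List.ofFn (cnt m (j + 1)) =
    (unitVecs m).flatMap fun e => (List.ofFn (cnt m j)).map (e + ·) := by
  have h := ofFn_mul_eq (m := m) (n := tdim m j) (cnt m (j + 1))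
  refine h.trans ?_
  rw [List.flatMap_def, unitVecs, map_ofFn_eq]
  simp only [map_ofFn_eq]
  congr 2
  funext i
  congr 1
  funext t
  have h1 := finProdFinEquiv.symm_apply_apply (i, t)
  show (Pi.single (finProdFinEquiv.symm (finProdFinEquiv (i, t))).1 1 : Fin m → ℝ) +
    cnt m j (finProdFinEquiv.symm (finProdFinEquiv (i, t))).2 = _
  rw [h1]

theorem vecVal_cons (a : ℝ) (v : Fin n → ℝ) :
    vecVal (Fin.cons a v : Fin (n + 1) → ℝ) = .node (.leaf a) (vecVal v) := by
  rw [vecVal, List.ofFn_cons, encList_cons, vecVal]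

open Classical in
/-- The number of entries of `C` equal to `c`. -/
noncomputable def multIn (C : List (Fin m → ℝ)) (c : Fin m → ℝ) : ℝ :=
  (C.map fun c' => if c = c' then 1 else 0).sum

theorem mult_eq (m d : ℕ) (t : Fin (tdim m d)) :
    mult m d t = multIn (List.ofFn (cnt m d)) (cnt m d t) := by
  rw [multIn, map_ofFn_eq, List.sum_ofFn, mult]

/-- The terms of a polynomial of degree `d`, as in its encoding. -/
noncomputable def terms (d : ℕ) (p : MvPolynomial (Fin m) ℝ) : List ((Fin m → ℝ) × ℝ) :=
  (List.Nat.antidiagonalTuple m d).map fun a =>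
    ((fun i => (a i : ℝ)), p.coeff (Finsupp.equivFunOnFinite.symm a))

theorem encodePoly_eq (d : ℕ) (p : MvPolynomial (Fin m) ℝ) :
    encodePoly d p = encList scoreVal (terms d p) := by
  simp [encodePoly, encList, terms, scoreVal, vecVal, Val.ofNat, Function.comp_def]

theorem indexCount_degree {d : ℕ} (α : Fin d → Fin m) : ∑ i, indexCount α i = d := by
  have h : (indexCount α).degree = d := by simp [indexCount, map_sum, Finsupp.degree_single]
  rwa [Finsupp.degree_eq_sum] at h

open Classical in
theorem tens_eq_terms (d : ℕ) (p : MvPolynomial (Fin m) ℝ) (t : Fin (tdim m d)) :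
    tens d p t = ((terms d p).map fun x => if cnt m d t = x.1 then x.2 else 0).sum /
      multIn (List.ofFn (cnt m d)) (cnt m d t) := by
  obtain ⟨α, rfl⟩ := (tupleEquiv m d).surjective t
  rw [← mult_eq, mult_tupleEquiv, tens, Equiv.symm_apply_apply, symTensor]
  congr 1
  have h1 : ∀ a : Fin m → ℕ, (cnt m d (tupleEquiv m d α) = fun i => (a i : ℝ)) ↔
      a = indexCount α := by
    intro a
    rw [funext_iff, funext_iff]
    refine forall_congr' fun i => ?_
    rw [cnt_tupleEquiv, Nat.cast_inj, eq_comm]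
  rw [terms, List.map_map]
  simp only [Function.comp_def, h1]
  rw [List.sum_map_ite_eq, List.count_eq_one_of_mem (List.Nat.nodup_antidiagonalTuple m d)
    (List.Nat.mem_antidiagonalTuple.2 (indexCount_degree α))]
  simp

/-- There are at most as many monomials as entries of the tensor. -/
theorem length_terms_le (d : ℕ) (p : MvPolynomial (Fin m) ℝ) :
    (terms d p).length ≤ tdim m d := by
  classical
  rw [terms, List.length_map,
    ← List.toFinset_card_of_nodup (List.Nat.nodup_antidiagonalTuple m d)]
  have h : (List.Nat.antidiagonalTuple m d).toFinset ⊆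
      Finset.univ.image fun t => (indexCount ((tupleEquiv m d).symm t) : Fin m → ℕ) := by
    intro a ha
    have ha' : ∑ i, a i = d := List.Nat.mem_antidiagonalTuple.1 (List.mem_toFinset.1 ha)
    have h1 := card_indexCount (d := d) (Finsupp.equivFunOnFinite.symm a)
      (by simpa [Finsupp.degree_eq_sum] using ha')
    have h2 : ((Finsupp.equivFunOnFinite.symm a).multinomial : ℝ) ≠ 0 := by
      rw [Finsupp.multinomial_eq]
      exact_mod_cast (Nat.multinomial_pos _ _).ne'
    rw [← h1, Nat.cast_ne_zero, Finset.card_ne_zero] at h2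
    obtain ⟨α, hα⟩ := h2
    refine Finset.mem_image.2 ⟨tupleEquiv m d α, Finset.mem_univ _, ?_⟩
    rw [Equiv.symm_apply_apply, (Finset.mem_filter.1 hα).2]
    rfl
  exact (Finset.card_le_card h).trans (Finset.card_image_le.trans (by simp))

end Lists

namespace Comp

variable {ι : Type*} {sz : ι → ℕ} {e : ι → Val} {m n d k : ι → ℕ}

theorem comp_vecs (hd : ∀ i, 0 < d i) (hdb : Bd sz d) (hkb : Bd sz k)
    (hdc : Comp sz e fun i => .leaf (d i)) (hkc : Comp sz e fun i => .leaf (k i)) :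
    Comp sz e fun i => .leaf (vecs (d i) (k i)) := by
  refine whileLoop (s := fun _ t => .leaf t)
    (((Bd.const 40).mul hkb).mono fun i => vecs_le (k i) (hd i)) (zero.congr fun _ => by simp)
    (ofProp_congr (not (le (mul (pow_nat hdb.lift hdc.lift (const 40)) hkc.lift)
      (pow_nat hdb.lift hdc.lift var))) fun x => ?_) ((add var one).congr fun x => by simp)
  rw [lt_vecs_iff (hd x.1), not_le]
  norm_cast

theorem comp_gridList {h : ι → ℝ} (hh : ∀ i, 0 < h i)
    (hl : Bd sz fun i => (gridList (h i)).length) (hc : Comp sz e fun i => .leaf (h i)) :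
    Comp sz e fun i => encList .leaf (gridList (h i)) := by
  have hK : Bd sz fun i => ⌊2 / h i⌋₊ + 1 := hl.mono fun i => (length_gridList (h i)).ge
  have hw := whileLoop (K := fun i => ⌊2 / h i⌋₊ + 1) (s := fun i t => .node (.leaf (-1 + t * h i))
    (encList .leaf ((List.range t).map fun t : ℕ => -1 + t * h i).reverse)) hK
    (node ((const (-1)).congr fun _ => by simp) (nil (encα := fun _ => Val.leaf)))
    (ofProp_congr (le (fst var) one) fun x => ?_)
    (node ((add (fst var) hc.lift).congr fun x => ?_)
      ((node (fst var) (snd var)).congr fun x => ?_))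
  · refine (reverse (encα := fun _ => Val.leaf) ?_ (snd hw)).congr fun i => ?_
    · simpa using hK
    · rw [List.reverse_reverse]
      rfl
  · have h0 := hh x.1
    rw [Nat.lt_succ_iff, Nat.le_floor_iff (by positivity), le_div_iff₀ h0]
    constructor <;> intro h <;> linarith
  · push_cast
    ring_nf
  · rw [List.range_succ]
    simp

theorem comp_zero (hn : Bd sz n) (hc : Comp sz e fun i => .leaf (n i)) :
    Comp sz e fun i => vecVal (0 : Fin (n i) → ℝ) := by
  refine loop (s := fun _ t => vecVal (0 : Fin t → ℝ)) hn hc zero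
    ((node zero var).congr fun x => ?_)
  rw [← vecVal_cons]
  congr 1
  ext j
  refine Fin.cases ?_ (fun j => ?_) j <;> simp

theorem comp_unitVecs (hn : Bd sz n) (hc : Comp sz e fun i => .leaf (n i)) :
    Comp sz e fun i => encList vecVal (unitVecs (n i)) := by
  have h := loop (s := fun _ t => .node (vecVal (0 : Fin t → ℝ)) (encList vecVal (unitVecs t)))
    hn hc (node zero (zero.congr fun _ => by simp [unitVecs])) (node ?_ ?_)
  · exact snd h
  · refine (node zero (fst var)).congr fun x => ?_
    rw [← vecVal_cons]
    congr 1
    ext j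
    refine Fin.cases ?_ (fun j => ?_) j <;> simp
  · refine (cons (α := fun x : (i : ι) × Fin (n i) => Fin (x.2 + 1) → ℝ)
      (encα := fun _ => vecVal) (x := fun x => Fin.cons 1 0)
      (l := fun x => (unitVecs x.2).map fun v => (Fin.cons 0 v : Fin (x.2 + 1) → ℝ))
      ((node one (fst var)).congr fun x => (vecVal_cons _ _).symm)
      (map (α := fun x : (i : ι) × Fin (n i) => Fin x.2 → ℝ) (β := fun x => Fin (x.2 + 1) → ℝ)
        (encα := fun _ => vecVal) (encβ := fun _ => vecVal)
        (F := fun x v => Fin.cons 0 v) (hn.lift.mono fun x => ?_) (snd var)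
        ((node zero var).congr fun x => (vecVal_cons _ _).symm))).congr fun x => ?_
    · simp [unitVecs]
    · rw [unitVecs_succ]

/-- The standard bases of the tensor spaces: that of order `d`, and the list of those of lower
order. -/
theorem comp_ids (hm : Bd sz m) (hN : Bd sz fun i => tdim (m i) (d i)) (hd : Bd sz d)
    (hm1 : ∀ i, 0 < m i) (hdc : Comp sz e fun i => .leaf (d i))
    (hu : Comp sz e fun i => encList vecVal (unitVecs (m i))) :
    Comp sz e fun i => .node (encList vecVal (unitVecs (tdim (m i) (d i))))
      (encList (fun j => encList vecVal (unitVecs (tdim (m i) j))) (List.range (d i)).reverse) := by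
  have hle : Bd (fun x : (i : ι) × Fin (d i) => sz x.1) fun x => tdim (m x.1) x.2 :=
    hN.lift.mono fun x => by
      rw [tdim_eq, tdim_eq]
      exact Nat.pow_le_pow_right (hm1 _) x.2.2.le
  refine loop (s := fun i t => .node (encList vecVal (unitVecs (tdim (m i) t)))
    (encList (fun j => encList vecVal (unitVecs (tdim (m i) j))) (List.range t).reverse)) hd hdc
    (node ?_ (nil (encα := fun i j => encList vecVal (unitVecs (tdim (m i) j))))) (node ?_ ?_)
  · refine (cons (α := fun _ => Fin 1 → ℝ) (encα := fun _ => vecVal) (x := fun _ _ => 1)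
      (l := fun _ => []) (node one zero) nil).congr fun i => ?_
    have : unitVecs 1 = [fun _ => (1 : ℝ)] := by
      simp only [unitVecs, List.ofFn_succ, List.ofFn_zero]
      congr 1
      ext j
      simp [Subsingleton.elim j 0]
    rw [show tdim (m i) 0 = 1 from rfl, this]
  · refine (flatMap (l := fun x : (i : ι) × Fin (d i) => unitVecs (m x.1))
      (encα := fun _ => vecVal) (encβ := fun _ => vecVal)
      (F := fun x e => (unitVecs (tdim (m x.1) x.2)).map (kron e))
      (by simpa [unitVecs] using hm.lift) hu.lift (by simpa [unitVecs] using hle.lift)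
      (comp_kronUnits (m := fun x : (x : (i : ι) × Fin (d i)) × (Fin (m x.1) → ℝ) => m x.1.1)
        hm.lift.lift hle.lift (weak (fst var)) var)).congr fun x => ?_
    rw [← unitVecs_mul]
  · refine (cons (encα := fun (x : (i : ι) × Fin (d i)) j =>
      encList vecVal (unitVecs (tdim (m x.1) j))) (x := fun x => (x.2 : ℕ)) (fst var)
      (snd var)).congr fun x => ?_
    rw [List.range_succ]
    simp

theorem comp_cnt (hm : Bd sz m) (hN : Bd sz fun i => tdim (m i) (d i)) (hd : Bd sz d)
    (hm1 : ∀ i, 0 < m i) (hdc : Comp sz e fun i => .leaf (d i))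
    (hz : Comp sz e fun i => vecVal (0 : Fin (m i) → ℝ))
    (hu : Comp sz e fun i => encList vecVal (unitVecs (m i))) :
    Comp sz e fun i => encList vecVal (List.ofFn (cnt (m i) (d i))) := by
  have hle : Bd (fun x : (i : ι) × Fin (d i) => sz x.1) fun x => tdim (m x.1) x.2 :=
    hN.lift.mono fun x => by
      rw [tdim_eq, tdim_eq]
      exact Nat.pow_le_pow_right (hm1 _) x.2.2.le
  refine loop (s := fun i t => encList vecVal (List.ofFn (cnt (m i) t))) hd hdc
    (cons (encα := fun _ => vecVal) hz nil) ?_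
  refine (flatMap (l := fun x : (i : ι) × Fin (d i) => unitVecs (m x.1))
    (encα := fun _ => vecVal) (encβ := fun _ => vecVal)
    (F := fun x e => (List.ofFn (cnt (m x.1) x.2)).map (e + ·))
    (by simpa [unitVecs] using hm.lift) hu.lift (by simpa using hle.lift)
    (map (l := fun x : (x : (i : ι) × Fin (d i)) × (Fin (m x.1) → ℝ) =>
      List.ofFn (cnt (m x.1.1) x.1.2)) (encα := fun _ => vecVal) (encβ := fun _ => vecVal)
      (F := fun x c => x.2 + c) (by simpa using hle.lift) (weak var)
      (vecAdd hm.lift.lift.lift (weak var) var))).congr fun x => ?_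
  rw [ofFn_cnt_succ]

theorem ofProp_vecEq {v w : ∀ i, Fin (n i) → ℝ} (hn : Bd sz n)
    (hv : Comp sz e fun i => vecVal (v i)) (hw : Comp sz e fun i => vecVal (w i)) :
    Comp sz e fun i => Val.ofProp (v i = w i) :=
  ofProp_congr (le (dot hn (vecSub hn hv hw) (vecSub hn hv hw)) zero) fun i => by
    rw [(dot_sq_nonneg _).ge_iff_eq', dotProduct_self_eq_zero, sub_eq_zero]

theorem leaf_ite {p : ι → Prop} [∀ i, Decidable (p i)] {x y : ι → ℝ}
    (hp : Comp sz e fun i => Val.ofProp (p i))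
    (hx : Comp sz e fun i => .leaf (x i)) (hy : Comp sz e fun i => .leaf (y i)) :
    Comp sz e fun i => .leaf (if p i then x i else y i) :=
  (ite hp hx hy).congr fun i => by split_ifs <;> rfl

theorem comp_multIn {C : ∀ i, List (Fin (m i) → ℝ)} {c : ∀ i, Fin (m i) → ℝ} (hm : Bd sz m)
    (hl : Bd sz fun i => (C i).length) (hC : Comp sz e fun i => encList vecVal (C i))
    (hc : Comp sz e fun i => vecVal (c i)) : Comp sz e fun i => .leaf (multIn (C i) (c i)) := by
  classical
  refine (listSum (encα := fun _ => vecVal) (F := fun i c' => if c i = c' then (1 : ℝ) else 0) hl hC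
    (leaf_ite (ofProp_vecEq hm.lift hc.lift var) one zero)).congr fun i => ?_
  rw [multIn]

theorem comp_symProj (hm : Bd sz m) (hN : Bd sz fun i => tdim (m i) (d i))
    (hC : Comp sz e fun i => encList vecVal (List.ofFn (cnt (m i) (d i)))) :
    Comp sz e fun i => matVal (symProj (m i) (d i)) := by
  classical
  have hl : Bd sz fun i => (List.ofFn (cnt (m i) (d i))).length := by simpa using hN
  have hmu : Comp (fun x : (i : ι) × (Fin (m i) → ℝ) => sz x.1)
      (fun x => .node (vecVal x.2) (e x.1))
      fun x => .leaf (multIn (List.ofFn (cnt (m x.1) (d x.1))) x.2) :=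
    comp_multIn hm.lift hl.lift hC.lift var
  refine (map (encα := fun _ => vecVal) (encβ := fun _ => encList .leaf)
    (F := fun i c => (List.ofFn (cnt (m i) (d i))).map fun c' =>
      if c = c' then 1 / multIn (List.ofFn (cnt (m i) (d i))) c else 0) hl hC
    (map (l := fun x : (i : ι) × (Fin (m i) → ℝ) => List.ofFn (cnt (m x.1) (d x.1)))
      (encα := fun _ => vecVal) (encβ := fun _ => Val.leaf)
      (F := fun x c' => if x.2 = c' then
        1 / multIn (List.ofFn (cnt (m x.1) (d x.1))) x.2 else 0) hl.lift hC.lift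
      (leaf_ite (ofProp_vecEq hm.lift.lift (weak var) var)
        (div one hmu.lift) zero))).congr fun i => ?_
  simp only [matVal, vecVal, encList, map_ofFn_eq, symProj, of_apply, mult_eq]

theorem comp_tens {p : ∀ i, MvPolynomial (Fin (m i)) ℝ} (hm : Bd sz m)
    (hN : Bd sz fun i => tdim (m i) (d i))
    (hC : Comp sz e fun i => encList vecVal (List.ofFn (cnt (m i) (d i))))
    (hp : Comp sz e fun i => encodePoly (d i) (p i)) :
    Comp sz e fun i => vecVal (tens (d i) (p i)) := by
  classical
  have hl : Bd sz fun i => (List.ofFn (cnt (m i) (d i))).length := by simpa using hN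
  have ht : Comp sz e fun i => encList scoreVal (terms (d i) (p i)) :=
    hp.congr fun i => encodePoly_eq _ _
  have hs : Comp (fun x : (i : ι) × (Fin (m i) → ℝ) => sz x.1)
      (fun x => .node (vecVal x.2) (e x.1))
      fun x => .leaf ((terms (d x.1) (p x.1)).map
        fun y => if x.2 = y.1 then y.2 else (0 : ℝ)).sum :=
    listSum (l := fun x : (i : ι) × (Fin (m i) → ℝ) => terms (d x.1) (p x.1))
      (encα := fun _ => scoreVal) (F := fun x y => if x.2 = y.1 then y.2 else (0 : ℝ))
      (hN.lift.mono fun x => length_terms_le _ _) ht.lift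
      (leaf_ite (ofProp_vecEq hm.lift.lift (weak var) (fst var)) (snd var) zero)
  refine (map (encα := fun _ => vecVal) (encβ := fun _ => Val.leaf)
    (F := fun i c => ((terms (d i) (p i)).map fun y => if c = y.1 then y.2 else (0 : ℝ)).sum /
      multIn (List.ofFn (cnt (m i) (d i))) c) hl hC
    (div hs (comp_multIn hm.lift hl.lift hC.lift var))).congr fun i => ?_
  rw [vecVal, map_ofFn_eq]
  congr 2
  funext t
  rw [tens_eq_terms]

theorem comp_spread {Λ σ : ι → ℝ} {P : ∀ i, Matrix (Fin (n i)) (Fin (n i)) ℝ} (hn : Bd sz n)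
    (hΛ : Comp sz e fun i => .leaf (Λ i)) (hσ : Comp sz e fun i => .leaf (σ i))
    (hP : Comp sz e fun i => matVal (P i))
    (hu : Comp sz e fun i => encList vecVal (unitVecs (n i))) :
    Comp sz e fun i => matVal (spread (Λ i) (σ i) (P i)) := by
  refine (zipWith (l := fun i => List.ofFn fun j => P i j) (l' := fun i => unitVecs (n i))
    (encα := fun _ => vecVal) (encβ := fun _ => vecVal) (encγ := fun _ => vecVal)
    (F := fun i r u => (Λ i - σ i) • r + σ i • u) (by simpa using hn) hP hu
    (vecAdd (n := fun x : (i : ι) × (Fin (n i) → ℝ) × (Fin (n i) → ℝ) => n x.1) hn.lift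
      (vecSmul hn.lift (sub hΛ.lift₂ hσ.lift₂) var)
      (vecSmul hn.lift hσ.lift₂ (weak var)))).congr fun i => ?_
  rw [unitVecs, zipWith_ofFn, matVal]
  congr 2
  funext j
  ext l
  simp [spread, one_apply, Pi.single_apply, eq_comm]

end Comp

/-! ### The program for the covering problem -/

namespace Input

open NearZeroCover.Comp

/-- The size of an input: the bound on the size of the cover. -/
noncomputable def size (I : Input) : ℕ := ⌈coverBound 100 I.d I.k I.m I.R I.ε⌉₊

/-- The input as a datum of the machine. -/
noncomputable def datum (I : Input) : Val :=
  encodeInput I.d I.k I.R I.ε I.δ fun j => (I.basis j : MvPolynomial (Fin I.m) ℝ)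

theorem le_size_of_cast_le {I : Input} {a : ℕ}
    (h : (a : ℝ) ≤ coverBound 100 I.d I.k I.m I.R I.ε) : a ≤ I.size := by
  have := h.trans (Nat.le_ceil _)
  exact_mod_cast this

theorem mul_branching_le (I : Input) : I.d * I.branching ^ I.d ≤ I.size := by
  refine le_size_of_cast_le ?_
  push_cast
  exact I.branching_pow_le

theorem branching_pos (I : Input) : 0 < I.branching :=
  Nat.mul_pos I.m_pos (Nat.pow_pos I.one_le_grid)

theorem branching_pow_le_size (I : Input) {t : ℕ} (ht : t ≤ I.d) : I.branching ^ t ≤ I.size :=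
  (Nat.pow_le_pow_right I.branching_pos ht).trans
    ((Nat.le_mul_of_pos_left _ I.d_pos).trans I.mul_branching_le)

theorem branching_le_size (I : Input) : I.branching ≤ I.size := by
  have h := I.branching_pow_le_size (t := 1) I.d_pos
  rwa [pow_one] at h

theorem bd_m : Bd size fun I => I.m := Bd.self.mono fun I =>
  (Nat.le_mul_of_pos_right _ (Nat.pow_pos I.one_le_grid)).trans I.branching_le_size

theorem bd_net : Bd size fun I => I.params.grid.length ^ I.params.s := Bd.self.mono fun I =>
  (Nat.le_mul_of_pos_left _ I.m_pos).trans I.branching_le_size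

theorem bd_grid : Bd size fun I => I.params.grid.length := bd_net.mono fun I =>
  Nat.le_self_pow (vecs_pos I.d_pos I.k_pos).ne' _

theorem bd_d : Bd size fun I => I.d := Bd.self.mono fun I =>
  (Nat.le_mul_of_pos_right _ (Nat.pow_pos I.branching_pos)).trans I.mul_branching_le

theorem bd_tdim : Bd size fun I => tdim I.m I.d := Bd.self.mono fun I => by
  rw [tdim_eq]
  exact (Nat.pow_le_pow_left (Nat.le_mul_of_pos_right _ (Nat.pow_pos I.one_le_grid)) _).trans
    (I.branching_pow_le_size le_rfl)

theorem bd_k : Bd size fun I => I.k := Bd.self.mono fun I => by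
  refine le_size_of_cast_le ?_
  have hk := I.one_le_k
  have hd := I.one_le_d
  have h1 : (I.k : ℝ) ≤ I.base := by linarith [I.le_base.2.1]
  refine h1.trans ?_
  have h2 : (1 : ℝ) ≤ 100 ^ 2 * (I.d : ℝ) ^ 2 * (I.k : ℝ) ^ (1 / (I.d : ℝ)) := by
    have h3 : (1 : ℝ) ≤ (I.k : ℝ) ^ (1 / (I.d : ℝ)) := Real.one_le_rpow hk (by positivity)
    have h4 : (1 : ℝ) ≤ (I.d : ℝ) ^ 2 := one_le_pow₀ hd
    exact one_le_mul_of_one_le_of_one_le (one_le_mul_of_one_le_of_one_le (by norm_num) h4) h3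
  rw [coverBound, ← base]
  exact Real.self_le_rpow_of_one_le (by linarith [I.two_le_base]) h2

theorem bd_s : Bd size fun I => I.params.s :=
  ((Bd.const 40).mul bd_k).mono fun I => vecs_le I.k I.d_pos

/-- There are at most as many polynomials as entries of a tensor. -/
theorem bd_n : Bd size fun I => I.n := bd_tdim.mono fun I => by
  have hli : LinearIndependent ℝ fun j => tens I.d (I.basis j : MvPolynomial (Fin I.m) ℝ) := by
    have h2 : LinearIndependent ℝ (((tensMap I.m I.d).comp I.V.subtype) ∘ I.basis) := by
      refine I.basis.linearIndependent.map' _ (LinearMap.ker_eq_bot'.2 fun p hp => ?_)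
      exact Subtype.ext (tens_eq_zero (I.hV p.2) hp)
    exact h2
  simpa using hli.fintype_card_le_finrank

theorem comp_d : Comp size datum fun I => .leaf (I.d : ℝ) := id.trans (op .left)

theorem comp_k : Comp size datum fun I => .leaf (I.k : ℝ) :=
  (id.trans (op .right)).trans (op .left)

theorem comp_m : Comp size datum fun I => .leaf (I.m : ℝ) :=
  ((id.trans (op .right)).trans (op .right)).trans (op .left)

theorem comp_R : Comp size datum fun I => .leaf I.R :=
  (((id.trans (op .right)).trans (op .right)).trans (op .right)).trans (op .left)

theorem comp_ε : Comp size datum fun I => .leaf I.ε :=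
  ((((id.trans (op .right)).trans (op .right)).trans (op .right)).trans (op .right)).trans
    (op .left)

theorem comp_polys : Comp size datum fun I => encList (encodePoly I.d)
    (List.ofFn fun j => (I.basis j : MvPolynomial (Fin I.m) ℝ)) := by
  have h : Comp size datum fun I => .ofList
      (List.ofFn fun j => encodePoly I.d (I.basis j : MvPolynomial (Fin I.m) ℝ)) :=
    ((((((id.trans (op .right)).trans (op .right)).trans (op .right)).trans (op .right)).trans
      (op .right)).trans (op .right)).trans (op .left)
  exact h.congr fun I => by rw [encList, map_ofFn_eq]

theorem comp_base : Comp size datum fun I => .leaf I.base :=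
  mul (mul (mul (mul ((const 2).congr fun _ => by norm_num) (div comp_R comp_ε)) comp_d) comp_k)
    comp_m

theorem comp_s : Comp size datum fun I => .leaf (I.params.s : ℝ) :=
  comp_vecs (fun I => I.d_pos) bd_d bd_k comp_d comp_k

theorem comp_grid : Comp size datum fun I => encList .leaf I.params.grid :=
  comp_gridList (fun I => I.spacing_pos) bd_grid (div one (pow_nat bd_d comp_d (pow 20 comp_base)))

theorem comp_tol : Comp size datum fun I => .leaf I.params.tol :=
  div ((const 2).congr fun _ => by norm_num) (pow 5 comp_base)

theorem comp_K : Comp size datum fun I => NearZeroCover.unary (I.m + 1 - I.params.s) := by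
  classical
  refine Comp.unary ((bd_m.add (Bd.const 1)).mono fun I => Nat.sub_le _ _)
    ((leaf_ite (le comp_s (add comp_m one)) (sub (add comp_m one) comp_s) zero).congr fun I => ?_)
  split_ifs with h
  · have h' : I.params.s ≤ I.m + 1 := by exact_mod_cast h
    rw [Nat.cast_sub h']
    push_cast
    rfl
  · have h' : ¬ I.params.s ≤ I.m + 1 := fun h' => h (by exact_mod_cast h')
    rw [Nat.sub_eq_zero_of_le (by omega), Nat.cast_zero]

theorem comp_zeros : Comp size datum fun I => vecVal (0 : Fin I.m → ℝ) := comp_zero bd_m comp_m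

theorem comp_units : Comp size datum fun I => encList vecVal (unitVecs I.m) :=
  comp_unitVecs bd_m comp_m

theorem comp_allIds : Comp size datum fun I =>
    .node (encList vecVal (unitVecs (tdim I.m I.d)))
      (encList (fun j => encList vecVal (unitVecs (tdim I.m j))) (List.range I.d).reverse) :=
  comp_ids bd_m bd_tdim bd_d (fun I => I.m_pos) comp_d comp_units

theorem comp_residual : Comp size datum fun I => matVal (residual I.m I.d I.tensors) := by
  have hC := comp_cnt bd_m bd_tdim bd_d (fun I => I.m_pos) comp_d comp_zeros comp_units
  have hl : Bd size fun I =>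
      (List.ofFn fun j => (I.basis j : MvPolynomial (Fin I.m) ℝ)).length := by simpa using bd_n
  have ht : Comp size datum fun I => encList vecVal I.tensors :=
    (map (encα := fun I => encodePoly I.d) (encβ := fun _ => vecVal)
      (F := fun I => tens I.d) hl comp_polys
      (comp_tens bd_m.lift bd_tdim.lift hC.lift var)).congr fun I => by
        rw [map_ofFn_eq, tensors]
  exact foldl_upd bd_tdim zero (bd_n.mono fun I => by simp [tensors]) ht
    (comp_symProj bd_m bd_tdim hC)

theorem comp_start : Comp size datum fun I => levelVal I.start :=
  node (add comp_k one) (node (cons (encα := fun _ => matVal)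
    (comp_spread bd_tdim (pow_nat bd_d comp_d (pow 26 comp_base))
      (div one (pow_nat bd_d comp_d comp_m)) comp_residual (fst comp_allIds)) nil) nil)

theorem step_prefix {D : ℕ} {q : List ℕ × ℕ} (h : q.1 ++ [q.2] <+: (List.range D).reverse) :
    q.1.length < D ∧ q.2 = D - 1 - q.1.length := by
  have h1 := h.length_le
  simp only [List.length_append, List.length_singleton, List.length_reverse,
    List.length_range] at h1
  refine ⟨by omega, ?_⟩
  have h2 := h.getElem (i := q.1.length) (by simp)
  simpa using h2

theorem comp_levels : Comp size datum fun I => levelVal ((Level.step I.params)^[I.d] I.start) := by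
  refine (foldl' (l := fun I => (List.range I.d).reverse)
    (encα := fun I j => encList vecVal (unitVecs (tdim I.m j))) (encβ := fun _ => levelVal)
    (F := fun I X _ => Level.step I.params X) (b₀ := start) (by simpa using bd_d)
    (snd comp_allIds) comp_start ?_).congr fun I => ?_
  · let T := (I : Input) × {q : List ℕ × ℕ // q.1 ++ [q.2] <+: (List.range I.d).reverse}
    have hT : ∀ x : T, ∃ κ S out, (Level.step x.1.params)^[x.2.1.1.length] x.1.start =
        ⟨x.2.1.2 + 1, κ, S, out⟩ := by
      intro x
      have h1 := Level.iterate_j x.1.params x.1.start x.2.1.1.length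
      obtain ⟨h2, h3⟩ := step_prefix x.2.2
      generalize (Level.step x.1.params)^[x.2.1.1.length] x.1.start = Y at h1 ⊢
      obtain ⟨j, κ, S, out⟩ := Y
      obtain rfl : j = x.2.1.2 + 1 := by
        change j = x.1.d - x.2.1.1.length at h1
        omega
      exact ⟨κ, S, out, rfl⟩
    choose κ S out hY using hT
    have hacc : ∀ x : T, x.2.1.1.foldl (fun X _ => Level.step x.1.params X) x.1.start =
        ⟨x.2.1.2 + 1, κ x, S x, out x⟩ := fun x => by rw [List.foldl_const, hY]
    have hlen : Bd (fun x : T => x.1.size) fun x => (S x).length := by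
      refine Bd.self.mono fun x => ?_
      have h1 := Level.length_S_le x.1.params (vecs_pos x.1.d_pos x.1.k_pos) x.1.one_le_grid
        x.1.m_pos x.1.start x.2.1.1.length
      rw [hY] at h1
      refine h1.trans ?_
      rw [show x.1.start.S.length = 1 from rfl, one_mul]
      exact x.1.branching_pow_le_size (step_prefix x.2.2).1.le
    have hdim : Bd (fun x : T => x.1.size) fun x => tdim x.1.m x.2.1.2 := by
      refine (bd_tdim.lift (κ := fun I => {q : List ℕ × ℕ //
        q.1 ++ [q.2] <+: (List.range I.d).reverse})).mono fun x => ?_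
      rw [tdim_eq, tdim_eq]
      obtain ⟨h2, h3⟩ := step_prefix x.2.2
      exact Nat.pow_le_pow_right x.1.m_pos (by omega)
    simp only [hacc]
    have hκ : Comp (fun x : T => x.1.size) (fun x => .node (encList vecVal
        (unitVecs (tdim x.1.m x.2.1.2))) (.node (levelVal ⟨x.2.1.2 + 1, κ x, S x, out x⟩)
          (datum x.1))) fun x => .leaf (κ x) := fst (weak var)
    refine Setup.step (m := fun x : T => x.1.m) (p := fun x => x.1.params) (κ₀ := κ) ?_
      (fun x => vecs_pos x.1.d_pos x.1.k_pos) hlen (fst (snd (weak var)))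
      (snd (snd (weak var)))
    exact
      { bd_m := bd_m.lift
        bd_n := hdim
        bd_s := bd_s.lift
        bd_grid := bd_grid.lift
        bd_net := bd_net.lift
        grid_pos := fun x => x.1.one_le_grid
        units := comp_units.lift₂
        ids := var
        zeros := comp_zeros.lift₂
        s := (Comp.unary bd_s comp_s).lift₂
        K := comp_K.lift₂
        β := (pow 18 comp_base).lift₂
        grid := comp_grid.lift₂
        tol := comp_tol.lift₂
        κ := div (mul ((const 5).congr fun _ => by norm_num) hκ) comp_s.lift₂ }
  · rw [List.foldl_const, List.length_reverse, List.length_range]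

/-- The cover is computed in time polynomial in the bound on its size. -/
theorem comp_points : Comp size datum fun I => encodePoints I.points := by
  have hl : Bd size fun I => ((Level.step I.params)^[I.d] I.start).out.length :=
    Bd.self.mono fun I => le_size_of_cast_le (by
      have := I.length_points_le
      rwa [points, List.length_map] at this)
  refine (map (encα := fun _ => vecVal) (encβ := fun _ => vecVal) (F := fun I q => I.R • q) hl
    (snd (snd comp_levels)) (vecSmul bd_m.lift comp_R.lift var)).congr fun I => ?_
  rw [encodePoints, points, encList, List.map_map, List.map_map]
  congr 2
  funext q
  simp only [Function.comp_apply, encodePoint, vecVal, encList, map_ofFn_eq]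

end Input

end NearZeroCover

/-- There are a universal constant `C > 0`, one program `P` and one polynomial `q` such that, for
all parameters and every basis `b` of the space `V`, the program halts within `q(M)` steps and
outputs a list of at most `M` points that form an `ε`-cover of `S(V, R, δ)`. -/
theorem theorem3p5 :
    ∃ (C : ℝ) (P : NearZeroCover.Prog) (q : Polynomial ℝ), 0 < C ∧
      ∀ (d k m : ℕ), 0 < d → 0 < k → 0 < m →
      ∀ V : Submodule ℝ (MvPolynomial (Fin m) ℝ),
        V ≤ MvPolynomial.homogeneousSubmodule (Fin m) ℝ d →
        Module.finrank ℝ (MvPolynomial.homogeneousSubmodule (Fin m) ℝ d)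
          ≤ Module.finrank ℝ V + k →
      ∀ (n : ℕ) (b : Module.Basis (Fin n) ℝ V) (R ε δ : ℝ), 0 < R → 0 < δ → ε ≤ R →
        δ ^ (1 / ((C + 1) * d)) * (2 * R * d * k * m) ^ (C / (C + 1)) ≤ ε →
      ∃ (pts : List (EuclideanSpace ℝ (Fin m))) (t : ℕ),
        NearZeroCover.Run P (NearZeroCover.encodeInput d k R ε δ fun j => (b j : MvPolynomial (Fin m) ℝ))
          (NearZeroCover.encodePoints pts) t ∧
        Metric.IsCover ε.toNNReal (NearZeroCover.nearZeroSet d V R δ) {x | x ∈ pts} ∧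
        (pts.length : ℝ) ≤ NearZeroCover.coverBound C d k m R ε ∧
        (t : ℝ) ≤ q.eval (NearZeroCover.coverBound C d k m R ε) := by
  obtain ⟨P, c, hP⟩ := NearZeroCover.Input.comp_points
  -- `+ 3` and not `+ 2`: the size of an input is `M` rounded up.
  refine ⟨100, P, (Polynomial.X + 3) ^ c, by norm_num, ?_⟩
  intro d k m hd hk hm V hV hcodim n b R ε δ hR hδ hεR hε
  let I : NearZeroCover.Input := ⟨d, k, m, hd, hk, hm, V, hV, hcodim, n, b, R, ε, δ, hR, hδ, hεR, hε⟩
  obtain ⟨t, hrun, ht⟩ := hP I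
  refine ⟨I.points, t, hrun, I.isCover_points, I.length_points_le, ?_⟩
  have h0 : 0 ≤ NearZeroCover.coverBound 100 d k m R ε :=
    (Nat.cast_nonneg _).trans I.length_points_le
  have h1 : (I.size : ℝ) ≤ NearZeroCover.coverBound 100 d k m R ε + 1 := (Nat.ceil_lt_add_one h0).le
  have h2 : (t : ℝ) ≤ ((I.size : ℝ) + 2) ^ c := by exact_mod_cast ht
  simp only [Polynomial.eval_pow, Polynomial.eval_add, Polynomial.eval_X, Polynomial.eval_ofNat]
  exact h2.trans (pow_le_pow_left₀ (by positivity) (by linarith) c)
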